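/- Let $\mathbb{R}[x,y,z]_3$ be the space of real ternary cubic forms, with its Euclidean topology. The real rank $\mathrm{rk}_{\mathbb R}(f)$ of $f\in\mathbb{R}[x,y,z]_3$ is the least integer $r\ge 0$ such that $f=\sum_{i=1}^r c_i\,l_i^3$ with $c_i\in\mathbb{R}$ and $l_i$ real linear forms. The real border rank $\underline{\mathrm{rk}}_{\mathbb R}(f)$ is the least positive integer $r$ such that $f=\lim_{\varepsilon\to0}f_\varepsilon$ for a family of real cubic forms $f_\varepsilon$, each of real rank $r$. An integer $r$ is a typical real rank if the forms of real rank $r$ contain a nonempty open subset of $\mathbb{R}[x,y,z]_3$. Two forms are called equivalent if they agree up to a change of variables in $SL(3,\mathbb{R})$ and a nonzero real factor. **Theorem.** Every nonzero real ternary cubic form is equivalent to a normal form in exactly one of the following sixteen rows, and its real rank and real border rank are those of that row. | | description | normal form | $\mathrm{rk}_{\mathbb R}$ | $\underline{\mathrm{rk}}_{\mathbb R}$ | |---|---|---|---|---| | 1 | triple line | $x^3$ | 1 | 1 | | 2 | imaginary concurrent lines | $x(x^2+y^2)$ | 2 | 2 | | 3 | real concurrent lines | $x(x^2-y^2)$ |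 3 | 3 | | 4 | double line and line | $x^2y$ | 3 | 2 | | 5 | imaginary conic and line | $(x^2+y^2+z^2)x$ | 4 | 4 | | 6 | real conic and external line | $(x^2+y^2-z^2)z$ | 5 | 4 | | 7 | real conic and secant line | $(x^2+y^2-z^2)y$ | 4 | 4 | | 8 | real conic and tangent line | $18y(x^2+yz)$ | 5 | 3 | | 9 | real Fermat cubic | $x^3+y^3+z^3$ | 3 | 3 | | 10 | imaginary Fermat cubic | $x^3+y^3+z^3+6xyz$ | 4 | 4 | | 11 | Hesse pencil, $\lambda\in\mathbb{R}\setminus\{-\frac12,0,1\}$ | $x^3+y^3+z^3+6\lambda xyz$ | 4 | 4 | | 12 | imaginary triangle | $x^3+y^3+z^3-3xyz$ | 5 | 4 | | 13 | cuspidal cubic | $y^2z-x^3$ | 4 | 3 | | 14 | nodal cubic | $x^3+y^3+6xyz$ | 4 | 4 | | 15 | cubic with an isolated real double point | $y^2z-x^3+x^2z$ | 4 | 4 | | 16 | real triangle | $xyz$ | 4 | 4 | In particular the maximal real rank of a real ternary cubic form is 5, and it is attained exactly by the forms equivalent to those of rows 6, 8 and 12. Moreover 4 is the only typical real rank of real ternary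 cubic forms. -/

import Mathlib

open MvPolynomial Filter Topology

/-- Real forms (homogeneous polynomials) of degree `d` in `n` variables. -/
abbrev RealForm (n d : ℕ) : Type :=
  ↥(MvPolynomial.homogeneousSubmodule (Fin n) ℝ d)

/-- The family of all coefficients of a real form. -/
noncomputable def formCoeffs {n d : ℕ} (f : RealForm n d) : (Fin n →₀ ℕ) → ℝ :=
  fun m => MvPolynomial.coeff m (f : MvPolynomial (Fin n) ℝ)

/-- The Euclidean topology on the finite-dimensional space of real forms: the topology of
convergence of all coefficients. -/
@[reducible] noncomputable def formTopology (n d : ℕ) : TopologicalSpace (RealForm n d) :=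
  TopologicalSpace.induced formCoeffs inferInstance

/-- `f` is a real linear combination of `r` `d`-th powers of real linear forms. -/
def IsSumOfPowers {n d : ℕ} (f : RealForm n d) (r : ℕ) : Prop :=
  ∃ (c : Fin r → ℝ) (l : Fin r → RealForm n 1),
    (f : MvPolynomial (Fin n) ℝ) = ∑ i, C (c i) * (l i : MvPolynomial (Fin n) ℝ) ^ d

/-- The real (Waring, symmetric) rank of `f` is `r`. -/
def IsRealRank {n d : ℕ} (f : RealForm n d) (r : ℕ) : Prop :=
  IsLeast {s : ℕ | IsSumOfPowers f s} r

/-- `f` is the limit, as `ε → 0`, of a family of real forms, each of real rank `r`. -/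
def IsLimitOfRank {n d : ℕ} (f : RealForm n d) (r : ℕ) : Prop :=
  ∃ P : ℝ → RealForm n d, (∀ ε : ℝ, 0 < ε → IsRealRank (P ε) r) ∧
    Tendsto (fun ε => formCoeffs (P ε)) (𝓝[>] 0) (𝓝 (formCoeffs f))

/-- The real border rank of `f` is `r`. -/
def IsRealBorderRank {n d : ℕ} (f : RealForm n d) (r : ℕ) : Prop :=
  IsLeast {s : ℕ | 0 < s ∧ IsLimitOfRank f s} r

/-- `r` is a typical real rank of forms of degree `d` in `n` variables: the forms of real rank `r`
fill a nonempty open set of the space of forms. -/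
def IsTypicalRealRank (n d r : ℕ) : Prop :=
  ∃ U : Set (RealForm n d), IsOpen[formTopology n d] U ∧ U.Nonempty ∧ ∀ f ∈ U, IsRealRank f r

/-- The linear change of variables given by `A`: the `i`-th variable is replaced by
`∑ j, A i j * X j`. -/
noncomputable def linearSubst {n : ℕ} (A : Matrix.SpecialLinearGroup (Fin n) ℝ)
    (p : MvPolynomial (Fin n) ℝ) : MvPolynomial (Fin n) ℝ :=
  aeval (fun i => ∑ j, C ((A : Matrix (Fin n) (Fin n) ℝ) i j) * X j) p

/-- `p` and `q` define the same projective hypersurface up to `SL(n, ℝ)`: they agree up to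
an `SL(n, ℝ)` change of variables and a nonzero real factor. -/
def SLEquivalent {n : ℕ} (p q : MvPolynomial (Fin n) ℝ) : Prop :=
  ∃ (A : Matrix.SpecialLinearGroup (Fin n) ℝ) (c : ℝ), c ≠ 0 ∧ p = C c * linearSubst A q

/-- The sixteen types of real plane cubics, in the order of the table. -/
inductive CubicType : Type
  | tripleLine
  | imaginaryConcurrentLines
  | realConcurrentLines
  | doubleLinePlusLine
  | imaginaryConicPlusLine
  | realConicPlusExternalLine
  | realConicPlusSecantLine
  | realConicPlusTangentLine
  | realFermat
  | imaginaryFermat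
  | hessePencil
  | imaginaryTriangle
  | cusp
  | nodalCubic
  | cubicaPunctata
  | realTriangle

namespace CubicType

/-- The member `x³ + y³ + z³ + 6 λ x y z` of the Hesse pencil. -/
noncomputable def hesse (lam : ℝ) : MvPolynomial (Fin 3) ℝ :=
  X 0 ^ 3 + X 1 ^ 3 + X 2 ^ 3 + C (6 * lam) * (X 0 * X 1 * X 2)

/-- The normal forms of each type, in the variables `x = X 0`, `y = X 1`, `z = X 2`
(a single form, except for the Hesse pencil). -/
noncomputable def normalForms : CubicType → Set (MvPolynomial (Fin 3) ℝ)
  | tripleLine => {X 0 ^ 3}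
  | imaginaryConcurrentLines => {X 0 * (X 0 ^ 2 + X 1 ^ 2)}
  | realConcurrentLines => {X 0 * (X 0 ^ 2 - X 1 ^ 2)}
  | doubleLinePlusLine => {X 0 ^ 2 * X 1}
  | imaginaryConicPlusLine => {(X 0 ^ 2 + X 1 ^ 2 + X 2 ^ 2) * X 0}
  | realConicPlusExternalLine => {(X 0 ^ 2 + X 1 ^ 2 - X 2 ^ 2) * X 2}
  | realConicPlusSecantLine => {(X 0 ^ 2 + X 1 ^ 2 - X 2 ^ 2) * X 1}
  | realConicPlusTangentLine => {18 * X 1 * (X 0 ^ 2 + X 1 * X 2)}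
  | realFermat => {X 0 ^ 3 + X 1 ^ 3 + X 2 ^ 3}
  | imaginaryFermat => {X 0 ^ 3 + X 1 ^ 3 + X 2 ^ 3 + 6 * X 0 * X 1 * X 2}
  | hessePencil => {p | ∃ lam : ℝ, lam ≠ -1 / 2 ∧ lam ≠ 0 ∧ lam ≠ 1 ∧ p = hesse lam}
  | imaginaryTriangle => {X 0 ^ 3 + X 1 ^ 3 + X 2 ^ 3 - 3 * X 0 * X 1 * X 2}
  | cusp => {X 1 ^ 2 * X 2 - X 0 ^ 3}
  | nodalCubic => {X 0 ^ 3 + X 1 ^ 3 + 6 * X 0 * X 1 * X 2}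
  | cubicaPunctata => {X 1 ^ 2 * X 2 - X 0 ^ 3 + X 0 ^ 2 * X 2}
  | realTriangle => {X 0 * X 1 * X 2}

/-- The real rank listed in the table. -/
def tableRank : CubicType → ℕ
  | tripleLine => 1
  | imaginaryConcurrentLines => 2
  | realConcurrentLines => 3
  | doubleLinePlusLine => 3
  | imaginaryConicPlusLine => 4
  | realConicPlusExternalLine => 5
  | realConicPlusSecantLine => 4
  | realConicPlusTangentLine => 5
  | realFermat => 3
  | imaginaryFermat => 4
  | hessePencil => 4
  | imaginaryTriangle => 5
  | cusp => 4
  | nodalCubic => 4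
  | cubicaPunctata => 4
  | realTriangle => 4

/-- The real border rank listed in the table. For `imaginaryFermat` the value is `4`: only the
complex border rank of this form is `3`. -/
def tableBorderRank : CubicType → ℕ
  | tripleLine => 1
  | imaginaryConcurrentLines => 2
  | realConcurrentLines => 3
  | doubleLinePlusLine => 2
  | imaginaryConicPlusLine => 4
  | realConicPlusExternalLine => 4
  | realConicPlusSecantLine => 4
  | realConicPlusTangentLine => 3
  | realFermat => 3
  | imaginaryFermat => 4
  | hessePencil => 4
  | imaginaryTriangle => 4
  | cusp => 3
  | nodalCubic => 4
  | cubicaPunctata => 4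
  | realTriangle => 4

/-- The real cubic form `f` is of type `t`. -/
def HasType (f : RealForm 3 3) (t : CubicType) : Prop :=
  ∃ p ∈ t.normalForms, SLEquivalent (f : MvPolynomial (Fin 3) ℝ) p

end CubicType

/-! A cubic form is replaced by its ten normalized coefficients, so that equivalence, rank and
limits become statements about vectors in ℝ¹⁰. Three facts carry the theorem: a classification, the
ranks of the normal forms, and the density of the cubics of rank four.

Classification (`exists_hasNormalForm`). If there is a real singular point, it is moved to (0,0,1);
the cubic becomes z·q(x,y) + b(x,y), and the type is decided by the real quadratic form q (zero, a
square, indefinite, definite) and then by b. If there is none, `flexLine_or_singular` produces a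
real line on which the cubic restricts to a multiple of a cube: flexes are the roots of a polynomial
of degree nine, and nine is odd. With that line at z = 0 the cubic is either a line times a conic or
a Weierstrass cubic. A Weierstrass cubic has a further real flex; with its mirror image and the flex
at infinity it gives three collinear flexes, so the cubic is the product of three flex tangents plus
a multiple of the cube of the line through the flexes, which leads to the Hesse pencil.

Ranks (`normalVec_ranks`). Upper bounds are explicit decompositions. Most lower bounds are closed
polynomial conditions satisfied by all sums of k cubes, and hence bound the border rank too: a 2×2
minor, a binary discriminant, the Hessian determinant, Aronhold's S, and the discriminant of the
Hessian on a line. Rank five is proved by apolarity: for four points in general position, the apolar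
conics take values proportional to one fixed vector, which in the three relevant cases forces the
four points into a plane.

Density (`isLimitOfHasRank_four`). If S ≠ 0 the rank is at least four. The normal forms of rank five
all contain a real line, and then the cubic and its Hessian have a common zero on z = 0, so a
resultant vanishes. Off the zero set of S times this resultant the rank is therefore exactly four.
Hence every border rank is at most four and four is the only typical rank. As density itself uses
the ranks, the border rank half of `normalVec_ranks` takes the limit property as a hypothesis, which
is discharged afterwards.

Types are disjoint (`type_unique`) because rank, border rank and six projectively invariant
properties separate them. -/

/-! ### Cubic forms as vectors of ten normalized coefficients -/

/-- The ternary cubic with coefficient vector `a`, where the coefficients are divided by the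
multinomial coefficients, as a function. -/
def cubicEval (a : Fin 10 → ℝ) (v : Fin 3 → ℝ) : ℝ :=
  a 0 * v 0 ^ 3 + a 1 * v 1 ^ 3 + a 2 * v 2 ^ 3 +
    3 * (a 3 * (v 0 ^ 2 * v 1) + a 4 * (v 0 ^ 2 * v 2) + a 5 * (v 0 * v 1 ^ 2) +
      a 6 * (v 1 ^ 2 * v 2) + a 7 * (v 0 * v 2 ^ 2) + a 8 * (v 1 * v 2 ^ 2)) +
    6 * (a 9 * (v 0 * v 1 * v 2))

/-- The symmetric trilinear form of a ternary cubic. -/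
def cubicPolar (a : Fin 10 → ℝ) (u v w : Fin 3 → ℝ) : ℝ :=
  a 0 * (u 0 * v 0 * w 0) + a 1 * (u 1 * v 1 * w 1) + a 2 * (u 2 * v 2 * w 2) +
    a 3 * (u 0 * v 0 * w 1 + u 0 * v 1 * w 0 + u 1 * v 0 * w 0) +
    a 4 * (u 0 * v 0 * w 2 + u 0 * v 2 * w 0 + u 2 * v 0 * w 0) +
    a 5 * (u 0 * v 1 * w 1 + u 1 * v 0 * w 1 + u 1 * v 1 * w 0) +
    a 6 * (u 1 * v 1 * w 2 + u 1 * v 2 * w 1 + u 2 * v 1 * w 1) +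
    a 7 * (u 0 * v 2 * w 2 + u 2 * v 0 * w 2 + u 2 * v 2 * w 0) +
    a 8 * (u 1 * v 2 * w 2 + u 2 * v 1 * w 2 + u 2 * v 2 * w 1) +
    a 9 * (u 0 * v 1 * w 2 + u 0 * v 2 * w 1 + u 1 * v 0 * w 2 + u 1 * v 2 * w 0 +
      u 2 * v 0 * w 1 + u 2 * v 1 * w 0)

/-- Polarization: the trilinear form is determined by values of the cubic, so identities between
values transfer to the polar form without expanding coefficients. -/
lemma cubicPolar_eq (a : Fin 10 → ℝ) (u v w : Fin 3 → ℝ) :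
    6 * cubicPolar a u v w = cubicEval a (u + v + w) - cubicEval a (u + v) - cubicEval a (u + w)
      - cubicEval a (v + w) + cubicEval a u + cubicEval a v + cubicEval a w := by
  simp only [cubicPolar, cubicEval, Pi.add_apply]; ring

/-- The exponent vector of a ternary monomial. -/
noncomputable def ternaryExp (i j k : ℕ) : Fin 3 →₀ ℕ := Finsupp.equivFunOnFinite.symm ![i, j, k]

/-- The normalized coefficient vector of a family of coefficients. -/
noncomputable def normalizedCoeffs (s : (Fin 3 →₀ ℕ) → ℝ) : Fin 10 → ℝ :=
  ![s (ternaryExp 3 0 0), s (ternaryExp 0 3 0), s (ternaryExp 0 0 3), s (ternaryExp 2 1 0) / 3,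
    s (ternaryExp 2 0 1) / 3, s (ternaryExp 1 2 0) / 3, s (ternaryExp 0 2 1) / 3,
    s (ternaryExp 1 0 2) / 3, s (ternaryExp 0 1 2) / 3, s (ternaryExp 1 1 1) / 6]

lemma continuous_normalizedCoeffs : Continuous normalizedCoeffs := by
  unfold normalizedCoeffs
  refine continuous_pi fun i => ?_
  fin_cases i <;> simp <;> fun_prop

/-- The normalized coefficient vector of a ternary cubic form. -/
noncomputable def cubicVec (f : RealForm 3 3) : Fin 10 → ℝ := normalizedCoeffs (formCoeffs f)

lemma ternaryExp_injective {i j k i' j' k' : ℕ} :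
    ternaryExp i j k = ternaryExp i' j' k' ↔ i = i' ∧ j = j' ∧ k = k' := by
  constructor
  · intro h
    have h0 := DFunLike.congr_fun h 0
    have h1 := DFunLike.congr_fun h 1
    have h2 := DFunLike.congr_fun h 2
    simp [ternaryExp] at h0 h1 h2
    exact ⟨h0, h1, h2⟩
  · rintro ⟨rfl, rfl, rfl⟩; rfl

lemma eq_ternaryExp (d : Fin 3 →₀ ℕ) : d = ternaryExp (d 0) (d 1) (d 2) := by
  ext i; fin_cases i <;> simp [ternaryExp]

/-- The exponents of the ternary cubic monomials. -/
noncomputable def cubicExps : Finset (Fin 3 →₀ ℕ) :=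
  {ternaryExp 3 0 0, ternaryExp 0 3 0, ternaryExp 0 0 3, ternaryExp 2 1 0, ternaryExp 2 0 1,
    ternaryExp 1 2 0, ternaryExp 0 2 1, ternaryExp 1 0 2, ternaryExp 0 1 2, ternaryExp 1 1 1}

lemma mem_cubicExps {i j k : ℕ} (h : i + j + k = 3) : ternaryExp i j k ∈ cubicExps := by
  have hi : i ≤ 3 := by omega
  have hj : j ≤ 3 := by omega
  obtain rfl : k = 3 - i - j := by omega
  interval_cases i <;> interval_cases j <;> simp_all [cubicExps]

lemma eval_eq_cubicEval (f : RealForm 3 3) (v : Fin 3 → ℝ) :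
    eval v (f : MvPolynomial (Fin 3) ℝ) = cubicEval (cubicVec f) v := by
  have hf : (f : MvPolynomial (Fin 3) ℝ).IsHomogeneous 3 := f.2
  rw [eval_eq', Finset.sum_subset (s₂ := cubicExps)]
  · simp only [cubicExps, Fin.prod_univ_three]
    repeat rw [Finset.sum_insert (by simp [ternaryExp_injective])]
    rw [Finset.sum_singleton]
    simp [cubicEval, cubicVec, normalizedCoeffs, formCoeffs, ternaryExp]
    ring
  · intro d hd
    have := hf (mem_support_iff.mp hd)
    rw [Finsupp.weight_apply, Finsupp.sum_fintype _ _ (by simp), Fin.sum_univ_three] at this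
    simp at this
    rw [eq_ternaryExp d]
    exact mem_cubicExps this
  · intro d _ hd
    rw [notMem_support_iff.mp hd, zero_mul]

/-- The ternary cubic form with a given normalized coefficient vector. -/
noncomputable def cubicForm (a : Fin 10 → ℝ) : RealForm 3 3 :=
  a 0 • ⟨X 0 ^ 3, isHomogeneous_X_pow 0 3⟩ + a 1 • ⟨X 1 ^ 3, isHomogeneous_X_pow 1 3⟩ +
  a 2 • ⟨X 2 ^ 3, isHomogeneous_X_pow 2 3⟩ +
  (3 * a 3) • ⟨X 0 ^ 2 * X 1, (isHomogeneous_X_pow 0 2).mul (isHomogeneous_X ℝ 1)⟩ +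
  (3 * a 4) • ⟨X 0 ^ 2 * X 2, (isHomogeneous_X_pow 0 2).mul (isHomogeneous_X ℝ 2)⟩ +
  (3 * a 5) • ⟨X 1 ^ 2 * X 0, (isHomogeneous_X_pow 1 2).mul (isHomogeneous_X ℝ 0)⟩ +
  (3 * a 6) • ⟨X 1 ^ 2 * X 2, (isHomogeneous_X_pow 1 2).mul (isHomogeneous_X ℝ 2)⟩ +
  (3 * a 7) • ⟨X 2 ^ 2 * X 0, (isHomogeneous_X_pow 2 2).mul (isHomogeneous_X ℝ 0)⟩ +
  (3 * a 8) • ⟨X 2 ^ 2 * X 1, (isHomogeneous_X_pow 2 2).mul (isHomogeneous_X ℝ 1)⟩ +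
  (6 * a 9) • ⟨X 0 * X 1 * X 2, ((isHomogeneous_X ℝ 0).mul (isHomogeneous_X ℝ 1)).mul
    (isHomogeneous_X ℝ 2)⟩

lemma eval_cubicForm (a : Fin 10 → ℝ) (v : Fin 3 → ℝ) :
    eval v (cubicForm a : MvPolynomial (Fin 3) ℝ) = cubicEval a v := by
  simp [cubicForm, cubicEval, smul_eval]; ring

lemma continuous_formCoeffs_cubicForm : Continuous fun a => formCoeffs (cubicForm a) := by
  refine continuous_pi fun m => ?_
  simp only [formCoeffs, cubicForm, Submodule.coe_add, Submodule.coe_smul, coeff_add, coeff_smul,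
    smul_eq_mul]
  fun_prop

lemma cubicEval_injective {a b : Fin 10 → ℝ} (h : ∀ v, cubicEval a v = cubicEval b v) : a = b := by
  -- These ten points impose independent linear conditions on ternary cubics.
  have e0 := h ![1, 0, 0]
  have e1 := h ![0, 1, 0]
  have e2 := h ![0, 0, 1]
  have e3 := h ![1, 1, 0]
  have e4 := h ![1, 0, 1]
  have e5 := h ![1, -1, 0]
  have e6 := h ![0, 1, 1]
  have e7 := h ![1, 0, -1]
  have e8 := h ![0, 1, -1]
  have e9 := h ![1, 1, 1]
  simp [cubicEval] at e0 e1 e2 e3 e4 e5 e6 e7 e8 e9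
  funext i
  fin_cases i <;> simp <;> linarith

lemma form_ext {f g : RealForm 3 3}
    (h : ∀ v, eval v (f : MvPolynomial (Fin 3) ℝ) = eval v (g : MvPolynomial (Fin 3) ℝ)) :
    f = g := Subtype.ext (MvPolynomial.funext h)

lemma cubicForm_cubicVec (f : RealForm 3 3) : cubicForm (cubicVec f) = f :=
  form_ext fun v => by rw [eval_cubicForm, eval_eq_cubicEval]

lemma cubicVec_cubicForm (a : Fin 10 → ℝ) : cubicVec (cubicForm a) = a :=
  cubicEval_injective fun v => by rw [← eval_eq_cubicEval, eval_cubicForm]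

lemma cubicVec_zero : cubicVec 0 = 0 := cubicEval_injective fun v => by
  rw [← eval_eq_cubicEval]; simp [cubicEval]

lemma cubicVec_eq_zero {f : RealForm 3 3} : cubicVec f = 0 ↔ f = 0 := by
  constructor
  · intro h
    rw [← cubicForm_cubicVec f, h, ← cubicVec_zero, cubicForm_cubicVec]
  · rintro rfl; exact cubicVec_zero

/-- Every real linear form is the pairing with a vector. -/
lemma exists_eval_linear (l : RealForm 3 1) :
    ∃ p : Fin 3 → ℝ, ∀ v, eval v (l : MvPolynomial (Fin 3) ℝ) = p ⬝ᵥ v := by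
  have hl : (l : MvPolynomial (Fin 3) ℝ).IsHomogeneous 1 := l.2
  refine ⟨fun i => coeff (ternaryExp (if i = 0 then 1 else 0) (if i = 1 then 1 else 0)
    (if i = 2 then 1 else 0)) (l : MvPolynomial (Fin 3) ℝ), fun v => ?_⟩
  rw [eval_eq', Finset.sum_subset
    (s₂ := {ternaryExp 1 0 0, ternaryExp 0 1 0, ternaryExp 0 0 1})]
  · simp only [Fin.prod_univ_three]
    repeat rw [Finset.sum_insert (by simp [ternaryExp_injective])]
    rw [Finset.sum_singleton]
    simp [ternaryExp, dotProduct, Fin.sum_univ_three]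
    ring
  · intro d hd
    have := hl (mem_support_iff.mp hd)
    rw [Finsupp.weight_apply, Finsupp.sum_fintype _ _ (by simp), Fin.sum_univ_three] at this
    simp at this
    rw [eq_ternaryExp d]
    simp only [Finset.mem_insert, Finset.mem_singleton, ternaryExp_injective]
    omega
  · intro d _ hd
    rw [notMem_support_iff.mp hd, zero_mul]

/-- The linear form pairing with the vector `p`. -/
noncomputable def linearForm (p : Fin 3 → ℝ) : RealForm 3 1 :=
  p 0 • ⟨X 0, isHomogeneous_X ℝ 0⟩ + p 1 • ⟨X 1, isHomogeneous_X ℝ 1⟩ +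
    p 2 • ⟨X 2, isHomogeneous_X ℝ 2⟩

lemma eval_linearForm (p v : Fin 3 → ℝ) :
    eval v (linearForm p : MvPolynomial (Fin 3) ℝ) = p ⬝ᵥ v := by
  simp [linearForm, smul_eval, dotProduct, Fin.sum_univ_three]

/-! ### Rank and limits in coefficient coordinates -/

/-- A function on `ℝ³` is a linear combination of `r` cubes of linear forms. -/
def IsSumOfCubes (F : (Fin 3 → ℝ) → ℝ) (r : ℕ) : Prop :=
  ∃ (c : Fin r → ℝ) (p : Fin r → Fin 3 → ℝ), ∀ v, F v = ∑ i, c i * (p i ⬝ᵥ v) ^ 3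

lemma isSumOfPowers_iff (f : RealForm 3 3) (r : ℕ) :
    IsSumOfPowers f r ↔ IsSumOfCubes (cubicEval (cubicVec f)) r := by
  constructor
  · rintro ⟨c, l, h⟩
    choose p hp using fun i => exists_eval_linear (l i)
    refine ⟨c, p, fun v => ?_⟩
    rw [← eval_eq_cubicEval, h]
    simp [hp]
  · rintro ⟨c, p, h⟩
    refine ⟨c, fun i => linearForm (p i), MvPolynomial.funext fun v => ?_⟩
    rw [eval_eq_cubicEval, h]
    simp [eval_linearForm]

/-- The real rank of a ternary cubic given by its coefficient vector is `r`. -/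
def HasRank (a : Fin 10 → ℝ) (r : ℕ) : Prop :=
  IsLeast {s : ℕ | IsSumOfCubes (cubicEval a) s} r

/-- `a` is a limit of ternary cubics of real rank `r`. -/
def IsLimitOfHasRank (a : Fin 10 → ℝ) (r : ℕ) : Prop :=
  ∃ P : ℝ → Fin 10 → ℝ, (∀ ε : ℝ, 0 < ε → HasRank (P ε) r) ∧ Tendsto P (𝓝[>] 0) (𝓝 a)

lemma isRealRank_iff (f : RealForm 3 3) (r : ℕ) : IsRealRank f r ↔ HasRank (cubicVec f) r := by
  simp only [IsRealRank, HasRank, isSumOfPowers_iff]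

lemma isLimitOfRank_iff (f : RealForm 3 3) (r : ℕ) :
    IsLimitOfRank f r ↔ IsLimitOfHasRank (cubicVec f) r := by
  constructor
  · rintro ⟨P, hP, hlim⟩
    exact ⟨fun ε => cubicVec (P ε), fun ε hε => (isRealRank_iff _ _).1 (hP ε hε),
      (continuous_normalizedCoeffs.tendsto _).comp hlim⟩
  · rintro ⟨P, hP, hlim⟩
    refine ⟨fun ε => cubicForm (P ε), fun ε hε => ?_, ?_⟩
    · rw [isRealRank_iff, cubicVec_cubicForm]
      exact hP ε hε
    · have := (continuous_formCoeffs_cubicForm.tendsto _).comp hlim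
      rwa [cubicForm_cubicVec] at this

lemma IsSumOfCubes.mono {F : (Fin 3 → ℝ) → ℝ} {r s : ℕ} (h : IsSumOfCubes F r) (hrs : r ≤ s) :
    IsSumOfCubes F s := by
  induction s, hrs using Nat.le_induction with
  | base => exact h
  | succ n _ ih =>
    obtain ⟨c, p, h⟩ := ih
    refine ⟨Fin.snoc c 0, Fin.snoc p 0, fun v => ?_⟩
    rw [Fin.sum_univ_castSucc]
    simp [h v]

lemma HasRank.unique {a : Fin 10 → ℝ} {r s : ℕ} (h : HasRank a r) (h' : HasRank a s) : r = s :=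
  IsLeast.unique h h'

/-- The rank is `r + 1` if there is a decomposition of length `r + 1` but none of length `r`. -/
lemma hasRank_succ {a : Fin 10 → ℝ} {r : ℕ} (h : IsSumOfCubes (cubicEval a) (r + 1))
    (h' : ¬ IsSumOfCubes (cubicEval a) r) : HasRank a (r + 1) := by
  refine ⟨h, fun s hs => ?_⟩
  by_contra hlt
  exact h' (IsSumOfCubes.mono hs (by omega))

/-! ### Equivalence of ternary cubics -/

/-- Two functions on `ℝ³` agree up to a linear change of coordinates and a nonzero factor. -/
def LinEquivalent (F G : (Fin 3 → ℝ) → ℝ) : Prop :=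
  ∃ A : Matrix (Fin 3) (Fin 3) ℝ, A.det ≠ 0 ∧ ∃ c : ℝ, c ≠ 0 ∧ ∀ v, F v = c * G (A.mulVec v)

lemma LinEquivalent.refl (F : (Fin 3 → ℝ) → ℝ) : LinEquivalent F F :=
  ⟨1, by simp, 1, one_ne_zero, by simp⟩

lemma LinEquivalent.symm {F G : (Fin 3 → ℝ) → ℝ} (h : LinEquivalent F G) : LinEquivalent G F := by
  obtain ⟨A, hA, c, hc, h⟩ := h
  refine ⟨A⁻¹, (A.isUnit_nonsing_inv_det (isUnit_iff_ne_zero.2 hA)).ne_zero, c⁻¹, inv_ne_zero hc,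
    fun v => ?_⟩
  rw [h, Matrix.mulVec_mulVec, Matrix.mul_nonsing_inv _ (isUnit_iff_ne_zero.2 hA),
    Matrix.one_mulVec, inv_mul_cancel_left₀ hc]

lemma LinEquivalent.trans {F G H : (Fin 3 → ℝ) → ℝ} (h : LinEquivalent F G)
    (h' : LinEquivalent G H) : LinEquivalent F H := by
  obtain ⟨A, hA, c, hc, h⟩ := h
  obtain ⟨B, hB, d, hd, h'⟩ := h'
  refine ⟨B * A, by rw [Matrix.det_mul]; exact mul_ne_zero hB hA, c * d, mul_ne_zero hc hd,
    fun v => ?_⟩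
  rw [h, h', Matrix.mulVec_mulVec, mul_assoc]

lemma eval_linearSubst (A : Matrix.SpecialLinearGroup (Fin 3) ℝ) (p : MvPolynomial (Fin 3) ℝ)
    (v : Fin 3 → ℝ) :
    eval v (linearSubst A p) = eval ((A : Matrix (Fin 3) (Fin 3) ℝ).mulVec v) p := by
  rw [linearSubst, aeval_def, ← coe_eval₂Hom, ← RingHom.comp_apply]
  congr 1
  ext i
  · simp
  · simp [Matrix.mulVec, dotProduct]

lemma exists_cube_root (x : ℝ) : ∃ y : ℝ, y ^ 3 = x := by
  have key : ∀ z : ℝ, 0 ≤ z → ∃ y : ℝ, y ^ 3 = z := fun z hz =>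
    ⟨z ^ ((3 : ℕ) : ℝ)⁻¹, Real.rpow_inv_natCast_pow hz (by norm_num)⟩
  rcases le_total 0 x with hx | hx
  · exact key x hx
  · obtain ⟨y, hy⟩ := key (-x) (by linarith)
    exact ⟨-y, by linarith [show (-y) ^ 3 = -y ^ 3 by ring]⟩

/-- Every real determinant has a real cube root `d`, so an invertible matrix can be scaled to
determinant one; homogeneity of degree three moves the scaling into the factor `d ^ 3`. Hence SL(3)
may be replaced by GL(3) throughout. -/
lemma slEquivalent_iff (f : RealForm 3 3) (p : MvPolynomial (Fin 3) ℝ) (hp : p.IsHomogeneous 3) :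
    SLEquivalent (f : MvPolynomial (Fin 3) ℝ) p ↔
      LinEquivalent (cubicEval (cubicVec f)) (fun v => eval v p) := by
  constructor
  · rintro ⟨A, c, hc, h⟩
    refine ⟨A, by simp, c, hc, fun v => ?_⟩
    rw [← eval_eq_cubicEval, h, map_mul, eval_C, eval_linearSubst]
  · rintro ⟨A, hA, c, hc, h⟩
    obtain ⟨d, hd⟩ := exists_cube_root A.det
    have hd0 : d ≠ 0 := by rintro rfl; simp at hd; exact hA hd.symm
    have hdet : (d⁻¹ • A).det = 1 := by
      rw [Matrix.det_smul, ← hd]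
      simp [hd0]
    let B : Matrix.SpecialLinearGroup (Fin 3) ℝ := ⟨d⁻¹ • A, hdet⟩
    refine ⟨B, c * d ^ 3, mul_ne_zero hc (pow_ne_zero _ hd0), MvPolynomial.funext fun v => ?_⟩
    have hB : (B : Matrix (Fin 3) (Fin 3) ℝ) = d⁻¹ • A := rfl
    obtain ⟨b, hb⟩ : ∃ b, ∀ v, eval v p = cubicEval b v :=
      ⟨_, eval_eq_cubicEval ⟨p, (mem_homogeneousSubmodule 3 p).2 hp⟩⟩
    rw [map_mul, eval_C, eval_linearSubst, eval_eq_cubicEval, h, hB]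
    simp only [hb, Matrix.smul_mulVec]
    have : cubicEval b (d⁻¹ • A.mulVec v) = d⁻¹ ^ 3 * cubicEval b (A.mulVec v) := by
      simp only [cubicEval, Pi.smul_apply, smul_eq_mul]; ring
    rw [this]
    field_simp

/-! ### Invariance of rank and border rank -/

lemma LinEquivalent.isSumOfCubes {F G : (Fin 3 → ℝ) → ℝ} (h : LinEquivalent F G) {r : ℕ}
    (hG : IsSumOfCubes G r) : IsSumOfCubes F r := by
  obtain ⟨A, -, c, -, h⟩ := h
  obtain ⟨d, p, hG⟩ := hG
  refine ⟨fun i => c * d i, fun i => Matrix.vecMul (p i) A, fun v => ?_⟩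
  simp only [h, hG, Finset.mul_sum, Matrix.dotProduct_mulVec, mul_assoc]

lemma LinEquivalent.hasRank {a b : Fin 10 → ℝ} (h : LinEquivalent (cubicEval a) (cubicEval b))
    {r : ℕ} (hb : HasRank b r) : HasRank a r :=
  ⟨h.isSumOfCubes hb.1, fun _ hs => hb.2 (h.symm.isSumOfCubes hs)⟩

/-- The coefficient vector after a linear substitution. -/
def cubicSubst (A : Matrix (Fin 3) (Fin 3) ℝ) (a : Fin 10 → ℝ) : Fin 10 → ℝ :=
  let e (i : Fin 3) : Fin 3 → ℝ := fun j => A j i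
  ![cubicPolar a (e 0) (e 0) (e 0), cubicPolar a (e 1) (e 1) (e 1), cubicPolar a (e 2) (e 2) (e 2),
    cubicPolar a (e 0) (e 0) (e 1), cubicPolar a (e 0) (e 0) (e 2), cubicPolar a (e 0) (e 1) (e 1),
    cubicPolar a (e 1) (e 1) (e 2), cubicPolar a (e 0) (e 2) (e 2), cubicPolar a (e 1) (e 2) (e 2),
    cubicPolar a (e 0) (e 1) (e 2)]

lemma cubicEval_cubicSubst (A : Matrix (Fin 3) (Fin 3) ℝ) (a : Fin 10 → ℝ) (v : Fin 3 → ℝ) :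
    cubicEval (cubicSubst A a) v = cubicEval a (A.mulVec v) := by
  simp [cubicEval, cubicSubst, cubicPolar, Matrix.mulVec, dotProduct, Fin.sum_univ_three]
  ring

lemma cubicEval_smul (c : ℝ) (a : Fin 10 → ℝ) (v : Fin 3 → ℝ) :
    cubicEval (c • a) v = c * cubicEval a v := by
  simp only [cubicEval, Pi.smul_apply, smul_eq_mul]; ring

lemma cubicEval_add (a b : Fin 10 → ℝ) (v : Fin 3 → ℝ) :
    cubicEval (a + b) v = cubicEval a v + cubicEval b v := by
  simp only [cubicEval, Pi.add_apply]; ring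

lemma continuous_cubicSubst (A : Matrix (Fin 3) (Fin 3) ℝ) : Continuous (cubicSubst A) := by
  refine continuous_pi fun i => ?_
  fin_cases i <;> simp [cubicSubst, cubicPolar] <;> fun_prop

lemma LinEquivalent.isLimitOfHasRank {a b : Fin 10 → ℝ}
    (h : LinEquivalent (cubicEval a) (cubicEval b)) {r : ℕ} (hb : IsLimitOfHasRank b r) :
    IsLimitOfHasRank a r := by
  obtain ⟨A, hA, c, hc, h⟩ := h
  obtain ⟨P, hP, hlim⟩ := hb
  have hsub : ∀ d v, cubicEval (c • cubicSubst A d) v = c * cubicEval d (A.mulVec v) := fun d v => by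
    rw [cubicEval_smul, cubicEval_cubicSubst]
  refine ⟨fun ε => c • cubicSubst A (P ε), fun ε hε => ?_, ?_⟩
  · exact LinEquivalent.hasRank ⟨A, hA, c, hc, hsub _⟩ (hP ε hε)
  · have hab : a = c • cubicSubst A b := cubicEval_injective fun v => by rw [h, hsub]
    rw [hab]
    exact (((continuous_cubicSubst A).const_smul c).tendsto _).comp hlim

/-! ### Sums of few cubes -/

/-- The normalized coefficient vector of the cube of a linear form. -/
def veronese (p : Fin 3 → ℝ) : Fin 10 → ℝ :=
  ![p 0 ^ 3, p 1 ^ 3, p 2 ^ 3, p 0 ^ 2 * p 1, p 0 ^ 2 * p 2, p 0 * p 1 ^ 2, p 1 ^ 2 * p 2,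
    p 0 * p 2 ^ 2, p 1 * p 2 ^ 2, p 0 * p 1 * p 2]

lemma cubicEval_veronese (p v : Fin 3 → ℝ) : cubicEval (veronese p) v = (p ⬝ᵥ v) ^ 3 := by
  simp [cubicEval, veronese, dotProduct, Fin.sum_univ_three]; ring

lemma cubicEval_zero (v : Fin 3 → ℝ) : cubicEval 0 v = 0 := by simp [cubicEval]

lemma cubicEval_sum {ι : Type*} (s : Finset ι) (a : ι → Fin 10 → ℝ) (v : Fin 3 → ℝ) :
    cubicEval (∑ i ∈ s, a i) v = ∑ i ∈ s, cubicEval (a i) v := by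
  classical
  induction s using Finset.induction_on with
  | empty => simp [cubicEval_zero]
  | insert i s hi ih => rw [Finset.sum_insert hi, Finset.sum_insert hi, cubicEval_add, ih]

lemma isSumOfCubes_iff {a : Fin 10 → ℝ} {r : ℕ} : IsSumOfCubes (cubicEval a) r ↔
    ∃ (c : Fin r → ℝ) (p : Fin r → Fin 3 → ℝ), a = ∑ i, c i • veronese (p i) := by
  refine exists_congr fun c => exists_congr fun p => ?_
  have : ∀ v, cubicEval (∑ i, c i • veronese (p i)) v = ∑ i, c i * (p i ⬝ᵥ v) ^ 3 := fun v => by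
    simp only [cubicEval_sum, cubicEval_smul, cubicEval_veronese]
  constructor
  · exact fun h => cubicEval_injective fun v => by rw [h, this]
  · rintro rfl; exact this

/-- A quarter of the Hessian matrix, up to normalization, of a ternary cubic at a point. -/
def hessMat (a : Fin 10 → ℝ) (v : Fin 3 → ℝ) : Matrix (Fin 3) (Fin 3) ℝ :=
  !![a 0 * v 0 + a 3 * v 1 + a 4 * v 2, a 3 * v 0 + a 5 * v 1 + a 9 * v 2,
      a 4 * v 0 + a 9 * v 1 + a 7 * v 2;
    a 3 * v 0 + a 5 * v 1 + a 9 * v 2, a 5 * v 0 + a 1 * v 1 + a 6 * v 2,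
      a 9 * v 0 + a 6 * v 1 + a 8 * v 2;
    a 4 * v 0 + a 9 * v 1 + a 7 * v 2, a 9 * v 0 + a 6 * v 1 + a 8 * v 2,
      a 7 * v 0 + a 8 * v 1 + a 2 * v 2]

lemma cubicPolar_eq_dotProduct (a : Fin 10 → ℝ) (v u w : Fin 3 → ℝ) :
    cubicPolar a v u w = u ⬝ᵥ (hessMat a v).mulVec w := by
  simp [cubicPolar, hessMat, Matrix.mulVec, dotProduct, Fin.sum_univ_three]; ring

/-! ### Polynomial conditions satisfied by sums of one, two or three cubes -/

/-- Aronhold's invariant of degree four of a ternary cubic. -/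
def aronholdS (a : Fin 10 → ℝ) : ℝ :=
  a 0 * a 1 * a 2 * a 9 - (a 1 * a 2 * a 3 * a 4 + a 2 * a 0 * a 5 * a 6 + a 0 * a 1 * a 7 * a 8)
    - a 9 * (a 0 * a 6 * a 8 + a 1 * a 7 * a 4 + a 2 * a 3 * a 5)
    + (a 0 * a 5 * a 8 ^ 2 + a 0 * a 7 * a 6 ^ 2 + a 1 * a 3 * a 7 ^ 2 + a 1 * a 8 * a 4 ^ 2
      + a 2 * a 6 * a 3 ^ 2 + a 2 * a 4 * a 5 ^ 2)
    - a 9 ^ 4 + 2 * a 9 ^ 2 * (a 5 * a 7 + a 8 * a 3 + a 4 * a 6)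
    - 3 * a 9 * (a 3 * a 6 * a 7 + a 4 * a 5 * a 8)
    - (a 5 ^ 2 * a 7 ^ 2 + a 8 ^ 2 * a 3 ^ 2 + a 4 ^ 2 * a 6 ^ 2)
    + (a 8 * a 3 * a 4 * a 6 + a 4 * a 6 * a 5 * a 7 + a 5 * a 7 * a 8 * a 3)

/-- S vanishes on the Fermat cubic and hence on its orbit closure; here this is a polynomial
identity in the coefficients and the linear forms. -/
lemma aronholdS_eq_zero {a : Fin 10 → ℝ} (h : IsSumOfCubes (cubicEval a) 3) : aronholdS a = 0 := by
  obtain ⟨c, p, rfl⟩ := isSumOfCubes_iff.1 h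
  simp [aronholdS, Fin.sum_univ_three, veronese]
  ring

/-- The determinant of the Hessian matrix of a sum of three cubes. -/
lemma det_hessMat_sum_three (c : Fin 3 → ℝ) (p : Fin 3 → Fin 3 → ℝ) (v : Fin 3 → ℝ) :
    (hessMat (∑ i, c i • veronese (p i)) v).det =
      c 0 * c 1 * c 2 * (Matrix.of p).det ^ 2 * ((p 0 ⬝ᵥ v) * (p 1 ⬝ᵥ v) * (p 2 ⬝ᵥ v)) := by
  simp [hessMat, Fin.sum_univ_three, veronese, Matrix.det_fin_three, dotProduct]
  ring

/-- The coefficients of the restriction of the Hessian determinant to the line `z = 0`. -/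
def hessBinary (a : Fin 10 → ℝ) : Fin 4 → ℝ :=
  ![a 0 * a 5 * a 7 - a 0 * a 9 * a 9 - a 3 * a 3 * a 7 + 2 * a 3 * a 4 * a 9 - a 4 * a 4 * a 5,
    a 0 * a 1 * a 7 + a 0 * a 5 * a 8 - 2 * a 0 * a 6 * a 9 - a 1 * a 4 * a 4 - a 3 * a 3 * a 8 +
      2 * a 3 * a 4 * a 6 - a 3 * a 5 * a 7 + a 3 * a 9 * a 9,
    a 0 * a 1 * a 8 - a 0 * a 6 * a 6 + a 1 * a 3 * a 7 - 2 * a 1 * a 4 * a 9 - a 3 * a 5 * a 8 +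
      2 * a 4 * a 5 * a 6 - a 5 * a 5 * a 7 + a 5 * a 9 * a 9,
    a 1 * a 3 * a 8 - a 1 * a 9 * a 9 - a 3 * a 6 * a 6 - a 5 * a 5 * a 8 + 2 * a 5 * a 6 * a 9]

/-- The binary cubic with given coefficients. -/
def binaryEval (b : Fin 4 → ℝ) (x y : ℝ) : ℝ :=
  b 0 * x ^ 3 + b 1 * x ^ 2 * y + b 2 * x * y ^ 2 + b 3 * y ^ 3

/-- The discriminant of a binary cubic. -/
def binaryDisc (b : Fin 4 → ℝ) : ℝ :=
  b 1 ^ 2 * b 2 ^ 2 - 4 * b 0 * b 2 ^ 3 - 4 * b 1 ^ 3 * b 3 - 27 * b 0 ^ 2 * b 3 ^ 2 +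
    18 * b 0 * b 1 * b 2 * b 3

lemma binaryEval_injective {b b' : Fin 4 → ℝ} (h : ∀ x y, binaryEval b x y = binaryEval b' x y) :
    b = b' := by
  have h0 := h 1 0
  have h1 := h 0 1
  have h2 := h 1 1
  have h3 := h 1 (-1)
  simp [binaryEval] at h0 h1 h2 h3
  funext i
  fin_cases i <;> simp <;> linarith

lemma binaryEval_hessBinary (a : Fin 10 → ℝ) (x y : ℝ) :
    binaryEval (hessBinary a) x y = (hessMat a ![x, y, 0]).det := by
  simp [binaryEval, hessBinary, hessMat, Matrix.det_fin_three]; ring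

/-- By `det_hessMat_sum_three` the Hessian is a multiple of a product of three real linear forms, so
its discriminant on z = 0 is a square. This detects reality: it excludes cubics that are sums of
three cubes only over ℂ, where S vanishes. -/
lemma binaryDisc_hessBinary_nonneg {a : Fin 10 → ℝ} (h : IsSumOfCubes (cubicEval a) 3) :
    0 ≤ binaryDisc (hessBinary a) := by
  obtain ⟨c, p, rfl⟩ := isSumOfCubes_iff.1 h
  set k : ℝ := c 0 * c 1 * c 2 * (Matrix.of p).det ^ 2 with hk
  have : hessBinary (∑ i, c i • veronese (p i)) = ![k * (p 0 0 * p 1 0 * p 2 0),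
      k * (p 0 0 * p 1 0 * p 2 1 + p 0 0 * p 1 1 * p 2 0 + p 0 1 * p 1 0 * p 2 0),
      k * (p 0 0 * p 1 1 * p 2 1 + p 0 1 * p 1 0 * p 2 1 + p 0 1 * p 1 1 * p 2 0),
      k * (p 0 1 * p 1 1 * p 2 1)] := binaryEval_injective fun x y => by
    rw [binaryEval_hessBinary, det_hessMat_sum_three, ← hk]
    simp [binaryEval, dotProduct, Fin.sum_univ_three]
    ring
  rw [this]
  have e : binaryDisc ![k * (p 0 0 * p 1 0 * p 2 0),
      k * (p 0 0 * p 1 0 * p 2 1 + p 0 0 * p 1 1 * p 2 0 + p 0 1 * p 1 0 * p 2 0),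
      k * (p 0 0 * p 1 1 * p 2 1 + p 0 1 * p 1 0 * p 2 1 + p 0 1 * p 1 1 * p 2 0),
      k * (p 0 1 * p 1 1 * p 2 1)] = (k ^ 2 * ((p 0 0 * p 1 1 - p 0 1 * p 1 0) *
        (p 0 0 * p 2 1 - p 0 1 * p 2 0) * (p 1 0 * p 2 1 - p 1 1 * p 2 0))) ^ 2 := by
    simp [binaryDisc]; ring
  rw [e]
  positivity

/-- The coefficients of the restriction of a ternary cubic to the line `z = 0`. -/
def restrictBinary (a : Fin 10 → ℝ) : Fin 4 → ℝ := ![a 0, 3 * a 3, 3 * a 5, a 1]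

lemma binaryEval_restrictBinary (a : Fin 10 → ℝ) (x y : ℝ) :
    binaryEval (restrictBinary a) x y = cubicEval a ![x, y, 0] := by
  simp [binaryEval, restrictBinary, cubicEval]; ring

lemma binaryDisc_restrictBinary_sum_two (c : Fin 2 → ℝ) (p : Fin 2 → Fin 3 → ℝ) :
    binaryDisc (restrictBinary (∑ i, c i • veronese (p i))) =
      -27 * (c 0 * c 1 * (p 0 0 * p 1 1 - p 0 1 * p 1 0) ^ 3) ^ 2 := by
  simp [binaryDisc, restrictBinary, Fin.sum_univ_two, veronese]; ring

lemma binaryDisc_restrictBinary_nonpos {a : Fin 10 → ℝ} (h : IsSumOfCubes (cubicEval a) 2) :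
    binaryDisc (restrictBinary a) ≤ 0 := by
  obtain ⟨c, p, rfl⟩ := isSumOfCubes_iff.1 h
  rw [binaryDisc_restrictBinary_sum_two]
  nlinarith [sq_nonneg (c 0 * c 1 * (p 0 0 * p 1 1 - p 0 1 * p 1 0) ^ 3)]

/-- The Hessian matrix is a combination of two matrices of rank at most one. -/
lemma det_hessMat_eq_zero {a : Fin 10 → ℝ} (h : IsSumOfCubes (cubicEval a) 2) (v : Fin 3 → ℝ) :
    (hessMat a v).det = 0 := by
  obtain ⟨c, p, rfl⟩ := isSumOfCubes_iff.1 h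
  simp [hessMat, Fin.sum_univ_two, veronese, Matrix.det_fin_three]; ring

lemma minor_sum_two (c : Fin 2 → ℝ) (p : Fin 2 → Fin 3 → ℝ) (a : Fin 10 → ℝ)
    (ha : a = ∑ i, c i • veronese (p i)) :
    a 0 * a 5 - a 3 ^ 2 = c 0 * c 1 * p 0 0 * p 1 0 * (p 0 0 * p 1 1 - p 0 1 * p 1 0) ^ 2 := by
  subst ha
  simp [Fin.sum_univ_two, veronese]; ring

/-- The expression is a 2×2 minor of the Hessian matrix at (1,0,0), which has rank at most one for a
single cube. -/
lemma minor_eq_zero {a : Fin 10 → ℝ} (h : IsSumOfCubes (cubicEval a) 1) :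
    a 0 * a 5 - a 3 ^ 2 = 0 := by
  obtain ⟨c, p, rfl⟩ := isSumOfCubes_iff.1 h
  simp [veronese]; ring

/-! ### Lower bounds for rank and border rank -/

/-- A closed condition satisfied by all sums of `k` cubes bounds the border rank from below. -/
lemma lt_of_isLimitOfHasRank {a : Fin 10 → ℝ} {k s : ℕ} {C : Set (Fin 10 → ℝ)} (hC : IsClosed C)
    (hk : ∀ b, IsSumOfCubes (cubicEval b) k → b ∈ C) (ha : a ∉ C) (h : IsLimitOfHasRank a s) :
    k < s := by
  by_contra hs
  obtain ⟨P, hP, hlim⟩ := h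
  refine ha (hC.mem_of_tendsto hlim ?_)
  filter_upwards [self_mem_nhdsWithin] with ε hε
  exact hk _ ((hP ε hε).1.mono (by omega))

lemma isLimitOfHasRank_of_hasRank {a : Fin 10 → ℝ} {r : ℕ} (h : HasRank a r) :
    IsLimitOfHasRank a r := ⟨fun _ => a, fun _ _ => h, tendsto_const_nhds⟩

lemma one_lt_of_isLimit {a : Fin 10 → ℝ} {s : ℕ} (ha : a 0 * a 5 - a 3 ^ 2 ≠ 0)
    (h : IsLimitOfHasRank a s) : 1 < s :=
  lt_of_isLimitOfHasRank (C := {b | b 0 * b 5 - b 3 ^ 2 = 0})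
    (isClosed_eq (by fun_prop) continuous_const) (fun _ => minor_eq_zero) ha h

lemma two_lt_of_isLimit_of_disc {a : Fin 10 → ℝ} {s : ℕ} (ha : 0 < binaryDisc (restrictBinary a))
    (h : IsLimitOfHasRank a s) : 2 < s :=
  lt_of_isLimitOfHasRank (C := {b | binaryDisc (restrictBinary b) ≤ 0})
    (isClosed_le (by simp only [binaryDisc, restrictBinary]; fun_prop) continuous_const)
    (fun _ => binaryDisc_restrictBinary_nonpos) (by simpa using ha) h

lemma continuous_det_hessMat (v : Fin 3 → ℝ) : Continuous fun a => (hessMat a v).det := by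
  simp only [hessMat, Matrix.det_fin_three]
  simp
  fun_prop

lemma two_lt_of_isLimit_of_det {a : Fin 10 → ℝ} {s : ℕ} (v : Fin 3 → ℝ)
    (ha : (hessMat a v).det ≠ 0) (h : IsLimitOfHasRank a s) : 2 < s :=
  lt_of_isLimitOfHasRank (C := {b | (hessMat b v).det = 0})
    (isClosed_eq (continuous_det_hessMat v) continuous_const)
    (fun _ hb => det_hessMat_eq_zero hb v) ha h

lemma continuous_aronholdS : Continuous aronholdS := by
  unfold aronholdS; fun_prop

lemma three_lt_of_isLimit_of_aronholdS {a : Fin 10 → ℝ} {s : ℕ} (ha : aronholdS a ≠ 0)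
    (h : IsLimitOfHasRank a s) : 3 < s :=
  lt_of_isLimitOfHasRank (C := {b | aronholdS b = 0})
    (isClosed_eq continuous_aronholdS continuous_const) (fun _ => aronholdS_eq_zero) ha h

lemma three_lt_of_isLimit_of_disc {a : Fin 10 → ℝ} {s : ℕ}
    (ha : binaryDisc (hessBinary a) < 0) (h : IsLimitOfHasRank a s) : 3 < s :=
  lt_of_isLimitOfHasRank (C := {b | 0 ≤ binaryDisc (hessBinary b)})
    (isClosed_le continuous_const (by simp only [binaryDisc, hessBinary]; simp; fun_prop))
    (fun _ => binaryDisc_hessBinary_nonneg) (by simpa using ha) h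

/-- A sum of three cubes with nonvanishing Hessian has no singular point. -/
lemma not_isSumOfCubes_three_of_singular {a : Fin 10 → ℝ} {u v : Fin 3 → ℝ} (hv : v ≠ 0)
    (hsing : ∀ w, cubicPolar a v v w = 0) (hu : (hessMat a u).det ≠ 0) :
    ¬ IsSumOfCubes (cubicEval a) 3 := by
  intro h
  obtain ⟨c, p, rfl⟩ := isSumOfCubes_iff.1 h
  rw [det_hessMat_sum_three] at hu
  have hc : c 0 * c 1 * c 2 ≠ 0 := left_ne_zero_of_mul (left_ne_zero_of_mul hu)
  have hdet : (Matrix.of p).det ≠ 0 :=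
    ne_zero_pow two_ne_zero (right_ne_zero_of_mul (left_ne_zero_of_mul hu))
  have hpol : ∀ w, cubicPolar (∑ i, c i • veronese (p i)) v v w =
      ∑ i, c i * (p i ⬝ᵥ v) ^ 2 * (p i ⬝ᵥ w) := fun w => by
    simp [cubicPolar, Fin.sum_univ_three, veronese, dotProduct]; ring
  -- The gradient at `v` is a combination of the three independent `p i`, so every `p i ⬝ᵥ v`
  -- vanishes and `v` is zero.
  have hker : Matrix.vecMul (fun i => c i * (p i ⬝ᵥ v) ^ 2) (Matrix.of p) = 0 := by
    funext j
    have := hsing (Pi.single j 1)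
    simp only [hpol, dotProduct_single_one] at this
    simpa only [Matrix.vecMul, dotProduct, Matrix.of_apply, Pi.zero_apply] using this
  have hz := Matrix.eq_zero_of_vecMul_eq_zero hdet hker
  refine hv (Matrix.eq_zero_of_mulVec_eq_zero hdet ?_)
  funext i
  have hi := congrFun hz i
  have hci : c i ≠ 0 := by
    rintro h0
    fin_cases i <;> simp_all
  simpa [hci, Matrix.mulVec] using hi

/-! ### Ternary cubics that are not sums of four cubes -/

/-- For a sum of four cubes in general position, the quadrics apolar to the cubic take
proportional values at the four points. -/
lemma exists_proportional_of_apolar {c : Fin 4 → ℝ} {p : Fin 4 → Fin 3 → ℝ}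
    (hgen : ∀ v : Fin 3 → ℝ, v ≠ 0 → ∀ l, ∃ j, j ≠ l ∧ c j * (p j ⬝ᵥ v) ≠ 0) :
    ∃ t : Fin 4 → ℝ, (∀ i, t i ≠ 0) ∧ ∀ Q : Fin 4 → ℝ,
      (∀ k, ∑ i, c i * Q i * p i k = 0) → ∃ α, ∀ i, Q i = α * t i := by
  -- The rows are the vectors `c j • p j` with `j ≠ l`; general position says that any three of them
  -- are independent.
  let N (l : Fin 4) : Matrix (Fin 3) (Fin 3) ℝ :=
    Matrix.of fun m => c (l.succAbove m) • p (l.succAbove m)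
  have hN : ∀ l, (N l).det ≠ 0 := by
    intro l h0
    obtain ⟨v, hv, hk⟩ := Matrix.exists_mulVec_eq_zero_iff.2 h0
    obtain ⟨j, hj, hne⟩ := hgen v hv l
    obtain ⟨m, rfl⟩ := Fin.exists_succAbove_eq hj
    have := congrFun hk m
    simp only [N, Matrix.mulVec, Matrix.of_apply, smul_dotProduct, smul_eq_mul,
      Pi.zero_apply] at this
    exact hne this
  have hrel : ∀ y : Fin 4 → ℝ, (∀ k, ∑ i, c i * y i * p i k = 0) → ∀ l, y l = 0 → y = 0 := by
    intro y hy l hl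
    have hz : Matrix.vecMul (fun m => y (l.succAbove m)) (N l) = 0 := by
      funext k
      have := hy k
      rw [Fin.sum_univ_succAbove _ l, hl] at this
      simp only [mul_zero, zero_mul, zero_add] at this
      rw [Pi.zero_apply, ← this]
      simp only [Matrix.vecMul, dotProduct, N, Matrix.of_apply, Pi.smul_apply, smul_eq_mul]
      exact Finset.sum_congr rfl fun m _ => by ring
    have := Matrix.eq_zero_of_vecMul_eq_zero (hN l) hz
    funext i
    by_cases hi : i = l
    · rw [hi, hl]; rfl
    · obtain ⟨m, rfl⟩ := Fin.exists_succAbove_eq hi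
      exact congrFun this m
  have hu : IsUnit (N 0).det := isUnit_iff_ne_zero.2 (hN 0)
  -- Expressing the vector with index 0 through the other three gives the linear relation `t` among
  -- the four. By `hrel` it is unique up to a factor and has no zero entry.
  let x := Matrix.vecMul (c 0 • p 0) (N 0)⁻¹
  have hx : Matrix.vecMul x (N 0) = c 0 • p 0 := by
    simp only [x, Matrix.vecMul_vecMul, Matrix.nonsing_inv_mul _ hu, Matrix.vecMul_one]
  let t : Fin 4 → ℝ := Fin.cons 1 (fun m => -x m)
  have ht : ∀ k, ∑ i, c i * t i * p i k = 0 := by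
    intro k
    have := congrFun hx k
    simp only [Matrix.vecMul, dotProduct, N, Matrix.of_apply, Pi.smul_apply, smul_eq_mul,
      Fin.zero_succAbove, Fin.sum_univ_three] at this
    rw [Fin.sum_univ_succ, Fin.sum_univ_three]
    simp only [t, Fin.cons_zero, Fin.cons_succ]
    linarith
  have ht0 : t 0 = 1 := rfl
  refine ⟨t, fun i hi => ?_, fun Q hQ => ⟨Q 0, fun i => ?_⟩⟩
  · have := hrel t ht i hi
    rw [this] at ht0
    simp at ht0
  · have := hrel (fun i => Q i - Q 0 * t i) (fun k => ?_) 0 (by simp [ht0])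
    · have hi := congrFun this i
      simp only [Pi.zero_apply] at hi
      linarith
    · have e : ∀ i, c i * (Q i - Q 0 * t i) * p i k =
          c i * Q i * p i k - Q 0 * (c i * t i * p i k) := fun i => by ring
      simp only [e, Finset.sum_sub_distrib, ← Finset.mul_sum, hQ, ht, mul_zero, sub_zero]

lemma cubicPolar_sum_cubes {r : ℕ} (c : Fin r → ℝ) (p : Fin r → Fin 3 → ℝ) (u v w : Fin 3 → ℝ) :
    cubicPolar (∑ i, c i • veronese (p i)) u v w =
      ∑ i, c i * ((p i ⬝ᵥ u) * (p i ⬝ᵥ v) * (p i ⬝ᵥ w)) := by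
  have h1 := cubicPolar_eq (∑ i, c i • veronese (p i)) u v w
  simp only [cubicEval_sum, cubicEval_smul, cubicEval_veronese, dotProduct_add] at h1
  have h2 : ∑ i, c i * ((p i ⬝ᵥ u) * (p i ⬝ᵥ v) * (p i ⬝ᵥ w)) * 6 =
      6 * cubicPolar (∑ i, c i • veronese (p i)) u v w := by
    rw [h1]
    simp only [← Finset.sum_sub_distrib, ← Finset.sum_add_distrib]
    exact Finset.sum_congr rfl fun i _ => by ring
  rw [← Finset.sum_mul] at h2
  linarith

/-- The polar conic of a sum of cubes at a point where all but one of the linear forms vanish. -/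
lemma hessMat_eq_of_forall_ne {c : Fin 4 → ℝ} {p : Fin 4 → Fin 3 → ℝ} {v : Fin 3 → ℝ} {l : Fin 4}
    (h : ∀ j, j ≠ l → c j * (p j ⬝ᵥ v) = 0) (i j : Fin 3) :
    hessMat (∑ i, c i • veronese (p i)) v i j = c l * (p l ⬝ᵥ v) * (p l i * p l j) := by
  have h1 := cubicPolar_eq_dotProduct (∑ i, c i • veronese (p i)) v (Pi.single i 1) (Pi.single j 1)
  rw [cubicPolar_sum_cubes, Finset.sum_eq_single l] at h1
  · simp at h1
    rw [← h1]; ring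
  · intro k _ hk
    have := h k hk
    linear_combination ((p k ⬝ᵥ Pi.single i 1) * (p k ⬝ᵥ Pi.single j 1)) * this
  · simp

/-- The coefficient vector of `z (x² + y²) + k z³`. -/
noncomputable def lineConicVec (k : ℝ) : Fin 10 → ℝ := ![0, 0, k, 0, 1 / 3, 0, 1 / 3, 0, 0, 0]

/-- The conics XY, X² - Y² and Z² - 3kX² are apolar to this cubic, so their values at the four
points are proportional to one vector `t`. For `k ≤ 0` the third conic is nonnegative, which gives
all `t i` the same sign; the first two then force a common ratio of the first two coordinates, and
the points lie in a plane. -/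
lemma not_isSumOfCubes_four_lineConicVec {k : ℝ} (hk : k ≤ 0) :
    ¬ IsSumOfCubes (cubicEval (lineConicVec k)) 4 := by
  intro h
  obtain ⟨c, p, ha⟩ := isSumOfCubes_iff.1 h
  have hgen : ∀ v : Fin 3 → ℝ, v ≠ 0 → ∀ l, ∃ j, j ≠ l ∧ c j * (p j ⬝ᵥ v) ≠ 0 := by
    intro v hv l
    by_contra! hcon
    -- Without general position the polar conic at some `v ≠ 0` would have rank at most one;
    -- comparing entries forces `v` to vanish.
    have hM := hessMat_eq_of_forall_ne hcon
    rw [← ha] at hM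
    have m00 := hM 0 0
    have m01 := hM 0 1
    have m02 := hM 0 2
    have m11 := hM 1 1
    have m12 := hM 1 2
    have m22 := hM 2 2
    generalize c l * (p l ⬝ᵥ v) = κ at m00 m01 m02 m11 m12 m22
    simp [hessMat, lineConicVec] at m00 m01 m02 m11 m12 m22
    have h2 : v 2 = 0 := by
      have : v 2 * v 2 = 0 := by
        have e : (3⁻¹ * v 2) * (3⁻¹ * v 2) = (κ * (p l 0 * p l 1)) ^ 2 := by
          nth_rewrite 1 [m00]; rw [m11]; ring
        rw [show κ * (p l 0 * p l 1) = 0 by rcases m01 with h | h | h <;> simp [h]] at e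
        linarith
      exact mul_self_eq_zero.1 this
    rw [h2] at m00 m11 m22
    simp only [mul_zero] at m00 m11 m22
    have h0 : v 0 = 0 := by
      have : v 0 * v 0 = 0 := by
        have e : (3⁻¹ * v 0) * (3⁻¹ * v 0) = (κ * (p l 0 * p l 0)) * (κ * (p l 2 * p l 2)) := by
          rw [m02]; ring
        rw [← m00] at e
        linarith
      exact mul_self_eq_zero.1 this
    have h1 : v 1 = 0 := by
      have : v 1 * v 1 = 0 := by
        have e : (3⁻¹ * v 1) * (3⁻¹ * v 1) = (κ * (p l 1 * p l 1)) * (κ * (p l 2 * p l 2)) := by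
          rw [m12]; ring
        rw [← m11] at e
        linarith
      exact mul_self_eq_zero.1 this
    exact hv (by funext i; fin_cases i <;> assumption)
  have hspan : ∀ v : Fin 3 → ℝ, v ≠ 0 → ¬ ∀ i, p i ⬝ᵥ v = 0 := by
    intro v hv hall
    obtain ⟨j, -, hj⟩ := hgen v hv 0
    exact hj (by rw [hall, mul_zero])
  obtain ⟨t, ht, hQ⟩ := exists_proportional_of_apolar hgen
  have hcoef : ∀ i, lineConicVec k i = (∑ i, c i • veronese (p i)) i := congrFun ha
  have e0 := hcoef 0
  have e1 := hcoef 1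
  have e2 := hcoef 2
  have e3 := hcoef 3
  have e4 := hcoef 4
  have e5 := hcoef 5
  have e6 := hcoef 6
  have e7 := hcoef 7
  have e8 := hcoef 8
  have e9 := hcoef 9
  simp [lineConicVec, veronese, Fin.sum_univ_four] at e0 e1 e2 e3 e4 e5 e6 e7 e8 e9
  obtain ⟨α, hα⟩ := hQ (fun i => p i 0 * p i 1) (fun k => by
    fin_cases k <;> simp [Fin.sum_univ_four] <;> linarith)
  obtain ⟨β, hβ⟩ := hQ (fun i => p i 0 ^ 2 - p i 1 ^ 2) (fun k => by
    fin_cases k <;> simp [Fin.sum_univ_four] <;> linarith)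
  obtain ⟨γ, hγ⟩ := hQ (fun i => p i 2 ^ 2 - 3 * k * p i 0 ^ 2) (fun k => by
    fin_cases k <;> simp [Fin.sum_univ_four]
    · linear_combination 3 * k * e0 - e7
    · linear_combination 3 * k * e3 - e8
    · linear_combination 3 * k * e4 - e2)
  clear hQ hcoef ha e0 e1 e2 e3 e4 e5 e6 e7 e8 e9
  have hkp : ∀ i, 0 ≤ -k * p i 0 ^ 2 := fun i => mul_nonneg (neg_nonneg.2 hk) (sq_nonneg _)
  have hγ0 : γ ≠ 0 := by
    rintro rfl
    refine hspan ![0, 0, 1] (fun h => by simpa using congrFun h 2) fun i => ?_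
    have h1 := hγ i
    have h2 : p i 2 ^ 2 = 0 := le_antisymm (by linarith [hkp i]) (sq_nonneg _)
    simpa [dotProduct, Fin.sum_univ_three] using h2
  -- This is where the sign of `k` enters.
  have hpos : ∀ i, 0 < γ * t i := fun i => by
    have h1 := hγ i
    refine lt_of_le_of_ne ?_ (mul_ne_zero hγ0 (ht i)).symm
    rw [← h1]
    linarith [hkp i, sq_nonneg (p i 2)]
  -- The square of the left side is (2 p₀ p₁)² + (p₀² - p₁²)² = (4α² + β²) t². Since `γ * t i` is
  -- positive for every `i`, the same square root `δ` serves all four points.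
  obtain ⟨δ, hδ⟩ : ∃ δ, ∀ i, p i 0 ^ 2 + p i 1 ^ 2 = δ * (γ * t i) := by
    refine ⟨√((4 * α ^ 2 + β ^ 2) / γ ^ 2), fun i => ?_⟩
    rw [← Real.sqrt_sq (hpos i).le, ← Real.sqrt_mul (by positivity), eq_comm,
      Real.sqrt_eq_iff_mul_self_eq (by positivity) (by positivity)]
    field_simp
    linear_combination -4 * (p i 0 * p i 1 + α * t i) * hα i -
      (p i 0 ^ 2 - p i 1 ^ 2 + β * t i) * hβ i
  have hX : ∀ i, p i 0 ^ 2 = ((δ * γ + β) / 2) * t i := fun i => by linarith [hδ i, hβ i]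
  have hY : ∀ i, p i 1 ^ 2 = ((δ * γ - β) / 2) * t i := fun i => by linarith [hδ i, hβ i]
  generalize (δ * γ + β) / 2 = A at hX
  generalize (δ * γ - β) / 2 = B at hY
  have hAB : α ^ 2 = A * B := by
    have : α ^ 2 * t 0 ^ 2 = A * B * t 0 ^ 2 := by
      linear_combination -(p 0 0 * p 0 1 + α * t 0) * hα 0 + p 0 1 ^ 2 * hX 0 + A * t 0 * hY 0
    exact mul_right_cancel₀ (pow_ne_zero 2 (ht 0)) this
  by_cases hA : A = 0
  · refine hspan ![1, 0, 0] (fun h => by simpa using congrFun h 0) fun i => ?_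
    have := hX i
    rw [hA, zero_mul] at this
    simpa [dotProduct, Fin.sum_univ_three] using this
  · refine hspan ![α, -A, 0] (fun h => hA (by simpa using congrFun h 1)) fun i => ?_
    have : (p i 0 * α + p i 1 * (-A)) ^ 2 = 0 := by
      linear_combination α ^ 2 * hX i + A ^ 2 * hY i - 2 * α * A * hα i - A * t i * hAB
    simpa [dotProduct, Fin.sum_univ_three] using this

/-- Here XZ and Z² are apolar to the cubic. If Z² vanishes at the four points they lie in the plane
Z = 0; otherwise it vanishes at none of them, and the ratio X : Z is the same for all. Either way
the points fail to span. -/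
lemma not_isSumOfCubes_four_tangent :
    ¬ IsSumOfCubes (cubicEval ![0, 0, 0, 6, 0, 0, 6, 0, 0, 0]) 4 := by
  intro h
  obtain ⟨c, p, ha⟩ := isSumOfCubes_iff.1 h
  have hgen : ∀ v : Fin 3 → ℝ, v ≠ 0 → ∀ l, ∃ j, j ≠ l ∧ c j * (p j ⬝ᵥ v) ≠ 0 := by
    intro v hv l
    by_contra! hcon
    have hM := hessMat_eq_of_forall_ne hcon
    rw [← ha] at hM
    have hκ : c l * (p l ⬝ᵥ v) = c l * (p l 0 * v 0 + p l 1 * v 1 + p l 2 * v 2) := by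
      simp [dotProduct, Fin.sum_univ_three]
    have m00 := hM 0 0
    have m01 := hM 0 1
    have m11 := hM 1 1
    have m12 := hM 1 2
    have m22 := hM 2 2
    generalize c l * (p l ⬝ᵥ v) = κ at hκ m00 m01 m11 m12 m22
    simp [hessMat] at m00 m01 m11 m12 m22
    have hκ2 : κ * p l 2 = 0 := by rcases m22 with h | h <;> simp [h]
    have h1 : v 1 = 0 := by
      rw [show κ * (p l 1 * p l 2) = p l 1 * (κ * p l 2) by ring, hκ2] at m12
      simpa using m12
    rw [h1, mul_zero] at m00
    have hκ0 : κ * p l 0 = 0 := by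
      rcases mul_eq_zero.1 m00.symm with h | h
      · simp [h]
      · simp [mul_self_eq_zero.1 h]
    have h0 : v 0 = 0 := by
      rw [show κ * (p l 0 * p l 1) = p l 1 * (κ * p l 0) by ring, hκ0] at m01
      simpa [h1] using m01
    rw [h0, h1] at hκ
    have hk0 : κ = 0 := by
      have : κ * κ = 0 := by
        nth_rewrite 2 [hκ]
        linear_combination (c l * v 2) * hκ2
      exact mul_self_eq_zero.1 this
    have h2 : v 2 = 0 := by simpa [hk0, h1] using m11
    exact hv (by funext i; fin_cases i <;> assumption)
  have hspan : ∀ v : Fin 3 → ℝ, v ≠ 0 → ¬ ∀ i, p i ⬝ᵥ v = 0 := by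
    intro v hv hall
    obtain ⟨j, -, hj⟩ := hgen v hv 0
    exact hj (by rw [hall, mul_zero])
  obtain ⟨t, ht, hQ⟩ := exists_proportional_of_apolar hgen
  have hcoef := congrFun ha
  have e2 := hcoef 2
  have e4 := hcoef 4
  have e7 := hcoef 7
  have e8 := hcoef 8
  have e9 := hcoef 9
  simp [veronese, Fin.sum_univ_four] at e2 e4 e7 e8 e9
  obtain ⟨α, hα⟩ := hQ (fun i => p i 0 * p i 2) (fun k => by
    fin_cases k <;> simp [Fin.sum_univ_four] <;> linarith)
  obtain ⟨γ, hγ⟩ := hQ (fun i => p i 2 ^ 2) (fun k => by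
    fin_cases k <;> simp [Fin.sum_univ_four] <;> linarith)
  by_cases hγ0 : γ = 0
  · refine hspan ![0, 0, 1] (fun h => by simpa using congrFun h 2) fun i => ?_
    have := hγ i
    rw [hγ0, zero_mul] at this
    simpa [dotProduct, Fin.sum_univ_three] using this
  · refine hspan ![γ, 0, -α] (fun h => hγ0 (by simpa using congrFun h 0)) fun i => ?_
    have h2 : p i 2 ≠ 0 := by
      intro h
      have := hγ i
      rw [h, zero_pow two_ne_zero] at this
      exact mul_ne_zero hγ0 (ht i) this.symm
    have : (p i 0 * γ + p i 2 * (-α)) * p i 2 = 0 := by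
      linear_combination γ * hα i - α * hγ i
    simpa [dotProduct, Fin.sum_univ_three, h2] using this

/-! ### Ranks of the normal forms -/

/-- The coefficient vector of the normal form of a type; the parameter only matters for the Hesse
pencil. -/
noncomputable def normalVec (lam : ℝ) : CubicType → Fin 10 → ℝ
  | .tripleLine => ![1, 0, 0, 0, 0, 0, 0, 0, 0, 0]
  | .imaginaryConcurrentLines => ![1, 0, 0, 0, 0, 1 / 3, 0, 0, 0, 0]
  | .realConcurrentLines => ![1, 0, 0, 0, 0, -1 / 3, 0, 0, 0, 0]
  | .doubleLinePlusLine => ![0, 0, 0, 1 / 3, 0, 0, 0, 0, 0, 0]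
  | .imaginaryConicPlusLine => ![1, 0, 0, 0, 0, 1 / 3, 0, 1 / 3, 0, 0]
  | .realConicPlusExternalLine => lineConicVec (-1)
  | .realConicPlusSecantLine => ![0, 1, 0, 1 / 3, 0, 0, 0, 0, -1 / 3, 0]
  | .realConicPlusTangentLine => ![0, 0, 0, 6, 0, 0, 6, 0, 0, 0]
  | .realFermat => ![1, 1, 1, 0, 0, 0, 0, 0, 0, 0]
  | .imaginaryFermat => ![1, 1, 1, 0, 0, 0, 0, 0, 0, 1]
  | .hessePencil => ![1, 1, 1, 0, 0, 0, 0, 0, 0, lam]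
  | .imaginaryTriangle => ![1, 1, 1, 0, 0, 0, 0, 0, 0, -1 / 2]
  | .cusp => ![-1, 0, 0, 0, 0, 0, 1 / 3, 0, 0, 0]
  | .nodalCubic => ![1, 1, 0, 0, 0, 0, 0, 0, 0, 1]
  | .cubicaPunctata => ![-1, 0, 0, 0, 1 / 3, 0, 1 / 3, 0, 0, 0]
  | .realTriangle => ![0, 0, 0, 0, 0, 0, 0, 0, 0, 1 / 6]

/-- The real border rank of a ternary cubic given by its coefficient vector is `r`. -/
def HasBorderRank (a : Fin 10 → ℝ) (r : ℕ) : Prop :=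
  IsLeast {s : ℕ | 0 < s ∧ IsLimitOfHasRank a s} r

lemma hasBorderRank_succ {a : Fin 10 → ℝ} {r : ℕ} (h : IsLimitOfHasRank a (r + 1))
    (h' : ∀ s, 0 < s → IsLimitOfHasRank a s → r < s) : HasBorderRank a (r + 1) :=
  ⟨⟨r.succ_pos, h⟩, fun s hs => h' s hs.1 hs.2⟩

/-- A lower bound for the border rank which is attained by the rank. -/
lemma hasRank_and_hasBorderRank {a : Fin 10 → ℝ} {r : ℕ} (h : IsSumOfCubes (cubicEval a) (r + 1))
    (h' : ∀ s, IsLimitOfHasRank a s → r < s) :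
    HasRank a (r + 1) ∧ (IsLimitOfHasRank a 4 → HasBorderRank a (r + 1)) := by
  classical
  have hr : HasRank a (r + 1) := by
    refine hasRank_succ h fun hr => ?_
    have hex : ∃ s, IsSumOfCubes (cubicEval a) s := ⟨r, hr⟩
    have := h' _ (isLimitOfHasRank_of_hasRank
      ⟨Nat.find_spec hex, fun s hs => Nat.find_min' hex hs⟩)
    exact absurd (Nat.find_min' hex hr) (by omega)
  exact ⟨hr, fun _ => hasBorderRank_succ (isLimitOfHasRank_of_hasRank hr) fun s _ hs => h' s hs⟩

lemma isSumOfCubes_yyz : IsSumOfCubes (fun v => v 1 ^ 2 * v 2) 3 :=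
  ⟨![1 / 6, 1 / 6, -1 / 3], ![![0, 1, 1], ![0, -1, 1], ![0, 0, 1]], fun v => by
    simp [Fin.sum_univ_three, dotProduct]; ring⟩

lemma IsSumOfCubes.add {F G : (Fin 3 → ℝ) → ℝ} {r s : ℕ} (hF : IsSumOfCubes F r)
    (hG : IsSumOfCubes G s) : IsSumOfCubes (fun v => F v + G v) (r + s) := by
  obtain ⟨c, p, hF⟩ := hF
  obtain ⟨d, q, hG⟩ := hG
  refine ⟨Fin.append c d, Fin.append p q, fun v => ?_⟩
  rw [Fin.sum_univ_add]
  simp [hF, hG]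

lemma isSumOfCubes_one (c : ℝ) (p : Fin 3 → ℝ) : IsSumOfCubes (fun v => c * (p ⬝ᵥ v) ^ 3) 1 :=
  ⟨fun _ => c, fun _ => p, by simp⟩

lemma isSumOfCubes_lineConicVec_one : IsSumOfCubes (cubicEval (lineConicVec 1)) 4 := by
  have hr : √(2 / 3 : ℝ) ^ 2 = 2 / 3 := Real.sq_sqrt (by norm_num)
  generalize √(2 / 3 : ℝ) = r at hr
  refine ⟨fun _ => 1 / 4, ![![r, 0, 1], ![-r, 0, 1], ![0, r, 1], ![0, -r, 1]], fun v => ?_⟩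
  simp [Fin.sum_univ_four, dotProduct, Fin.sum_univ_three, cubicEval, lineConicVec]
  linear_combination (-(3 / 2) * v 2 * (v 0 ^ 2 + v 1 ^ 2)) * hr

/-- Changing `k` costs one multiple of z³ on top of the four cubes for `k = 1`. -/
lemma isSumOfCubes_lineConicVec (k : ℝ) : IsSumOfCubes (cubicEval (lineConicVec k)) 5 := by
  have := isSumOfCubes_lineConicVec_one.add (isSumOfCubes_one (k - 1) ![0, 0, 1])
  convert this using 2 with v
  simp [dotProduct, Fin.sum_univ_three, cubicEval, lineConicVec]
  ring

lemma hasRank_lineConicVec {k : ℝ} (hk : k ≤ 0) : HasRank (lineConicVec k) 5 :=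
  hasRank_succ (isSumOfCubes_lineConicVec k) (not_isSumOfCubes_four_lineConicVec hk)

/-- The cubic is x + y + z times x² + y² + z² - xy - yz - zx, and the quadratic factor is (3/4)(x -
y)² + (1/4)(x + y - 2z)². -/
lemma linEquivalent_imaginaryTriangle (lam : ℝ) :
    LinEquivalent (cubicEval (normalVec lam .imaginaryTriangle)) (cubicEval (lineConicVec 0)) := by
  have hr : √(3 : ℝ) ^ 2 = 3 := Real.sq_sqrt (by norm_num)
  have hr0 : √(3 : ℝ) ≠ 0 := by positivity
  generalize √(3 : ℝ) = r at hr hr0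
  refine ⟨!![r / 2, -r / 2, 0; 1 / 2, 1 / 2, -1; 1, 1, 1], ?_, 1, one_ne_zero, fun v => ?_⟩
  · rw [Matrix.det_fin_three]
    simp
    ring_nf
    simpa using hr0
  · simp [cubicEval, normalVec, lineConicVec, Matrix.mulVec, dotProduct, Fin.sum_univ_three]
    linear_combination (-(1 / 4) * (v 0 + v 1 + v 2) * (v 0 - v 1) ^ 2) * hr

lemma linEquivalent_imaginaryConicPlusLine (lam : ℝ) :
    LinEquivalent (cubicEval (normalVec lam .imaginaryConicPlusLine))
      (cubicEval (lineConicVec 1)) := by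
  refine ⟨!![0, 1, 0; 0, 0, 1; 1, 0, 0], ?_, 1, one_ne_zero, fun v => ?_⟩
  · rw [Matrix.det_fin_three]; simp
  · simp [cubicEval, normalVec, lineConicVec, Matrix.mulVec, dotProduct, Fin.sum_univ_three]
    ring

/-- With s = x + y + z, the last three forms are (1 - k)s + 2kx and its permutations. Symmetric
cubics are spanned by s³, s(xy + yz + zx) and xyz; the sum of these three cubes over 8k² already has
the right coefficients at the last two, and a multiple of s³ corrects the first. -/
lemma isSumOfCubes_hesse {lam : ℝ} (h : lam ≠ -1 / 2) :
    IsSumOfCubes (cubicEval ![1, 1, 1, 0, 0, 0, 0, 0, 0, lam]) 4 := by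
  obtain ⟨k, rfl⟩ : ∃ k, lam = (k - 1) / 2 := ⟨1 + 2 * lam, by ring⟩
  have hk : k ≠ 0 := by rintro rfl; exact h (by norm_num)
  refine ⟨![1 + 3 * (1 - k) / k ^ 2 - (3 - k) ^ 3 / (8 * k ^ 2), 1 / (8 * k ^ 2), 1 / (8 * k ^ 2),
    1 / (8 * k ^ 2)], ![![1, 1, 1], ![1 - k, 1 - k, 1 + k], ![1 - k, 1 + k, 1 - k],
      ![1 + k, 1 - k, 1 - k]], fun v => ?_⟩
  simp [Fin.sum_univ_four, dotProduct, Fin.sum_univ_three, cubicEval]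
  field_simp
  ring

lemma isSumOfCubes_nodalCubic (lam : ℝ) :
    IsSumOfCubes (cubicEval (normalVec lam .nodalCubic)) 4 := by
  have hs : √(5 : ℝ) ^ 2 = 5 := Real.sq_sqrt (by norm_num)
  obtain ⟨r, hr⟩ : ∃ r : ℝ, r ^ 2 + r = 1 := ⟨(-1 + √5) / 2, by linear_combination (1 / 4) * hs⟩
  refine ⟨![1 / 15, 1 / 3, -1 / 5, -1 / 5],
    ![![2, 2, 1], ![-1, -1, 1], ![r, -1 - r, 1], ![-1 - r, r, 1]], fun v => ?_⟩
  simp [Fin.sum_univ_four, dotProduct, Fin.sum_univ_three, cubicEval, normalVec]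
  linear_combination ((3 / 5) * (2 * v 2 - v 0 - v 1) * (v 0 - v 1) ^ 2) * hr

lemma isSumOfCubes_cubicaPunctata (lam : ℝ) :
    IsSumOfCubes (cubicEval (normalVec lam .cubicaPunctata)) 4 := by
  refine ⟨![50 / 243, 50 / 243, -25 / 54, 25 / 486],
    ![![0, 9 / 10, 1], ![0, -9 / 10, 1], ![-3 / 10, 0, 1], ![-27 / 10, 0, 1]], fun v => ?_⟩
  simp [Fin.sum_univ_four, dotProduct, Fin.sum_univ_three, cubicEval, normalVec]
  ring

lemma isSumOfCubes_realConicPlusSecantLine (lam : ℝ) :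
    IsSumOfCubes (cubicEval (normalVec lam .realConicPlusSecantLine)) 4 := by
  refine ⟨![2 / 3, 2 / 3, -1 / 6, -1 / 6],
    ![![1 / 2, 1, 0], ![-1 / 2, 1, 0], ![0, 1, 1], ![0, 1, -1]], fun v => ?_⟩
  simp [Fin.sum_univ_four, dotProduct, Fin.sum_univ_three, cubicEval, normalVec]
  ring

lemma isSumOfCubes_realTriangle (lam : ℝ) :
    IsSumOfCubes (cubicEval (normalVec lam .realTriangle)) 4 := by
  refine ⟨![1 / 24, -1 / 24, -1 / 24, -1 / 24],
    ![![1, 1, 1], ![1, 1, -1], ![1, -1, 1], ![-1, 1, 1]], fun v => ?_⟩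
  simp [Fin.sum_univ_four, dotProduct, Fin.sum_univ_three, cubicEval, normalVec]
  ring

/-- The first two cubes give 18x²y + 6y³; the last three form a second difference of the cube of 3z
in direction y, equal to 18y²z - 6y³. -/
lemma isSumOfCubes_realConicPlusTangentLine (lam : ℝ) :
    IsSumOfCubes (cubicEval (normalVec lam .realConicPlusTangentLine)) 5 := by
  refine ⟨![3, 3, 1, 1, -2],
    ![![1, 1, 0], ![-1, 1, 0], ![0, 0, 3], ![0, -2, 3], ![0, -1, 3]], fun v => ?_⟩
  simp [Fin.sum_univ_five, dotProduct, Fin.sum_univ_three, cubicEval, normalVec]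
  ring

lemma hasRank_doubleLinePlusLine (lam : ℝ) : HasRank (normalVec lam .doubleLinePlusLine) 3 := by
  refine hasRank_succ ⟨![1 / 6, 1 / 6, -1 / 3], ![![1, 1, 0], ![-1, 1, 0], ![0, 1, 0]],
    fun v => ?_⟩ fun h => ?_
  · simp [Fin.sum_univ_three, dotProduct, cubicEval, normalVec]
    ring
  -- The discriminant of x²y vanishes, so one of the two terms is zero or the linear forms are
  -- dependent on z = 0; then the minor would vanish too, but it does not.
  · obtain ⟨c, p, h⟩ := isSumOfCubes_iff.1 h
    have h1 := minor_sum_two c p _ h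
    have h2 := binaryDisc_restrictBinary_sum_two c p
    rw [← h] at h2
    simp [normalVec, binaryDisc, restrictBinary] at h1 h2
    rcases h2 with (h | h) | h <;> simp [h] at h1

/-- The family is the difference quotient ((x + εy)³ - x³) / (3ε). -/
lemma isLimitOfHasRank_doubleLinePlusLine (lam : ℝ) :
    IsLimitOfHasRank (normalVec lam .doubleLinePlusLine) 2 := by
  refine ⟨fun ε => ![0, ε ^ 2 / 3, 0, 1 / 3, 0, ε / 3, 0, 0, 0, 0], fun ε hε => ?_, ?_⟩
  · refine hasRank_succ ⟨![1 / (3 * ε), -1 / (3 * ε)], ![![1, ε, 0], ![1, 0, 0]], fun v => ?_⟩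
      fun h => ?_
    · simp [Fin.sum_univ_three, dotProduct, cubicEval]
      field_simp
      ring
    · have := minor_eq_zero h
      simp at this
  · refine Tendsto.mono_left ?_ nhdsWithin_le_nhds
    have : Continuous fun ε : ℝ => ![0, ε ^ 2 / 3, 0, 1 / 3, 0, ε / 3, 0, 0, 0, 0] :=
      continuous_pi fun i => by fin_cases i <;> simp <;> fun_prop
    convert this.tendsto 0 using 2
    simp [normalVec]

/-- The family is a second difference quotient of cubes along the curve y + εx + ε²z; the factor 18
of the normal form comes from it. The nonzero Hessian keeps the rank at exactly three. -/
lemma isLimitOfHasRank_realConicPlusTangentLine (lam : ℝ) :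
    IsLimitOfHasRank (normalVec lam .realConicPlusTangentLine) 3 := by
  refine ⟨fun ε => ![0, 0, 6 * ε ^ 4, 6, 6 * ε ^ 2, 0, 6, 0, 6 * ε ^ 2, 0], fun ε hε => ?_, ?_⟩
  · refine hasRank_succ ⟨![3 / ε ^ 2, 3 / ε ^ 2, -6 / ε ^ 2],
      ![![ε, 1, ε ^ 2], ![-ε, 1, ε ^ 2], ![0, 1, 0]], fun v => ?_⟩ fun h => ?_
    · simp [Fin.sum_univ_three, dotProduct, cubicEval]
      field_simp
      ring
    · have := det_hessMat_eq_zero h ![0, 1, 0]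
      simp [hessMat, Matrix.det_fin_three] at this
  · refine Tendsto.mono_left ?_ nhdsWithin_le_nhds
    have : Continuous fun ε : ℝ =>
        ![0, 0, 6 * ε ^ 4, 6, 6 * ε ^ 2, 0, 6, 0, 6 * ε ^ 2, 0] :=
      continuous_pi fun i => by fin_cases i <;> simp <;> fun_prop
    convert this.tendsto 0 using 2
    simp [normalVec]

lemma hasRank_cusp (lam : ℝ) : HasRank (normalVec lam .cusp) 4 := by
  refine hasRank_succ ?_ (not_isSumOfCubes_three_of_singular (u := ![1, 1, 0]) (v := ![0, 0, 1])
    (fun h => by simpa using congrFun h 2) (fun w => by simp [cubicPolar, normalVec]) ?_)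
  · convert isSumOfCubes_yyz.add (isSumOfCubes_one (-1) ![1, 0, 0]) using 2 with v
    simp [dotProduct, Fin.sum_univ_three, cubicEval, normalVec]
    ring
  · simp [hessMat, Matrix.det_fin_three, normalVec]

lemma isLimitOfHasRank_cusp (lam : ℝ) : IsLimitOfHasRank (normalVec lam .cusp) 3 := by
  refine ⟨fun ε => ![-1, 0, ε ^ 2 / 3, 0, 0, 0, 1 / 3, 0, ε / 3, 0], fun ε hε => ?_, ?_⟩
  · refine hasRank_succ ⟨![1 / (3 * ε), -1 / (3 * ε), -1],
      ![![0, 1, ε], ![0, 1, 0], ![1, 0, 0]], fun v => ?_⟩ fun h => ?_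
    · simp [Fin.sum_univ_three, dotProduct, cubicEval]
      field_simp
      ring
    · have := det_hessMat_eq_zero h ![1, 1, 0]
      simp [hessMat, Matrix.det_fin_three] at this
  · refine Tendsto.mono_left ?_ nhdsWithin_le_nhds
    have : Continuous fun ε : ℝ => ![-1, 0, ε ^ 2 / 3, 0, 0, 0, 1 / 3, 0, ε / 3, 0] :=
      continuous_pi fun i => by fin_cases i <;> simp <;> fun_prop
    convert this.tendsto 0 using 2
    simp [normalVec]

/-- The rank and the border rank of the normal forms. -/
lemma normalVec_ranks {lam : ℝ} (h1 : lam ≠ -1 / 2)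
    (h2 : lam ≠ 0) (h3 : lam ≠ 1) (t : CubicType) :
    HasRank (normalVec lam t) t.tableRank ∧
      (IsLimitOfHasRank (normalVec lam t) 4 →
        HasBorderRank (normalVec lam t) t.tableBorderRank) := by
  cases t
  case tripleLine =>
    have hr : HasRank (normalVec lam .tripleLine) 1 := by
      refine hasRank_succ ⟨![1], ![![1, 0, 0]], fun v => ?_⟩ ?_
      · simp [dotProduct, Fin.sum_univ_three, cubicEval, normalVec]
      · rintro ⟨c, p, h⟩
        simpa [cubicEval, normalVec] using h ![1, 0, 0]
    exact ⟨hr, fun _ => hasBorderRank_succ (isLimitOfHasRank_of_hasRank hr) fun s hs _ => hs⟩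
  case imaginaryConcurrentLines =>
    refine hasRank_and_hasBorderRank ?_ fun s => one_lt_of_isLimit (by simp [normalVec])
    have hr : √(1 / 3 : ℝ) ^ 2 = 1 / 3 := Real.sq_sqrt (by norm_num)
    generalize √(1 / 3 : ℝ) = r at hr
    refine ⟨fun _ => 1 / 2, ![![1, r, 0], ![1, -r, 0]], fun v => ?_⟩
    simp [Fin.sum_univ_two, dotProduct, Fin.sum_univ_three, cubicEval, normalVec]
    linear_combination (-3 * v 0 * v 1 ^ 2) * hr
  case realConcurrentLines =>
    refine hasRank_and_hasBorderRank ⟨![4 / 3, -1 / 6, -1 / 6],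
      ![![1, 0, 0], ![1, 1, 0], ![1, -1, 0]], fun v => ?_⟩ fun s => two_lt_of_isLimit_of_disc ?_
    · simp [dotProduct, Fin.sum_univ_three, cubicEval, normalVec]
      ring
    · simp [binaryDisc, restrictBinary, normalVec]
      norm_num
  case doubleLinePlusLine =>
    exact ⟨hasRank_doubleLinePlusLine lam, fun _ => hasBorderRank_succ
      (isLimitOfHasRank_doubleLinePlusLine lam) fun s _ => one_lt_of_isLimit (by simp [normalVec])⟩
  case imaginaryConicPlusLine =>
    refine hasRank_and_hasBorderRank ?_
      fun s => three_lt_of_isLimit_of_aronholdS ?_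
    · exact (linEquivalent_imaginaryConicPlusLine lam).isSumOfCubes isSumOfCubes_lineConicVec_one
    · simp [aronholdS, normalVec]
  case realConicPlusExternalLine =>
    refine ⟨hasRank_lineConicVec (by norm_num), fun hlim => hasBorderRank_succ hlim fun s _ =>
      three_lt_of_isLimit_of_aronholdS ?_⟩
    simp [aronholdS, normalVec, lineConicVec]
  case realConicPlusSecantLine =>
    refine hasRank_and_hasBorderRank (isSumOfCubes_realConicPlusSecantLine lam)
      fun s => three_lt_of_isLimit_of_aronholdS ?_
    simp [aronholdS, normalVec]
  case realConicPlusTangentLine =>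
    refine ⟨hasRank_succ (isSumOfCubes_realConicPlusTangentLine lam)
      not_isSumOfCubes_four_tangent, fun _ => hasBorderRank_succ
      (isLimitOfHasRank_realConicPlusTangentLine lam) fun s _ =>
        two_lt_of_isLimit_of_det ![0, 1, 1] ?_⟩
    simp [hessMat, Matrix.det_fin_three, normalVec]
  case realFermat =>
    refine hasRank_and_hasBorderRank ⟨fun _ => 1, ![![1, 0, 0], ![0, 1, 0], ![0, 0, 1]],
      fun v => ?_⟩ fun s => two_lt_of_isLimit_of_det ![1, 1, 1] ?_
    · simp [dotProduct, Fin.sum_univ_three, cubicEval, normalVec]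
    · simp [hessMat, Matrix.det_fin_three, normalVec]
  case imaginaryFermat =>
    -- S is zero here, so the sign of the discriminant is needed: on z = 0 the Hessian is -(x³ +
    -- y³), which has only one real root.
    refine hasRank_and_hasBorderRank (isSumOfCubes_hesse (by norm_num))
      fun s => three_lt_of_isLimit_of_disc ?_
    simp [binaryDisc, hessBinary, normalVec]
  case hessePencil =>
    refine hasRank_and_hasBorderRank (isSumOfCubes_hesse h1)
      fun s => three_lt_of_isLimit_of_aronholdS ?_
    have e : aronholdS (normalVec lam .hessePencil) = lam * (1 - lam) * (1 + lam + lam ^ 2) := by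
      simp [aronholdS, normalVec]; ring
    rw [e]
    exact mul_ne_zero (mul_ne_zero h2 (sub_ne_zero.2 h3.symm))
      (by nlinarith [sq_nonneg (lam + 1 / 2)])
  case imaginaryTriangle =>
    refine ⟨(linEquivalent_imaginaryTriangle lam).hasRank (hasRank_lineConicVec le_rfl),
      fun hlim => hasBorderRank_succ hlim fun s _ => three_lt_of_isLimit_of_aronholdS ?_⟩
    simp [aronholdS, normalVec]
    norm_num
  case cusp =>
    refine ⟨hasRank_cusp lam, fun _ => hasBorderRank_succ (isLimitOfHasRank_cusp lam) fun s _ =>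
      two_lt_of_isLimit_of_det ![1, 1, 0] ?_⟩
    simp [hessMat, Matrix.det_fin_three, normalVec]
  case nodalCubic =>
    refine hasRank_and_hasBorderRank (isSumOfCubes_nodalCubic lam)
      fun s => three_lt_of_isLimit_of_aronholdS ?_
    simp [aronholdS, normalVec]
  case cubicaPunctata =>
    refine hasRank_and_hasBorderRank (isSumOfCubes_cubicaPunctata lam)
      fun s => three_lt_of_isLimit_of_aronholdS ?_
    simp [aronholdS, normalVec]
  case realTriangle =>
    refine hasRank_and_hasBorderRank (isSumOfCubes_realTriangle lam)
      fun s => three_lt_of_isLimit_of_aronholdS ?_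
    simp [aronholdS, normalVec]

/-! ### Inequivalence of the normal forms -/

lemma LinEquivalent.exists_polar {a b : Fin 10 → ℝ}
    (h : LinEquivalent (cubicEval a) (cubicEval b)) :
    ∃ A : Matrix (Fin 3) (Fin 3) ℝ, A.det ≠ 0 ∧ ∃ c : ℝ, c ≠ 0 ∧
      ∀ u v w, cubicPolar a u v w = c * cubicPolar b (A.mulVec u) (A.mulVec v) (A.mulVec w) := by
  obtain ⟨A, hA, c, hc, h⟩ := h
  refine ⟨A, hA, c, hc, fun u v w => ?_⟩
  have h1 := cubicPolar_eq a u v w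
  have h2 := cubicPolar_eq b (A.mulVec u) (A.mulVec v) (A.mulVec w)
  simp only [h, ← Matrix.mulVec_add] at h1 h2
  linear_combination h1 / 6 - c * h2 / 6

/-! ### Projectively invariant properties of cubics -/

/-- The singular points of a ternary cubic. -/
def singularPoints (a : Fin 10 → ℝ) : Set (Fin 3 → ℝ) := {v | ∀ w, cubicPolar a v v w = 0}

/-- The cubic has a real singular point. -/
def HasSingularPoint (a : Fin 10 → ℝ) : Prop := ∃ v ∈ singularPoints a, v ≠ 0

/-- The cubic has two distinct real singular points. -/
def HasTwoSingularPoints (a : Fin 10 → ℝ) : Prop :=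
  ∃ v ∈ singularPoints a, ∃ w ∈ singularPoints a, v ≠ 0 ∧ ∀ s : ℝ, w ≠ s • v

/-- All real singular points of the cubic lie on a line. -/
def HasCollinearSingularPoints (a : Fin 10 → ℝ) : Prop :=
  ∃ l : Fin 3 → ℝ, l ≠ 0 ∧ ∀ v ∈ singularPoints a, l ⬝ᵥ v = 0

/-- The cubic has a real singular point with semidefinite polar conic. -/
def HasSemidefiniteSingularPoint (a : Fin 10 → ℝ) : Prop :=
  ∃ v ∈ singularPoints a, v ≠ 0 ∧ ∀ w w', 0 ≤ cubicPolar a v w w * cubicPolar a v w' w'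

/-- The cubic contains a real line. -/
def ContainsLine (a : Fin 10 → ℝ) : Prop :=
  ∃ l : Fin 3 → ℝ, l ≠ 0 ∧ ∀ v, l ⬝ᵥ v = 0 → cubicEval a v = 0

/-- The Hessian of the cubic contains a real line. -/
def HessianContainsLine (a : Fin 10 → ℝ) : Prop :=
  ∃ l : Fin 3 → ℝ, l ≠ 0 ∧ ∀ v, l ⬝ᵥ v = 0 → ∃ w ≠ 0, ∀ u, cubicPolar a v w u = 0

section Invariance

variable {a b : Fin 10 → ℝ}

lemma mulVec_ne_zero {A : Matrix (Fin 3) (Fin 3) ℝ} (hA : A.det ≠ 0) {v : Fin 3 → ℝ}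
    (hv : v ≠ 0) : A.mulVec v ≠ 0 := fun h => hv (Matrix.eq_zero_of_mulVec_eq_zero hA h)

lemma vecMul_ne_zero {A : Matrix (Fin 3) (Fin 3) ℝ} (hA : A.det ≠ 0) {v : Fin 3 → ℝ}
    (hv : v ≠ 0) : Matrix.vecMul v A ≠ 0 := fun h => hv (Matrix.eq_zero_of_vecMul_eq_zero hA h)

lemma exists_mulVec_eq {A : Matrix (Fin 3) (Fin 3) ℝ} (hA : A.det ≠ 0) (w : Fin 3 → ℝ) :
    ∃ v, A.mulVec v = w :=
  ⟨A⁻¹.mulVec w, by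
    rw [Matrix.mulVec_mulVec, Matrix.mul_nonsing_inv _ (isUnit_iff_ne_zero.2 hA),
      Matrix.one_mulVec]⟩

lemma mulVec_mem_singularPoints {A : Matrix (Fin 3) (Fin 3) ℝ} (hA : A.det ≠ 0) {c : ℝ}
    (hc : c ≠ 0) (h : ∀ u v w, cubicPolar a u v w =
      c * cubicPolar b (A.mulVec u) (A.mulVec v) (A.mulVec w)) {v : Fin 3 → ℝ} :
    A.mulVec v ∈ singularPoints b ↔ v ∈ singularPoints a := by
  constructor
  · intro hv w
    rw [h, hv, mul_zero]
  · intro hv w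
    obtain ⟨w, rfl⟩ := exists_mulVec_eq hA w
    have := hv w
    rw [h] at this
    exact (mul_eq_zero.1 this).resolve_left hc

lemma HasSingularPoint.congr (h : LinEquivalent (cubicEval a) (cubicEval b))
    (ha : HasSingularPoint a) : HasSingularPoint b := by
  obtain ⟨A, hA, c, hc, h⟩ := h.exists_polar
  obtain ⟨v, hv, hv0⟩ := ha
  exact ⟨A.mulVec v, (mulVec_mem_singularPoints hA hc h).2 hv, mulVec_ne_zero hA hv0⟩

lemma HasTwoSingularPoints.congr (h : LinEquivalent (cubicEval a) (cubicEval b))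
    (ha : HasTwoSingularPoints a) : HasTwoSingularPoints b := by
  obtain ⟨A, hA, c, hc, h⟩ := h.exists_polar
  obtain ⟨v, hv, w, hw, hv0, hvw⟩ := ha
  refine ⟨A.mulVec v, (mulVec_mem_singularPoints hA hc h).2 hv,
    A.mulVec w, (mulVec_mem_singularPoints hA hc h).2 hw, mulVec_ne_zero hA hv0, fun s hs => ?_⟩
  refine mulVec_ne_zero hA (sub_ne_zero.2 (hvw s)) ?_
  rw [Matrix.mulVec_sub, Matrix.mulVec_smul, hs, sub_self]

lemma HasCollinearSingularPoints.congr (h : LinEquivalent (cubicEval a) (cubicEval b))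
    (hb : HasCollinearSingularPoints b) : HasCollinearSingularPoints a := by
  obtain ⟨A, hA, c, hc, h⟩ := h.exists_polar
  obtain ⟨l, hl, hb⟩ := hb
  refine ⟨Matrix.vecMul l A, vecMul_ne_zero hA hl, fun v hv => ?_⟩
  rw [← Matrix.dotProduct_mulVec]
  exact hb _ ((mulVec_mem_singularPoints hA hc h).2 hv)

lemma HasSemidefiniteSingularPoint.congr (h : LinEquivalent (cubicEval a) (cubicEval b))
    (ha : HasSemidefiniteSingularPoint a) : HasSemidefiniteSingularPoint b := by
  obtain ⟨A, hA, c, hc, h⟩ := h.exists_polar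
  obtain ⟨v, hv, hv0, hD⟩ := ha
  refine ⟨A.mulVec v, (mulVec_mem_singularPoints hA hc h).2 hv, mulVec_ne_zero hA hv0,
    fun w w' => ?_⟩
  obtain ⟨w, rfl⟩ := exists_mulVec_eq hA w
  obtain ⟨w', rfl⟩ := exists_mulVec_eq hA w'
  have := hD w w'
  rw [h, h] at this
  have hc2 : 0 < c ^ 2 := by positivity
  nlinarith

lemma ContainsLine.congr (h : LinEquivalent (cubicEval a) (cubicEval b)) (hb : ContainsLine b) :
    ContainsLine a := by
  obtain ⟨A, hA, c, hc, h⟩ := h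
  obtain ⟨l, hl, hb⟩ := hb
  refine ⟨Matrix.vecMul l A, vecMul_ne_zero hA hl, fun v hv => ?_⟩
  rw [← Matrix.dotProduct_mulVec] at hv
  rw [h, hb _ hv, mul_zero]

lemma HessianContainsLine.congr (h : LinEquivalent (cubicEval a) (cubicEval b))
    (hb : HessianContainsLine b) : HessianContainsLine a := by
  obtain ⟨A, hA, c, hc, h⟩ := h.exists_polar
  obtain ⟨l, hl, hb⟩ := hb
  refine ⟨Matrix.vecMul l A, vecMul_ne_zero hA hl, fun v hv => ?_⟩
  rw [← Matrix.dotProduct_mulVec] at hv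
  obtain ⟨w, hw, hu⟩ := hb _ hv
  obtain ⟨w, rfl⟩ := exists_mulVec_eq hA w
  refine ⟨w, fun h0 => hw (by rw [h0, Matrix.mulVec_zero]), fun u => ?_⟩
  rw [h, hu, mul_zero]

lemma det_hessMat_eq_zero_of_polar {v w : Fin 3 → ℝ} (hw : w ≠ 0)
    (h : ∀ u, cubicPolar a v w u = 0) : (hessMat a v).det = 0 := by
  refine Matrix.exists_vecMul_eq_zero_iff.1 ⟨w, hw, ?_⟩
  funext i
  have := h (Pi.single i 1)
  rw [cubicPolar_eq_dotProduct, Matrix.dotProduct_mulVec] at this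
  simpa using this

end Invariance

/-! ### The invariant properties evaluated on the normal forms -/

lemma vec_ne_zero_of {v : Fin 3 → ℝ} (i : Fin 3) (h : v i ≠ 0) : v ≠ 0 :=
  fun h0 => h (by rw [h0]; rfl)

lemma eq_zero_of_forall_eq {l : Fin 3 → ℝ} (h0 : l 0 = 0) (h1 : l 1 = 0) (h2 : l 2 = 0) : l = 0 := by
  funext i; fin_cases i <;> assumption

lemma mem_singularPoints_iff {a : Fin 10 → ℝ} {v : Fin 3 → ℝ} : v ∈ singularPoints a ↔
    cubicPolar a v v ![1, 0, 0] = 0 ∧ cubicPolar a v v ![0, 1, 0] = 0 ∧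
      cubicPolar a v v ![0, 0, 1] = 0 := by
  constructor
  · exact fun h => ⟨h _, h _, h _⟩
  · rintro ⟨h0, h1, h2⟩ w
    have : cubicPolar a v v w = w 0 * cubicPolar a v v ![1, 0, 0] +
        w 1 * cubicPolar a v v ![0, 1, 0] + w 2 * cubicPolar a v v ![0, 0, 1] := by
      simp [cubicPolar]; ring
    rw [this, h0, h1, h2]; ring

lemma not_hasSingularPoint_hesse {lam : ℝ} (h : lam ≠ -1 / 2) :
    ¬ HasSingularPoint ![1, 1, 1, 0, 0, 0, 0, 0, 0, lam] := by
  rintro ⟨v, hv, hv0⟩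
  rw [mem_singularPoints_iff] at hv
  simp [cubicPolar] at hv
  obtain ⟨h0, h1, h2⟩ := hv
  -- Multiplying the three equations x² = -2λyz, y² = -2λxz, z² = -2λxy gives (xyz)²(1 + 8λ³) = 0.
  have h3 : (v 0 * v 1 * v 2) ^ 2 * ((1 + 2 * lam) * (1 - 2 * lam + 4 * lam ^ 2)) = 0 := by
    linear_combination (v 1 ^ 2 * v 2 ^ 2) * h0 - 2 * lam * v 1 * v 2 * v 2 ^ 2 * h1 +
      4 * lam ^ 2 * v 1 * v 2 * v 0 * v 2 * h2
  have h4 : (1 + 2 * lam) * (1 - 2 * lam + 4 * lam ^ 2) ≠ 0 :=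
    mul_ne_zero (fun h' => h (by linarith)) (by nlinarith [sq_nonneg (4 * lam - 1)])
  have h5 : v 0 * v 1 * v 2 = 0 := by simpa [h4] using h3
  apply hv0
  rcases mul_eq_zero.1 h5 with h5 | h5
  · rcases mul_eq_zero.1 h5 with h5 | h5 <;> rw [h5] at h0 h1 h2 <;> simp at h0 h1 h2 <;>
      exact eq_zero_of_forall_eq (by assumption) (by assumption) (by assumption)
  · rw [h5] at h0 h1 h2
    simp at h0 h1 h2
    exact eq_zero_of_forall_eq h0 h1 h5

/-- At points of the line with a zero coordinate the equation compares two cubes. Cubing is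
injective on ℝ, so `l` is a multiple of (1,1,1), and evaluation at (1,1,-2) gives the relation. -/
lemma eq_of_line_hesse {k m : ℝ} (hk : k ≠ 0) {l : Fin 3 → ℝ}
    (h : ∀ v : Fin 3 → ℝ, l ⬝ᵥ v = 0 →
      k * (v 0 ^ 3 + v 1 ^ 3 + v 2 ^ 3) + m * (v 0 * v 1 * v 2) = 0) : 3 * k + m = 0 := by
  have hcube : Function.Injective fun x : ℝ => x ^ 3 := (Odd.strictMono_pow (by decide)).injective
  have h1 := h ![l 1, -l 0, 0] (by simp [dotProduct, Fin.sum_univ_three]; ring)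
  have h2 := h ![l 2, 0, -l 0] (by simp [dotProduct, Fin.sum_univ_three]; ring)
  simp [hk] at h1 h2
  have e1 : l 1 = l 0 := hcube (by simp only; linarith [show (-l 0) ^ 3 = -l 0 ^ 3 by ring])
  have e2 : l 2 = l 0 := hcube (by simp only; linarith [show (-l 0) ^ 3 = -l 0 ^ 3 by ring])
  have h3 := h ![1, 1, -2] (by simp [dotProduct, Fin.sum_univ_three, e1, e2]; ring)
  simp at h3
  linarith

lemma not_containsLine_hesse {lam : ℝ} (h : lam ≠ -1 / 2) :
    ¬ ContainsLine ![1, 1, 1, 0, 0, 0, 0, 0, 0, lam] := by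
  rintro ⟨l, -, hv⟩
  have := eq_of_line_hesse (k := 1) (m := 6 * lam) one_ne_zero fun v h0 => by
    rw [← hv v h0]; simp [cubicEval]; ring
  exact h (by linarith)

/-- The Hessian of a member of the pencil is again of the shape k(x³ + y³ + z³) + m xyz, and 3k + m
factors as (λ - 1)²(2λ + 1). -/
lemma not_hessianContainsLine_hesse {lam : ℝ} (h1 : lam ≠ -1 / 2) (h2 : lam ≠ 0) (h3 : lam ≠ 1) :
    ¬ HessianContainsLine ![1, 1, 1, 0, 0, 0, 0, 0, 0, lam] := by
  rintro ⟨l, -, hv⟩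
  have := eq_of_line_hesse (k := -lam ^ 2) (m := 1 + 2 * lam ^ 3) (by simpa using h2)
    fun v h0 => by
      obtain ⟨w, hw, hu⟩ := hv v h0
      rw [← det_hessMat_eq_zero_of_polar hw hu]
      simp [hessMat, Matrix.det_fin_three]; ring
  have h4 : (lam - 1) ^ 2 * (2 * lam + 1) = 0 := by linear_combination this
  rcases mul_eq_zero.1 h4 with h4 | h4
  · exact h3 (sub_eq_zero.1 (by simpa using h4))
  · exact h1 (by linarith)

lemma hessianContainsLine_imaginaryFermat (lam : ℝ) :
    HessianContainsLine (normalVec lam .imaginaryFermat) := by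
  refine ⟨![1, 1, 1], vec_ne_zero_of 0 (by simp), fun v hv => ⟨![1, 1, 1],
    vec_ne_zero_of 0 (by simp), fun u => ?_⟩⟩
  simp [dotProduct, Fin.sum_univ_three] at hv
  simp [cubicPolar, normalVec]
  linear_combination (u 0 + u 1 + u 2) * hv

lemma hasSingularPoint_realConcurrentLines (lam : ℝ) :
    HasSingularPoint (normalVec lam .realConcurrentLines) :=
  ⟨![0, 0, 1], by simp [mem_singularPoints_iff, cubicPolar, normalVec], vec_ne_zero_of 2 (by simp)⟩

lemma hasSingularPoint_imaginaryTriangle (lam : ℝ) :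
    HasSingularPoint (normalVec lam .imaginaryTriangle) :=
  ⟨![1, 1, 1], by simp [mem_singularPoints_iff, cubicPolar, normalVec]; norm_num,
    vec_ne_zero_of 2 (by simp)⟩

lemma hasSingularPoint_realConicPlusSecantLine (lam : ℝ) :
    HasSingularPoint (normalVec lam .realConicPlusSecantLine) :=
  ⟨![1, 0, 1], by simp [mem_singularPoints_iff, cubicPolar, normalVec]; norm_num, vec_ne_zero_of 2 (by simp)⟩

lemma hasSingularPoint_nodalCubic (lam : ℝ) : HasSingularPoint (normalVec lam .nodalCubic) :=
  ⟨![0, 0, 1], by simp [mem_singularPoints_iff, cubicPolar, normalVec], vec_ne_zero_of 2 (by simp)⟩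

lemma hasSingularPoint_cubicaPunctata (lam : ℝ) :
    HasSingularPoint (normalVec lam .cubicaPunctata) :=
  ⟨![0, 0, 1], by simp [mem_singularPoints_iff, cubicPolar, normalVec], vec_ne_zero_of 2 (by simp)⟩

lemma hasSingularPoint_realTriangle (lam : ℝ) : HasSingularPoint (normalVec lam .realTriangle) :=
  ⟨![0, 0, 1], by simp [mem_singularPoints_iff, cubicPolar, normalVec], vec_ne_zero_of 2 (by simp)⟩

lemma not_hasSingularPoint_imaginaryConicPlusLine (lam : ℝ) :
    ¬ HasSingularPoint (normalVec lam .imaginaryConicPlusLine) := by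
  rintro ⟨v, hv, hv0⟩
  have h := (mem_singularPoints_iff.1 hv).1
  simp [cubicPolar, normalVec] at h
  have e0 : v 0 * v 0 = 0 := by nlinarith [mul_self_nonneg (v 0), mul_self_nonneg (v 1), mul_self_nonneg (v 2)]
  have e1 : v 1 * v 1 = 0 := by nlinarith [mul_self_nonneg (v 0), mul_self_nonneg (v 1), mul_self_nonneg (v 2)]
  have e2 : v 2 * v 2 = 0 := by nlinarith [mul_self_nonneg (v 0), mul_self_nonneg (v 1), mul_self_nonneg (v 2)]
  exact hv0 (eq_zero_of_forall_eq (mul_self_eq_zero.1 e0) (mul_self_eq_zero.1 e1)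
    (mul_self_eq_zero.1 e2))

lemma not_hasSingularPoint_realConicPlusExternalLine (lam : ℝ) :
    ¬ HasSingularPoint (normalVec lam .realConicPlusExternalLine) := by
  rintro ⟨v, hv, hv0⟩
  rw [mem_singularPoints_iff] at hv
  simp [cubicPolar, normalVec, lineConicVec] at hv
  obtain ⟨h0, h1, h2⟩ := hv
  by_cases hz : v 2 = 0
  · rw [hz] at h2
    have e0 : v 0 * v 0 = 0 := by nlinarith [mul_self_nonneg (v 0), mul_self_nonneg (v 1)]
    have e1 : v 1 * v 1 = 0 := by nlinarith [mul_self_nonneg (v 0), mul_self_nonneg (v 1)]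
    exact hv0 (eq_zero_of_forall_eq (mul_self_eq_zero.1 e0) (mul_self_eq_zero.1 e1) hz)
  · have e0 : v 0 = 0 := mul_right_cancel₀ hz (by linarith)
    have e1 : v 1 = 0 := mul_right_cancel₀ hz (by linarith)
    rw [e0, e1] at h2
    simp at h2
    exact hz h2

lemma containsLine_imaginaryConicPlusLine (lam : ℝ) :
    ContainsLine (normalVec lam .imaginaryConicPlusLine) := by
  refine ⟨![1, 0, 0], vec_ne_zero_of 0 (by simp), fun v hv => ?_⟩
  have : v 0 = 0 := by simpa [dotProduct, Fin.sum_univ_three] using hv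
  simp [cubicEval, normalVec, this]

lemma hasTwoSingularPoints_realConicPlusSecantLine (lam : ℝ) :
    HasTwoSingularPoints (normalVec lam .realConicPlusSecantLine) := by
  refine ⟨![1, 0, 1], by simp [mem_singularPoints_iff, cubicPolar, normalVec]; norm_num, ![1, 0, -1],
    by simp [mem_singularPoints_iff, cubicPolar, normalVec]; norm_num, vec_ne_zero_of 2 (by simp), ?_⟩
  intro s hs
  have h0 := congrFun hs 0
  have h2 := congrFun hs 2
  simp at h0 h2
  linarith

lemma hasTwoSingularPoints_realTriangle (lam : ℝ) :
    HasTwoSingularPoints (normalVec lam .realTriangle) := by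
  refine ⟨![1, 0, 0], by simp [mem_singularPoints_iff, cubicPolar, normalVec], ![0, 1, 0],
    by simp [mem_singularPoints_iff, cubicPolar, normalVec], vec_ne_zero_of 0 (by simp), ?_⟩
  intro s hs
  simpa using congrFun hs 1

lemma singularPoints_nodalCubic {lam : ℝ} {v : Fin 3 → ℝ}
    (hv : v ∈ singularPoints (normalVec lam .nodalCubic)) : v 0 = 0 ∧ v 1 = 0 := by
  rw [mem_singularPoints_iff] at hv
  simp [cubicPolar, normalVec] at hv
  obtain ⟨h0, h1, h2⟩ := hv
  have h3 : v 0 * v 1 = 0 := by linarith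
  rcases mul_eq_zero.1 h3 with h | h
  · rw [h] at h1
    simp at h1
    exact ⟨h, h1⟩
  · rw [h] at h0
    simp at h0
    exact ⟨h0, h⟩

lemma singularPoints_cubicaPunctata {lam : ℝ} {v : Fin 3 → ℝ}
    (hv : v ∈ singularPoints (normalVec lam .cubicaPunctata)) : v 0 = 0 ∧ v 1 = 0 := by
  rw [mem_singularPoints_iff] at hv
  simp [cubicPolar, normalVec] at hv
  obtain ⟨h0, h1, h2⟩ := hv
  constructor <;> refine mul_self_eq_zero.1 ?_ <;>
    nlinarith [mul_self_nonneg (v 0), mul_self_nonneg (v 1)]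

lemma not_hasTwoSingularPoints_of {a : Fin 10 → ℝ}
    (h : ∀ v ∈ singularPoints a, v 0 = 0 ∧ v 1 = 0) : ¬ HasTwoSingularPoints a := by
  rintro ⟨v, hv, w, hw, hv0, hs⟩
  obtain ⟨v0, v1⟩ := h v hv
  obtain ⟨w0, w1⟩ := h w hw
  have v2 : v 2 ≠ 0 := fun v2 => hv0 (eq_zero_of_forall_eq v0 v1 v2)
  refine hs (w 2 / v 2) ?_
  funext i
  fin_cases i <;> simp [v0, v1, w0, w1, v2]

lemma hasCollinearSingularPoints_realConicPlusSecantLine (lam : ℝ) :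
    HasCollinearSingularPoints (normalVec lam .realConicPlusSecantLine) := by
  refine ⟨![0, 1, 0], vec_ne_zero_of 1 (by simp), fun v hv => ?_⟩
  rw [mem_singularPoints_iff] at hv
  simp [cubicPolar, normalVec] at hv
  obtain ⟨h0, h1, h2⟩ := hv
  have : v 1 = 0 := by
    by_contra hy
    have e0 : v 0 = 0 := mul_right_cancel₀ hy (by linarith)
    have e2 : v 2 = 0 := mul_right_cancel₀ hy (by linarith)
    rw [e0, e2] at h1
    simp at h1
    exact hy h1
  simpa [dotProduct, Fin.sum_univ_three] using this

lemma not_hasCollinearSingularPoints_realTriangle (lam : ℝ) :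
    ¬ HasCollinearSingularPoints (normalVec lam .realTriangle) := by
  rintro ⟨l, hl, h⟩
  have h0 := h ![1, 0, 0] (by simp [mem_singularPoints_iff, cubicPolar, normalVec])
  have h1 := h ![0, 1, 0] (by simp [mem_singularPoints_iff, cubicPolar, normalVec])
  have h2 := h ![0, 0, 1] (by simp [mem_singularPoints_iff, cubicPolar, normalVec])
  simp [dotProduct, Fin.sum_univ_three] at h0 h1 h2
  exact hl (eq_zero_of_forall_eq h0 h1 h2)

lemma hasSemidefiniteSingularPoint_cubicaPunctata (lam : ℝ) :
    HasSemidefiniteSingularPoint (normalVec lam .cubicaPunctata) := by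
  refine ⟨![0, 0, 1], by simp [mem_singularPoints_iff, cubicPolar, normalVec],
    vec_ne_zero_of 2 (by simp), fun w w' => ?_⟩
  have h : ∀ w, 0 ≤ cubicPolar (normalVec lam .cubicaPunctata) ![0, 0, 1] w w := fun w => by
    simp [cubicPolar, normalVec]
    nlinarith [mul_self_nonneg (w 0), mul_self_nonneg (w 1)]
  exact mul_nonneg (h w) (h w')

lemma not_hasSemidefiniteSingularPoint_nodalCubic (lam : ℝ) :
    ¬ HasSemidefiniteSingularPoint (normalVec lam .nodalCubic) := by
  rintro ⟨v, hv, hv0, h⟩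
  obtain ⟨v0, v1⟩ := singularPoints_nodalCubic hv
  have v2 : v 2 ≠ 0 := fun v2 => hv0 (eq_zero_of_forall_eq v0 v1 v2)
  have := h ![1, 1, 0] ![1, -1, 0]
  simp [cubicPolar, normalVec, v0, v1] at this
  have : 0 < v 2 * v 2 := mul_self_pos.2 v2
  nlinarith

/-- Normal forms of different types are not equivalent. -/
lemma type_unique (hlim : ∀ a, IsLimitOfHasRank a 4) {lam lam' : ℝ} (h1 : lam ≠ -1 / 2)
    (h2 : lam ≠ 0) (h3 : lam ≠ 1) (h1' : lam' ≠ -1 / 2) (h2' : lam' ≠ 0) (h3' : lam' ≠ 1)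
    {t t' : CubicType}
    (h : LinEquivalent (cubicEval (normalVec lam t)) (cubicEval (normalVec lam' t'))) :
    t = t' := by
  have key := (normalVec_ranks h1 h2 h3 t).imp_right fun hb => hb (hlim _)
  have key' := (normalVec_ranks h1' h2' h3' t').imp_right fun hb => hb (hlim _)
  have hr : t.tableRank = t'.tableRank := key.1.unique (h.hasRank key'.1)
  have hb : t.tableBorderRank = t'.tableBorderRank := by
    refine IsLeast.unique key.2 ?_
    refine ⟨⟨key'.2.1.1, h.isLimitOfHasRank key'.2.1.2⟩, fun s hs => ?_⟩
    exact key'.2.2 ⟨hs.1, h.symm.isLimitOfHasRank hs.2⟩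
  have i1 : HasSingularPoint (normalVec lam t) ↔ HasSingularPoint (normalVec lam' t') :=
    ⟨.congr h, .congr h.symm⟩
  have i2 : HasTwoSingularPoints (normalVec lam t) ↔ HasTwoSingularPoints (normalVec lam' t') :=
    ⟨.congr h, .congr h.symm⟩
  have i3 : HasCollinearSingularPoints (normalVec lam t) ↔
      HasCollinearSingularPoints (normalVec lam' t') := ⟨.congr h.symm, .congr h⟩
  have i4 : HasSemidefiniteSingularPoint (normalVec lam t) ↔
      HasSemidefiniteSingularPoint (normalVec lam' t') := ⟨.congr h, .congr h.symm⟩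
  have i5 : ContainsLine (normalVec lam t) ↔ ContainsLine (normalVec lam' t') :=
    ⟨.congr h.symm, .congr h⟩
  have i6 : HessianContainsLine (normalVec lam t) ↔ HessianContainsLine (normalVec lam' t') :=
    ⟨.congr h.symm, .congr h⟩
  have n0 : (0 : ℝ) ≠ -1 / 2 := by norm_num
  have n1 : (1 : ℝ) ≠ -1 / 2 := by norm_num
  have s9 : ∀ l, ¬ HasSingularPoint (normalVec l .realFermat) :=
    fun l => not_hasSingularPoint_hesse n0
  have s10 : ∀ l, ¬ HasSingularPoint (normalVec l .imaginaryFermat) :=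
    fun l => not_hasSingularPoint_hesse n1
  have s11 : ∀ l, l ≠ -1 / 2 → ¬ HasSingularPoint (normalVec l .hessePencil) :=
    fun l hl => not_hasSingularPoint_hesse hl
  have l10 : ∀ l, ¬ ContainsLine (normalVec l .imaginaryFermat) :=
    fun l => not_containsLine_hesse n1
  have l11 : ∀ l, l ≠ -1 / 2 → ¬ ContainsLine (normalVec l .hessePencil) :=
    fun l hl => not_containsLine_hesse hl
  have g11 : ∀ l, l ≠ -1 / 2 → l ≠ 0 → l ≠ 1 → ¬ HessianContainsLine (normalVec l .hessePencil) :=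
    fun l => not_hessianContainsLine_hesse
  have d14 : ∀ l, ¬ HasTwoSingularPoints (normalVec l .nodalCubic) :=
    fun l => not_hasTwoSingularPoints_of fun v => singularPoints_nodalCubic
  have d15 : ∀ l, ¬ HasTwoSingularPoints (normalVec l .cubicaPunctata) :=
    fun l => not_hasTwoSingularPoints_of fun v => singularPoints_cubicaPunctata
  clear key key' h
  -- Rank and border rank leave only types with values (3,3), (4,4) or (5,4) to be separated.
  -- Singular points settle the first and last and split the second. There the nonsingular types are
  -- separated by lines in the cubic and in its Hessian, the singular ones by the number and
  -- collinearity of singular points and the definiteness of the polar conic.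
  cases t <;> cases t' <;> first
    | rfl
    | exact absurd hr (by decide)
    | exact absurd hb (by decide)
    | (exfalso
       simp only [s9, s10, s11 _ h1, s11 _ h1', hasSingularPoint_realConcurrentLines,
        hasSingularPoint_imaginaryTriangle, hasSingularPoint_realConicPlusSecantLine,
        hasSingularPoint_nodalCubic, hasSingularPoint_cubicaPunctata,
        hasSingularPoint_realTriangle, not_hasSingularPoint_imaginaryConicPlusLine,
        not_hasSingularPoint_realConicPlusExternalLine, iff_false, false_iff,
        not_true_eq_false] at i1
       done)
    | (exfalso
       simp only [l10, l11 _ h1, l11 _ h1', containsLine_imaginaryConicPlusLine, iff_false,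
        false_iff, not_true_eq_false] at i5
       done)
    | (exfalso
       simp only [g11 _ h1 h2 h3, g11 _ h1' h2' h3', hessianContainsLine_imaginaryFermat, iff_false,
        false_iff, not_true_eq_false] at i6
       done)
    | (exfalso
       simp only [d14, d15, hasTwoSingularPoints_realConicPlusSecantLine,
        hasTwoSingularPoints_realTriangle, iff_false, false_iff, not_true_eq_false] at i2
       done)
    | (exfalso
       simp only [hasCollinearSingularPoints_realConicPlusSecantLine,
        not_hasCollinearSingularPoints_realTriangle, iff_false, false_iff,
        not_true_eq_false] at i3
       done)
    | (exfalso
       simp only [hasSemidefiniteSingularPoint_cubicaPunctata,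
        not_hasSemidefiniteSingularPoint_nodalCubic, iff_false, false_iff,
        not_true_eq_false] at i4
       done)

/-! ### Generic ternary cubics have rank four -/

/-- The Bézout matrix of two binary cubics. -/
def bezoutMat (p q : Fin 4 → ℝ) : Matrix (Fin 3) (Fin 3) ℝ :=
  let m (i j : Fin 4) : ℝ := p i * q j - p j * q i
  !![m 0 1, m 0 2, m 0 3; m 0 2, m 0 3 + m 1 2, m 1 3; m 0 3, m 1 3, m 2 3]

lemma det_bezoutMat_eq_zero {p q : Fin 4 → ℝ} {x y : ℝ} (hxy : x ≠ 0 ∨ y ≠ 0)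
    (hp : binaryEval p x y = 0) (hq : binaryEval q x y = 0) : (bezoutMat p q).det = 0 := by
  simp only [binaryEval] at hp hq
  by_cases hy : y = 0
  · have hx : x ≠ 0 := hxy.resolve_right (not_not.2 hy)
    have hp0 : p 0 = 0 := by simpa [hy, hx] using hp
    have hq0 : q 0 = 0 := by simpa [hy, hx] using hq
    simp [bezoutMat, Matrix.det_fin_three, hp0, hq0]
  -- A common root gives this kernel vector; each row is checked after multiplication by a power of
  -- y.
  · refine Matrix.exists_mulVec_eq_zero_iff.1 ⟨![x ^ 2, x * y, y ^ 2],
      vec_ne_zero_of 2 (by simpa using hy), ?_⟩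
    funext i
    fin_cases i
    · refine mul_left_cancel₀ hy ?_
      simp [bezoutMat, Matrix.mulVec, dotProduct, Fin.sum_univ_three, -mul_eq_zero]
      linear_combination p 0 * hq - q 0 * hp
    · refine mul_left_cancel₀ (pow_ne_zero 2 hy) ?_
      simp [bezoutMat, Matrix.mulVec, dotProduct, Fin.sum_univ_three, -mul_eq_zero]
      linear_combination (p 0 * x + p 1 * y) * hq - (q 0 * x + q 1 * y) * hp
    · refine mul_left_cancel₀ (pow_ne_zero 3 hy) ?_
      simp [bezoutMat, Matrix.mulVec, dotProduct, Fin.sum_univ_three, -mul_eq_zero]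
      linear_combination (p 0 * x ^ 2 + p 1 * x * y + p 2 * y ^ 2) * hq -
        (q 0 * x ^ 2 + q 1 * x * y + q 2 * y ^ 2) * hp

/-- The resultant of the restrictions to `z = 0` of a ternary cubic and of its Hessian. -/
def hessResultant (a : Fin 10 → ℝ) : ℝ := (bezoutMat (restrictBinary a) (hessBinary a)).det

/-- The Hessian of a cubic vanishes on every line in the cubic. -/
lemma det_hessMat_eq_zero_of_line {a : Fin 10 → ℝ} {l v : Fin 3 → ℝ}
    (h : ∀ v, l ⬝ᵥ v = 0 → cubicEval a v = 0) (hv : l ⬝ᵥ v = 0) : (hessMat a v).det = 0 := by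
  have hpol : ∀ w z, l ⬝ᵥ w = 0 → l ⬝ᵥ z = 0 → cubicPolar a v w z = 0 := by
    intro w z hw hz
    have := cubicPolar_eq a v w z
    rw [h, h, h, h, h, h, h] at this
    · simpa using this
    all_goals simp [dotProduct_add, hv, hw, hz]
  -- With M the Hessian matrix at `v`, a nonzero `w` is chosen with both `w` and M`w` on the line.
  -- The polar form vanishes on the line, so M`w` · M`w` = 0 and `w` lies in the kernel of M.
  obtain ⟨w, hw0, hw⟩ : ∃ w ≠ 0,
      (Matrix.of ![l, Matrix.vecMul l (hessMat a v), 0]).mulVec w = 0 :=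
    Matrix.exists_mulVec_eq_zero_iff.2 (Matrix.det_eq_zero_of_row_eq_zero 2 (by simp))
  have hw1 : l ⬝ᵥ w = 0 := by simpa [Matrix.mulVec] using congrFun hw 0
  have hw2 : l ⬝ᵥ (hessMat a v).mulVec w = 0 := by
    rw [Matrix.dotProduct_mulVec]
    simpa [Matrix.mulVec] using congrFun hw 1
  refine Matrix.exists_mulVec_eq_zero_iff.1 ⟨w, hw0, ?_⟩
  have := hpol _ _ hw2 hw1
  rw [cubicPolar_eq_dotProduct] at this
  exact dotProduct_self_eq_zero.1 this

/-- The contained line meets z = 0 in a real point, where both the cubic and its Hessian vanish. -/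
lemma hessResultant_eq_zero {a : Fin 10 → ℝ} (h : ContainsLine a) : hessResultant a = 0 := by
  obtain ⟨l, -, h⟩ := h
  obtain ⟨x, y, hxy, hl⟩ : ∃ x y : ℝ, (x ≠ 0 ∨ y ≠ 0) ∧ l ⬝ᵥ ![x, y, 0] = 0 := by
    by_cases hl0 : l 0 = 0
    · exact ⟨1, 0, by simp, by simp [dotProduct, Fin.sum_univ_three, hl0]⟩
    · exact ⟨l 1, -l 0, by simp [hl0], by simp [dotProduct, Fin.sum_univ_three]; ring⟩
  refine det_bezoutMat_eq_zero hxy ?_ ?_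
  · rw [binaryEval_restrictBinary, h _ hl]
  · rw [binaryEval_hessBinary, det_hessMat_eq_zero_of_line h hl]

lemma containsLine_of_tableRank_eq_five {t : CubicType} (lam : ℝ) (ht : t.tableRank = 5) :
    ContainsLine (normalVec lam t) := by
  cases t <;> try exact absurd ht (by decide)
  case realConicPlusExternalLine =>
    refine ⟨![0, 0, 1], vec_ne_zero_of 2 (by simp), fun v hv => ?_⟩
    have : v 2 = 0 := by simpa [dotProduct, Fin.sum_univ_three] using hv
    simp [cubicEval, normalVec, lineConicVec, this]
  case realConicPlusTangentLine =>
    refine ⟨![0, 1, 0], vec_ne_zero_of 1 (by simp), fun v hv => ?_⟩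
    have : v 1 = 0 := by simpa [dotProduct, Fin.sum_univ_three] using hv
    simp [cubicEval, normalVec, this]
  case imaginaryTriangle =>
    refine ⟨![1, 1, 1], vec_ne_zero_of 1 (by simp), fun v hv => ?_⟩
    have : v 0 = -v 1 - v 2 := by
      simp [dotProduct, Fin.sum_univ_three] at hv
      linarith
    simp [cubicEval, normalVec, this]
    ring

/-- `a` is equivalent to one of the normal forms. -/
def HasNormalForm (a : Fin 10 → ℝ) (t : CubicType) : Prop :=
  ∃ lam : ℝ, lam ≠ -1 / 2 ∧ lam ≠ 0 ∧ lam ≠ 1 ∧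
    LinEquivalent (cubicEval a) (cubicEval (normalVec lam t))

lemma HasNormalForm.hasRank {a : Fin 10 → ℝ} {t : CubicType} (h : HasNormalForm a t) :
    HasRank a t.tableRank := by
  obtain ⟨lam, h1, h2, h3, h⟩ := h
  exact h.hasRank (normalVec_ranks h1 h2 h3 t).1

/-- A ternary cubic outside of a proper algebraic subset has rank four. -/
lemma hasRank_four_of_generic (hclass : ∀ a : Fin 10 → ℝ, a ≠ 0 → ∃ t, HasNormalForm a t)
    {a : Fin 10 → ℝ} (h : aronholdS a * hessResultant a ≠ 0) : HasRank a 4 := by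
  have hS := left_ne_zero_of_mul h
  have ha : a ≠ 0 := by
    rintro rfl
    simp [aronholdS] at hS
  obtain ⟨t, ht⟩ := hclass a ha
  have hr := ht.hasRank
  have h4 : 3 < t.tableRank :=
    three_lt_of_isLimit_of_aronholdS hS (isLimitOfHasRank_of_hasRank hr)
  have h5 : t.tableRank ≠ 5 := by
    intro h5
    obtain ⟨lam, -, -, -, he⟩ := ht
    exact right_ne_zero_of_mul h
      (hessResultant_eq_zero ((containsLine_of_tableRank_eq_five lam h5).congr he))
  have h6 : t.tableRank ≤ 5 := by cases t <;> decide
  rwa [show t.tableRank = 4 by omega] at hr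

lemma continuous_hessResultant : Continuous hessResultant := by
  unfold hessResultant
  simp only [bezoutMat, restrictBinary, hessBinary, Matrix.det_fin_three]
  simp
  fun_prop

lemma analyticOnNhd_generic (a b : Fin 10 → ℝ) :
    AnalyticOnNhd ℝ (fun t : ℝ => aronholdS (a + t • b) * hessResultant (a + t • b)) Set.univ := by
  intro t _
  simp only [aronholdS, hessResultant, bezoutMat, restrictBinary, hessBinary, Matrix.det_fin_three,
    Pi.add_apply, Pi.smul_apply, smul_eq_mul]
  simp
  fun_prop

/-- A cubic in the generic locus. -/
def genericVec : Fin 10 → ℝ := ![0, 1, 0, 1, 0, 0, 0, 1, 0, 0]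

lemma generic_genericVec : aronholdS genericVec * hessResultant genericVec ≠ 0 := by
  simp [aronholdS, hessResultant, bezoutMat, restrictBinary, hessBinary, Matrix.det_fin_three,
    genericVec]
  norm_num

/-- Every ternary cubic is a limit of cubics of rank four. -/
lemma isLimitOfHasRank_four (hclass : ∀ a : Fin 10 → ℝ, a ≠ 0 → ∃ t, HasNormalForm a t)
    (a : Fin 10 → ℝ) : IsLimitOfHasRank a 4 := by
  have han := analyticOnNhd_generic a (genericVec - a)
  set ψ : ℝ → ℝ := fun t =>
    aronholdS (a + t • (genericVec - a)) * hessResultant (a + t • (genericVec - a)) with hψ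
  have h1 : ψ 1 ≠ 0 := by
    simp only [hψ, one_smul, add_sub_cancel]
    exact generic_genericVec
  -- On the segment towards `genericVec` the genericity polynomial is analytic in `t` and nonzero at
  -- 1, so 0 is not an accumulation point of its zeros.
  have hev : ∀ᶠ t in 𝓝[≠] (0 : ℝ), ψ t ≠ 0 := by
    rcases (han 0 trivial).eventually_eq_zero_or_eventually_ne_zero with h | h
    · exact absurd (han.eqOn_zero_of_preconnected_of_eventuallyEq_zero isPreconnected_univ
        (Set.mem_univ 0) h (Set.mem_univ 1)) h1
    · exact h
  have hev' : ∀ᶠ t in 𝓝[>] (0 : ℝ), ψ t ≠ 0 :=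
    hev.filter_mono (nhdsWithin_mono _ fun t ht => (ne_of_gt ht))
  obtain ⟨δ, hδ, hδ'⟩ := mem_nhdsGT_iff_exists_Ioo_subset.1 hev'
  have hδ0 : (0 : ℝ) < δ := hδ
  -- The family must have rank four for every positive ε, hence the truncation at δ / 2.
  refine ⟨fun ε => a + min ε (δ / 2) • (genericVec - a), fun ε hε => ?_, ?_⟩
  · exact hasRank_four_of_generic hclass
      (hδ' ⟨lt_min hε (by linarith), (min_le_right _ _).trans_lt (by linarith)⟩)
  · refine Tendsto.mono_left ?_ nhdsWithin_le_nhds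
    have : Continuous fun ε : ℝ => a + min ε (δ / 2) • (genericVec - a) := by fun_prop
    convert this.tendsto 0 using 2
    rw [min_eq_left (by linarith)]
    simp

/-! ### Classification of cubics with a real singular point -/

/-- A function on `ℝ³` that is equivalent to one of the normal forms. -/
def IsClassified (F : (Fin 3 → ℝ) → ℝ) : Prop :=
  ∃ t : CubicType, ∃ lam : ℝ, lam ≠ -1 / 2 ∧ lam ≠ 0 ∧ lam ≠ 1 ∧
    LinEquivalent F (cubicEval (normalVec lam t))

lemma IsClassified.of_equiv {F G : (Fin 3 → ℝ) → ℝ} (h : LinEquivalent F G) (hG : IsClassified G) :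
    IsClassified F := by
  obtain ⟨t, lam, h1, h2, h3, hG⟩ := hG
  exact ⟨t, lam, h1, h2, h3, h.trans hG⟩

/-- The value 2 is an arbitrary admissible parameter; it only matters for the Hesse pencil. -/
lemma IsClassified.of_type {F : (Fin 3 → ℝ) → ℝ} (t : CubicType)
    (h : LinEquivalent F (cubicEval (normalVec 2 t))) : IsClassified F :=
  ⟨t, 2, by norm_num, by norm_num, by norm_num, h⟩

lemma linEquivalent_comp {F : (Fin 3 → ℝ) → ℝ} {B : Matrix (Fin 3) (Fin 3) ℝ} (hB : B.det ≠ 0) :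
    LinEquivalent F (fun v => F (B.mulVec v)) :=
  LinEquivalent.symm ⟨B, hB, 1, one_ne_zero, fun v => by rw [one_mul]⟩

lemma exists_root_of_odd_natDegree {p : Polynomial ℝ} (hp : Odd p.natDegree) :
    ∃ x : ℝ, p.eval x = 0 := by
  have key : ∀ q : Polynomial ℝ, Odd q.natDegree → 0 ≤ q.leadingCoeff → ∃ x, q.eval x = 0 := by
    intro q hq hlc
    have hdeg : 0 < q.natDegree := hq.pos
    have h1 := q.tendsto_atTop_of_leadingCoeff_nonneg (Polynomial.natDegree_pos_iff_degree_pos.1 hdeg)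
      hlc
    have hcomp : (q.comp (-Polynomial.X)).natDegree = q.natDegree := by
      rw [Polynomial.natDegree_comp]; simp
    have h2 := (q.comp (-Polynomial.X)).tendsto_atBot_of_leadingCoeff_nonpos
      (Polynomial.natDegree_pos_iff_degree_pos.1 (by rw [hcomp]; exact hdeg)) (by
        rw [Polynomial.leadingCoeff_comp (by simp)]
        simpa [hq.neg_one_pow] using hlc)
    obtain ⟨a, ha⟩ := (h1.eventually (eventually_ge_atTop 0)).exists
    obtain ⟨b, hb⟩ := (h2.eventually (eventually_le_atBot 0)).exists
    rw [Polynomial.eval_comp] at hb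
    simp at hb
    exact mem_range_of_exists_le_of_exists_ge q.continuous ⟨_, hb⟩ ⟨_, ha⟩
  rcases le_total 0 p.leadingCoeff with h | h
  · exact key p hp h
  · obtain ⟨x, hx⟩ := key (-p) (by simpa using hp) (by simpa using h)
    exact ⟨x, by simpa using hx⟩

lemma exists_root_binaryEval (b : Fin 4 → ℝ) :
    b 3 = 0 ∨ ∃ m : ℝ, binaryEval b 1 m = 0 := by
  by_cases h : b 3 = 0
  · exact Or.inl h
  right
  let p : Polynomial ℝ := .C (b 3) * .X ^ 3 + .C (b 2) * .X ^ 2 + .C (b 1) * .X + .C (b 0)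
  have hp : p.natDegree = 3 := Polynomial.natDegree_cubic h
  obtain ⟨m, hm⟩ := exists_root_of_odd_natDegree (p := p) (by rw [hp]; decide)
  refine ⟨m, ?_⟩
  simp [p] at hm
  simp [binaryEval]
  linarith

lemma det_ne_zero_of_eq {A : Matrix (Fin 3) (Fin 3) ℝ} {d : ℝ} (hd : d ≠ 0)
    (h : A 0 0 * A 1 1 * A 2 2 - A 0 0 * A 1 2 * A 2 1 - A 0 1 * A 1 0 * A 2 2 +
      A 0 1 * A 1 2 * A 2 0 + A 0 2 * A 1 0 * A 2 1 - A 0 2 * A 1 1 * A 2 0 = d) : A.det ≠ 0 := by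
  rw [Matrix.det_fin_three, h]
  exact hd

lemma isClassified_line_mul {α β γ : ℝ} (h : α ≠ 0 ∨ β ≠ 0 ∨ γ ≠ 0) :
    IsClassified (fun v => v 0 * (α * v 0 ^ 2 + β * v 0 * v 1 + γ * v 1 ^ 2)) := by
  by_cases hγ : γ = 0
  · subst hγ
    by_cases hβ : β = 0
    · subst hβ
      have hα : α ≠ 0 := by simpa using h
      refine .of_type .tripleLine ⟨1, by simp, α, hα, fun v => ?_⟩
      simp [cubicEval, normalVec]; ring
    · refine .of_type .doubleLinePlusLine ⟨!![1, 0, 0; α, β, 0; 0, 0, 1],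
        det_ne_zero_of_eq hβ (by simp), 1, one_ne_zero, fun v => ?_⟩
      simp [cubicEval, normalVec, Matrix.mulVec, dotProduct, Fin.sum_univ_three]
      ring
  · obtain ⟨e, he⟩ : ∃ e, β = 2 * γ * e := ⟨β / (2 * γ), by field_simp⟩
    obtain ⟨δ, hδ⟩ : ∃ δ, α = δ + γ * e ^ 2 := ⟨α - γ * e ^ 2, by ring⟩
    subst he hδ
    by_cases hδ : δ = 0
    · subst hδ
      refine .of_type .doubleLinePlusLine ⟨!![e, 1, 0; 1, 0, 0; 0, 0, 1],
        det_ne_zero_of_eq (d := -1) (by norm_num) (by simp), γ, hγ, fun v => ?_⟩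
      simp [cubicEval, normalVec, Matrix.mulVec, dotProduct, Fin.sum_univ_three]
      ring
    · obtain ⟨s, hs, hs2 | hs2⟩ : ∃ s : ℝ, s ≠ 0 ∧ (γ = δ * s ^ 2 ∨ γ = -(δ * s ^ 2)) := by
        refine ⟨√|γ / δ|, by positivity, ?_⟩
        rw [Real.sq_sqrt (abs_nonneg _)]
        rcases abs_choice (γ / δ) with h | h <;> rw [h]
        · left; field_simp
        · right; field_simp
      · subst hs2
        refine .of_type .imaginaryConcurrentLines ⟨!![1, 0, 0; s * e, s, 0; 0, 0, 1],
          det_ne_zero_of_eq hs (by simp), δ, hδ, fun v => ?_⟩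
        simp [cubicEval, normalVec, Matrix.mulVec, dotProduct, Fin.sum_univ_three]
        ring
      · subst hs2
        refine .of_type .realConcurrentLines ⟨!![1, 0, 0; s * e, s, 0; 0, 0, 1],
          det_ne_zero_of_eq hs (by simp), δ, hδ, fun v => ?_⟩
        simp [cubicEval, normalVec, Matrix.mulVec, dotProduct, Fin.sum_univ_three]
        ring

lemma isClassified_binary {b : Fin 4 → ℝ} (hb : b ≠ 0) :
    IsClassified (fun v => binaryEval b (v 0) (v 1)) := by
  rcases eq_or_ne (b 3) 0 with h | h
  · have := isClassified_line_mul (α := b 0) (β := b 1) (γ := b 2) (by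
      by_contra! hcon
      refine hb (funext fun i => ?_)
      fin_cases i <;> simp_all)
    convert this using 2 with v
    simp only [binaryEval, h]; ring
  · obtain ⟨m, hm⟩ := (exists_root_binaryEval b).resolve_left h
    refine .of_equiv (G := fun v => v 0 * (b 3 * v 0 ^ 2 + (b 2 + 3 * b 3 * m) * v 0 * v 1 +
        (b 1 + 2 * b 2 * m + 3 * b 3 * m ^ 2) * v 1 ^ 2))
      ⟨!![-m, 1, 0; 1, 0, 0; 0, 0, 1], det_ne_zero_of_eq (d := -1) (by norm_num) (by simp), 1,
        one_ne_zero, fun v => ?_⟩ (isClassified_line_mul (Or.inl h))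
    simp [binaryEval] at hm
    simp [binaryEval, Matrix.mulVec, dotProduct, Fin.sum_univ_three]
    linear_combination (v 0) ^ 3 * hm

lemma exists_binaryEval_subst (b : Fin 4 → ℝ) (p q r s : ℝ) :
    ∃ b', ∀ x y, binaryEval b (p * x + q * y) (r * x + s * y) = binaryEval b' x y :=
  ⟨![b 0 * p ^ 3 + b 1 * p ^ 2 * r + b 2 * p * r ^ 2 + b 3 * r ^ 3,
    3 * b 0 * p ^ 2 * q + b 1 * (p ^ 2 * s + 2 * p * q * r) + b 2 * (q * r ^ 2 + 2 * p * r * s) +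
      3 * b 3 * r ^ 2 * s,
    3 * b 0 * p * q ^ 2 + b 1 * (q ^ 2 * r + 2 * p * q * s) + b 2 * (p * s ^ 2 + 2 * q * r * s) +
      3 * b 3 * r * s ^ 2,
    b 0 * q ^ 3 + b 1 * q ^ 2 * s + b 2 * q * s ^ 2 + b 3 * s ^ 3], fun x y => by
    simp [binaryEval]; ring⟩

/-- Multiples of x² in the binary cubic are absorbed into z; what remains depends on whether the
coefficients of xy² and y³ vanish, and in the cuspidal case the cube is completed. -/
lemma isClassified_cuspidal (b : Fin 4 → ℝ) :
    IsClassified (fun v => v 2 * v 0 ^ 2 + binaryEval b (v 0) (v 1)) := by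
  rcases eq_or_ne (b 3) 0 with hd | hd
  · rcases eq_or_ne (b 2) 0 with hc | hc
    · refine .of_type .doubleLinePlusLine ⟨!![1, 0, 0; b 0, b 1, 1; 0, 1, 0],
        det_ne_zero_of_eq (d := -1) (by norm_num) (by simp), 1, one_ne_zero, fun v => ?_⟩
      simp [binaryEval, hc, hd, cubicEval, normalVec, Matrix.mulVec, dotProduct,
        Fin.sum_univ_three]
      ring
    · refine .of_type .realConicPlusTangentLine
        ⟨!![0, 1, 0; 1, 0, 0; b 0 / b 2, b 1 / b 2, 1 / b 2],
        det_ne_zero_of_eq (d := -1 / b 2) (by simp [hc]) (by simp; ring), b 2 / 18,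
        by simpa using hc, fun v => ?_⟩
      simp [binaryEval, hd, cubicEval, normalVec, Matrix.mulVec, dotProduct, Fin.sum_univ_three]
      field_simp
      ring
  · obtain ⟨κ, hκ⟩ := exists_cube_root (b 3)
    have hκ0 : κ ≠ 0 := by rintro rfl; simp at hκ; exact hd hκ.symm
    obtain ⟨e, he⟩ : ∃ e, b 2 = 3 * b 3 * e := ⟨b 2 / (3 * b 3), by field_simp⟩
    refine .of_type .cusp ⟨!![-κ * e, -κ, 0; 1, 0, 0;
        b 0 - b 3 * e ^ 3, b 1 - 3 * b 3 * e ^ 2, 1],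
      det_ne_zero_of_eq hκ0 (by simp), 1, one_ne_zero, fun v => ?_⟩
    simp [binaryEval, he, cubicEval, normalVec, Matrix.mulVec, dotProduct, Fin.sum_univ_three]
    linear_combination -(e * v 0 + v 1) ^ 3 * hκ

/-- Multiples of xy are absorbed into z, so only the vanishing of the coefficients of x³ and y³
matters. -/
lemma isClassified_nodal (b : Fin 4 → ℝ) :
    IsClassified (fun v => v 2 * (v 0 * v 1) + binaryEval b (v 0) (v 1)) := by
  rcases eq_or_ne (b 3) 0 with hd | hd <;> rcases eq_or_ne (b 0) 0 with ha | ha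
  · refine .of_type .realTriangle ⟨!![1, 0, 0; 0, 1, 0; b 1, b 2, 1],
      det_ne_zero_of_eq one_ne_zero (by simp), 1, one_ne_zero, fun v => ?_⟩
    simp [binaryEval, ha, hd, cubicEval, normalVec, Matrix.mulVec, dotProduct, Fin.sum_univ_three]
    ring
  · refine .of_type .realConicPlusSecantLine
      ⟨!![b 1 / (2 * b 0), (1 + b 2 / b 0) / 2, 1 / (2 * b 0); 1, 0, 0;
        -b 1 / (2 * b 0), (1 - b 2 / b 0) / 2, -1 / (2 * b 0)],
      det_ne_zero_of_eq (d := 1 / (2 * b 0)) (by simp [ha]) (by simp; field_simp; ring), b 0, ha,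
      fun v => ?_⟩
    simp [binaryEval, hd, cubicEval, normalVec, Matrix.mulVec, dotProduct, Fin.sum_univ_three]
    field_simp
    ring
  · refine .of_type .realConicPlusSecantLine
      ⟨!![(1 + b 1 / b 3) / 2, b 2 / (2 * b 3), 1 / (2 * b 3); 0, 1, 0;
        (1 - b 1 / b 3) / 2, -b 2 / (2 * b 3), -1 / (2 * b 3)],
      det_ne_zero_of_eq (d := -1 / (2 * b 3)) (by simp [hd]) (by simp; field_simp; ring), b 3, hd,
      fun v => ?_⟩
    simp [binaryEval, ha, cubicEval, normalVec, Matrix.mulVec, dotProduct, Fin.sum_univ_three]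
    field_simp
    ring
  · obtain ⟨κ, hκ⟩ := exists_cube_root (b 0)
    obtain ⟨μ, hμ⟩ := exists_cube_root (b 3)
    have hκ0 : κ ≠ 0 := by rintro rfl; simp at hκ; exact ha hκ.symm
    have hμ0 : μ ≠ 0 := by rintro rfl; simp at hμ; exact hd hμ.symm
    refine .of_type .nodalCubic ⟨!![κ, 0, 0; 0, μ, 0;
        b 1 / (6 * κ * μ), b 2 / (6 * κ * μ), 1 / (6 * κ * μ)],
      det_ne_zero_of_eq (d := 1 / 6) (by norm_num) (by simp; field_simp), 1, one_ne_zero,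
      fun v => ?_⟩
    simp [binaryEval, ← hκ, ← hμ, cubicEval, normalVec, Matrix.mulVec, dotProduct,
      Fin.sum_univ_three]
    field_simp
    ring

/-- Multiples of x² + y² are absorbed into z, so the binary cubic matters only through its value at
(1, i). -/
lemma isClassified_acnodal (b : Fin 4 → ℝ) :
    IsClassified (fun v => v 2 * (v 0 ^ 2 + v 1 ^ 2) + binaryEval b (v 0) (v 1)) := by
  -- The right side is the value of the binary cubic at (1, i). With ζ = u + iw, the cube of ux + wy
  -- has the same value there, and (ux + wy, -wx + uy) is a similarity, preserving x² + y² up to a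
  -- factor.
  obtain ⟨ζ, hζ⟩ : ∃ ζ : ℂ, ζ ^ 3 = ⟨b 0 - b 2, -(b 3 - b 1)⟩ :=
    IsAlgClosed.exists_pow_nat_eq _ (by norm_num)
  obtain ⟨u, w⟩ := ζ
  have hre := congrArg Complex.re hζ
  have him := congrArg Complex.im hζ
  simp [pow_succ] at hre him
  by_cases h0 : u ^ 2 + w ^ 2 = 0
  · have hu : u = 0 := by nlinarith
    have hw : w = 0 := by nlinarith
    subst hu hw
    simp at hre him
    refine .of_equiv (G := cubicEval (lineConicVec 0)) ⟨!![1, 0, 0; 0, 1, 0; b 2, b 1, 1],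
      det_ne_zero_of_eq one_ne_zero (by simp), 1, one_ne_zero, fun v => ?_⟩
      (.of_type .imaginaryTriangle (linEquivalent_imaginaryTriangle 2).symm)
    simp [binaryEval, lineConicVec, cubicEval, Matrix.mulVec, dotProduct, Fin.sum_univ_three]
    linear_combination -(v 0) ^ 3 * hre + (v 1) ^ 3 * him
  · refine .of_type .cubicaPunctata ⟨!![u, w, 0; -w, u, 0;
        -(b 2 - 3 * u * w ^ 2) / (u ^ 2 + w ^ 2), -(b 1 - 3 * u ^ 2 * w) / (u ^ 2 + w ^ 2),
          -1 / (u ^ 2 + w ^ 2)],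
      det_ne_zero_of_eq (d := -1) (by norm_num) (by simp; field_simp; ring), -1, by norm_num,
      fun v => ?_⟩
    simp [binaryEval, cubicEval, normalVec, Matrix.mulVec, dotProduct, Fin.sum_univ_three]
    field_simp
    linear_combination (-(v 0) ^ 3 * hre + (v 1) ^ 3 * him) * (u ^ 2 + w ^ 2)

/-- Cubics with a singular point at `(0, 0, 1)`. -/
lemma isClassified_of_singular_aux {α β γ : ℝ} {b : Fin 4 → ℝ}
    (h : b ≠ 0 ∨ α ≠ 0 ∨ β ≠ 0 ∨ γ ≠ 0) : IsClassified (fun v =>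
      v 2 * (α * v 0 ^ 2 + 2 * β * (v 0 * v 1) + γ * v 1 ^ 2) + binaryEval b (v 0) (v 1)) := by
  have key : ∀ α β γ : ℝ, ∀ b : Fin 4 → ℝ, α ≠ 0 → IsClassified (fun v =>
      v 2 * (α * v 0 ^ 2 + 2 * β * (v 0 * v 1) + γ * v 1 ^ 2) + binaryEval b (v 0) (v 1)) := by
    intro α β γ b hα
    obtain ⟨e, rfl⟩ : ∃ e, β = α * e := ⟨β / α, by field_simp⟩
    -- The quadratic form is now α((x + ey)² + δy²); the sign of δ separates cuspidal, acnodal and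
    -- nodal cubics.
    obtain ⟨δ, rfl⟩ : ∃ δ, γ = α * (δ + e ^ 2) := ⟨γ / α - e ^ 2, by field_simp; ring⟩
    rcases eq_or_ne δ 0 with hδ | hδ
    · subst hδ
      obtain ⟨b', hb'⟩ := exists_binaryEval_subst b 1 (-e) 0 1
      refine .of_equiv (linEquivalent_comp (B := !![1, -e, 0; 0, 1, 0; 0, 0, 1 / α])
        (det_ne_zero_of_eq (d := 1 / α) (by simpa using hα) (by simp))) ?_
      convert isClassified_cuspidal b' using 2 with v
      rw [← hb']
      simp [Matrix.mulVec, dotProduct, Fin.sum_univ_three]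
      field_simp
      ring
    · obtain ⟨s, hs, hs2⟩ : ∃ s : ℝ, s ≠ 0 ∧ (δ = s ^ 2 ∨ δ = -(s ^ 2)) := by
        refine ⟨√|δ|, by positivity, ?_⟩
        rw [Real.sq_sqrt (abs_nonneg _)]
        rcases abs_choice δ with h | h <;> rw [h] <;> simp
      rcases hs2 with rfl | rfl
      · obtain ⟨b', hb'⟩ := exists_binaryEval_subst b 1 (-e / s) 0 (1 / s)
        refine .of_equiv (linEquivalent_comp (B := !![1, -e / s, 0; 0, 1 / s, 0; 0, 0, 1 / α])
          (det_ne_zero_of_eq (d := 1 / s * (1 / α)) (by simp [hα, hs]) (by simp))) ?_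
        convert isClassified_acnodal b' using 2 with v
        rw [← hb']
        simp [Matrix.mulVec, dotProduct, Fin.sum_univ_three]
        field_simp
        ring
      · obtain ⟨b', hb'⟩ := exists_binaryEval_subst b (1 / 2 - e / (2 * s)) (1 / 2 + e / (2 * s))
          (1 / (2 * s)) (-1 / (2 * s))
        refine .of_equiv (linEquivalent_comp (B := !![1 / 2 - e / (2 * s), 1 / 2 + e / (2 * s), 0;
          1 / (2 * s), -1 / (2 * s), 0; 0, 0, 1 / α])
          (det_ne_zero_of_eq (d := -1 / (2 * s) * (1 / α)) (by simp [hα, hs])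
            (by simp; field_simp; ring))) ?_
        convert isClassified_nodal b' using 2 with v
        rw [← hb']
        simp [Matrix.mulVec, dotProduct, Fin.sum_univ_three]
        field_simp
        ring
  by_cases hα : α = 0
  · by_cases hγ : γ = 0
    · subst hα hγ
      by_cases hβ : β = 0
      · subst hβ
        have hb : b ≠ 0 := by simpa using h
        convert isClassified_binary hb using 2 with v
        ring
      · obtain ⟨b', hb'⟩ := exists_binaryEval_subst b 1 0 0 1
        refine .of_equiv (linEquivalent_comp (B := !![1, 0, 0; 0, 1, 0; 0, 0, 1 / (2 * β)])
          (det_ne_zero_of_eq (d := 1 / (2 * β)) (by simpa using hβ) (by simp))) ?_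
        convert isClassified_nodal b' using 2 with v
        rw [← hb']
        simp [Matrix.mulVec, dotProduct, Fin.sum_univ_three]
        field_simp
    · obtain ⟨b', hb'⟩ := exists_binaryEval_subst b 0 1 1 0
      refine .of_equiv (linEquivalent_comp (B := !![0, 1, 0; 1, 0, 0; 0, 0, 1])
        (det_ne_zero_of_eq (d := -1) (by norm_num) (by simp))) ?_
      convert key γ β α b' hγ using 2 with v
      rw [← hb']
      simp [Matrix.mulVec, dotProduct, Fin.sum_univ_three]
      left
      ring
  · exact key α β γ b hα

lemma exists_matrix_mulVec_eq {v : Fin 3 → ℝ} (hv : v ≠ 0) :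
    ∃ B : Matrix (Fin 3) (Fin 3) ℝ, B.det ≠ 0 ∧ B.mulVec ![0, 0, 1] = v := by
  by_cases h2 : v 2 = 0
  · by_cases h1 : v 1 = 0
    · have h0 : v 0 ≠ 0 := fun h0 => hv (eq_zero_of_forall_eq h0 h1 h2)
      refine ⟨!![0, 0, v 0; 1, 0, v 1; 0, 1, v 2], det_ne_zero_of_eq h0 (by simp), ?_⟩
      funext i
      fin_cases i <;> simp [Matrix.mulVec, dotProduct, Fin.sum_univ_three]
    · refine ⟨!![1, 0, v 0; 0, 0, v 1; 0, 1, v 2],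
        det_ne_zero_of_eq (d := -v 1) (by simpa using h1) (by simp), ?_⟩
      funext i
      fin_cases i <;> simp [Matrix.mulVec, dotProduct, Fin.sum_univ_three]
  · refine ⟨!![1, 0, v 0; 0, 1, v 1; 0, 0, v 2], det_ne_zero_of_eq h2 (by simp), ?_⟩
    funext i
    fin_cases i <;> simp [Matrix.mulVec, dotProduct, Fin.sum_univ_three]

lemma linEquivalent_cubicSubst {a : Fin 10 → ℝ} {B : Matrix (Fin 3) (Fin 3) ℝ} (hB : B.det ≠ 0) :
    LinEquivalent (cubicEval a) (cubicEval (cubicSubst B a)) := by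
  rw [show cubicEval (cubicSubst B a) = fun v => cubicEval a (B.mulVec v) from
    funext (cubicEval_cubicSubst B a)]
  exact linEquivalent_comp hB

lemma cubicPolar_cubicSubst (a : Fin 10 → ℝ) (B : Matrix (Fin 3) (Fin 3) ℝ) (u v w : Fin 3 → ℝ) :
    cubicPolar (cubicSubst B a) u v w = cubicPolar a (B.mulVec u) (B.mulVec v) (B.mulVec w) := by
  have h1 := cubicPolar_eq (cubicSubst B a) u v w
  have h2 := cubicPolar_eq a (B.mulVec u) (B.mulVec v) (B.mulVec w)
  simp only [cubicEval_cubicSubst, Matrix.mulVec_add] at h1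
  linarith

lemma isClassified_of_hasSingularPoint {a : Fin 10 → ℝ} (ha : a ≠ 0) (h : HasSingularPoint a) :
    IsClassified (cubicEval a) := by
  obtain ⟨v, hv, hv0⟩ := h
  obtain ⟨B, hB, rfl⟩ := exists_matrix_mulVec_eq hv0
  have hequiv := linEquivalent_cubicSubst (a := a) hB
  refine .of_equiv hequiv ?_
  have hsing : ![0, 0, 1] ∈ singularPoints (cubicSubst B a) := fun w => by
    rw [cubicPolar_cubicSubst, hv]
  have hne : cubicSubst B a ≠ 0 := by
    intro h0
    refine ha (cubicEval_injective fun v => ?_)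
    obtain ⟨A, -, c, -, h⟩ := hequiv
    rw [h, h0, cubicEval_zero, cubicEval_zero, mul_zero]
  generalize cubicSubst B a = d at hsing hne
  rw [mem_singularPoints_iff] at hsing
  simp [cubicPolar] at hsing
  obtain ⟨h7, h8, h2⟩ := hsing
  have := isClassified_of_singular_aux (α := 3 * d 4) (β := 3 * d 9) (γ := 3 * d 6)
    (b := restrictBinary d) (by
      by_contra! hcon
      obtain ⟨hb, h4, h9, h6⟩ := hcon
      have b0 := congrFun hb 0
      have b1 := congrFun hb 1
      have b2 := congrFun hb 2
      have b3 := congrFun hb 3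
      simp [restrictBinary] at b0 b1 b2 b3 h4 h9 h6
      refine hne (funext fun i => ?_)
      fin_cases i <;> assumption)
  convert this using 2 with v
  simp [cubicEval, binaryEval, restrictBinary, h7, h8, h2]
  ring

/-! ### Real inflection lines -/

/-- The cubic has a real inflectional tangent line, or contains a real line. -/
def HasFlexLine (a : Fin 10 → ℝ) : Prop :=
  ∃ l : Fin 3 → ℝ, l ≠ 0 ∧ ∃ (n : Fin 3 → ℝ) (c : ℝ),
    ∀ v, l ⬝ᵥ v = 0 → cubicEval a v = c * (n ⬝ᵥ v) ^ 3

lemma HasFlexLine.congr {a b : Fin 10 → ℝ} (h : LinEquivalent (cubicEval a) (cubicEval b))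
    (hb : HasFlexLine b) : HasFlexLine a := by
  obtain ⟨A, hA, c, hc, h⟩ := h
  obtain ⟨l, hl, n, d, hb⟩ := hb
  refine ⟨Matrix.vecMul l A, vecMul_ne_zero hA hl, Matrix.vecMul n A, c * d, fun v hv => ?_⟩
  rw [← Matrix.dotProduct_mulVec] at hv ⊢
  rw [h, hb _ hv, mul_assoc]

lemma flexLine_or_singular_congr {a b : Fin 10 → ℝ}
    (h : LinEquivalent (cubicEval a) (cubicEval b)) (hb : HasFlexLine b ∨ HasSingularPoint b) :
    HasFlexLine a ∨ HasSingularPoint a :=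
  hb.imp (.congr h) (.congr h.symm)

/-- With D the quartic on the right and N = 2DD'' - D'² on the left, the equation says that w = √D
satisfies w'' = ±2. The terms of degree 12 and 10 cancel, and the difference has odd degree nine
with leading coefficient 64q. -/
lemma exists_flex_root (p r : ℝ) {q : ℝ} (hq : q ≠ 0) : ∃ u : ℝ,
    (8 * u ^ 6 + 12 * p * u ^ 4 + 16 * q * u ^ 3 + 24 * r * u ^ 2 + (4 * p * r - q ^ 2)) ^ 2 =
      64 * (u ^ 4 + p * u ^ 2 + q * u + r) ^ 3 := by
  let P : Polynomial ℝ := .C (64 * q) * .X ^ 9 + .C (192 * r - 48 * p ^ 2) * .X ^ 8 +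
    .C (48 * q ^ 2 + 256 * p * r - 64 * p ^ 3) * .X ^ 6 +
    .C (384 * q * r - 192 * p ^ 2 * q) * .X ^ 5 +
    .C (384 * r ^ 2 - 96 * p ^ 2 * r - 216 * p * q ^ 2) * .X ^ 4 +
    .C (-96 * q ^ 3 - 256 * p * q * r) * .X ^ 3 + .C (-240 * q ^ 2 * r) * .X ^ 2 +
    .C (-192 * q * r ^ 2) * .X + .C ((4 * p * r - q ^ 2) ^ 2 - 64 * r ^ 3)
  have hP : P.natDegree = 9 := by
    simp only [P]
    compute_degree!
  obtain ⟨u, hu⟩ := exists_root_of_odd_natDegree (p := P) (by rw [hP]; decide)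
  refine ⟨u, ?_⟩
  simp only [P, Polynomial.eval_add, Polynomial.eval_mul, Polynomial.eval_C, Polynomial.eval_pow,
    Polynomial.eval_X] at hu
  linear_combination hu

/-- The coefficient vector of `z² x + z y² + b₁ y² x + b₂ y x² + b₃ x³`. -/
noncomputable def tangentVec (b₁ b₂ b₃ : ℝ) : Fin 10 → ℝ :=
  ![b₃, 0, 0, b₂ / 3, 0, b₁ / 3, 1 / 3, 1 / 3, 0, 0]

/-- Lines through (0,0,1) are y = ux; on each the cubic is quadratic in z, with solutions z = (-u² ±
w)/2 and w² = D(u). A flex is a point where z'' = 0, that is w'' = 2 on the proper branch. For `b₂ =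
0` the point (0,1,0) is already a flex or the line contains only cubic's zeros. -/
lemma flexLine_or_singular_tangentVec (b₁ b₂ b₃ : ℝ) :
    HasFlexLine (tangentVec b₁ b₂ b₃) ∨ HasSingularPoint (tangentVec b₁ b₂ b₃) := by
  by_cases h2 : b₂ = 0
  · subst h2
    refine Or.inl ⟨![b₁, 0, 1], vec_ne_zero_of 2 (by simp), ![1, 0, 0], b₁ ^ 2 + b₃, fun v hv => ?_⟩
    simp [dotProduct, Fin.sum_univ_three] at hv
    simp [dotProduct, Fin.sum_univ_three, cubicEval, tangentVec]
    linear_combination (v 1 ^ 2 + v 0 * (v 2 - b₁ * v 0)) * hv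
  · obtain ⟨u, hu⟩ := exists_flex_root (-4 * b₁) (-4 * b₃) (q := -4 * b₂) (by simpa using h2)
    set D := u ^ 4 + -4 * b₁ * u ^ 2 + -4 * b₂ * u + -4 * b₃ with hD
    set N := 8 * u ^ 6 + 12 * (-4 * b₁) * u ^ 4 + 16 * (-4 * b₂) * u ^ 3 + 24 * (-4 * b₃) * u ^ 2 +
      (4 * (-4 * b₁) * (-4 * b₃) - (-4 * b₂) ^ 2) with hN
    have hND : N = 2 * D * (12 * u ^ 2 - 8 * b₁) - (4 * u ^ 3 - 8 * b₁ * u - 4 * b₂) ^ 2 := by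
      rw [hN, hD]; ring
    -- If D vanishes, so do N and D'; a double root of D is a singular point of the cubic.
    by_cases hD0 : D = 0
    · right
      have hN0 : N = 0 := by
        rw [hD0] at hu
        simpa using hu
      have hD' : 4 * u ^ 3 - 8 * b₁ * u - 4 * b₂ = 0 := by
        rw [hN0, hD0] at hND
        simpa using hND.symm
      rw [hD0] at hD
      refine ⟨![1, u, -u ^ 2 / 2], mem_singularPoints_iff.2 ⟨?_, ?_, ?_⟩, vec_ne_zero_of 0 (by simp)⟩
      · simp [cubicPolar, tangentVec]
        linear_combination (1 / 4) * hD + (1 / 12) * u * hD'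
      · simp [cubicPolar, tangentVec]
        linear_combination (-1 / 12) * hD'
      · simp [cubicPolar, tangentVec]
        ring
    · left
      -- This choice fixes the sign of the square root of D, hence the branch carrying the flex.
      obtain ⟨w, hw⟩ : ∃ w, N = 8 * D * w := ⟨N / (8 * D), by field_simp⟩
      have hw2 : w ^ 2 = D := by
        rw [hw] at hu
        have : D ^ 2 * (w ^ 2 - D) = 0 := by linear_combination hu / 64
        simpa [hD0, sub_eq_zero] using this
      have hw0 : w ≠ 0 := by
        rintro rfl
        exact hD0 (by rw [← hw2]; simp)
      obtain ⟨μ, hμ⟩ : ∃ μ, 4 * u ^ 3 - 8 * b₁ * u - 4 * b₂ = 4 * w * μ :=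
        ⟨(4 * u ^ 3 - 8 * b₁ * u - 4 * b₂) / (4 * w), by field_simp⟩
      -- The point has height z₀ = (-u² + w)/2 and the tangent there has slope μ - u. The equations
      -- `e1`, `e2`, `e3` kill the terms of order 0, 1 and 2 along the tangent, leaving a cube.
      have e1 : ((-u ^ 2 + w) / 2) ^ 2 + u ^ 2 * ((-u ^ 2 + w) / 2) + b₁ * u ^ 2 + b₂ * u + b₃ =
          0 := by
        linear_combination (1 / 4) * hw2 + (1 / 4) * hD
      have e2 : 2 * ((-u ^ 2 + w) / 2) * (μ - u) + 2 * u * ((-u ^ 2 + w) / 2) + u ^ 2 * (μ - u) +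
          2 * b₁ * u + b₂ = 0 := by
        linear_combination (-1 / 4) * hμ
      have e3 : (μ - u) ^ 2 + (-u ^ 2 + w) / 2 + 2 * u * (μ - u) + b₁ = 0 := by
        have : 16 * D * ((μ - u) ^ 2 + (-u ^ 2 + w) / 2 + 2 * u * (μ - u) + b₁) = 0 := by
          rw [hμ] at hND
          linear_combination hND - hw - 16 * μ ^ 2 * hw2
        simpa [hD0] using this
      generalize (-u ^ 2 + w) / 2 = z₀ at e1 e2 e3
      generalize μ - u = m at e2 e3
      refine ⟨![m * u - z₀, -m, 1], vec_ne_zero_of 2 (by simp), ![-u, 1, 0], m, fun v hv => ?_⟩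
      simp [dotProduct, Fin.sum_univ_three] at hv
      have hz : v 2 = z₀ * v 0 + m * (v 1 - u * v 0) := by linarith
      simp [dotProduct, Fin.sum_univ_three, cubicEval, tangentVec, hz]
      linear_combination v 0 ^ 3 * e1 + v 0 ^ 2 * (v 1 - u * v 0) * e2 +
        v 0 * (v 1 - u * v 0) ^ 2 * e3

/-- The curve passes through (0,0,1) with tangent x = 0. Either this tangent is itself a flex line,
or a triangular substitution brings the cubic to the shape of `tangentVec`. -/
lemma flexLine_or_singular_of_tangent {a : Fin 10 → ℝ} (h2 : a 2 = 0) (h8 : a 8 = 0)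
    (h7 : a 7 ≠ 0) : HasFlexLine a ∨ HasSingularPoint a := by
  by_cases h6 : a 6 = 0
  · refine Or.inl ⟨![1, 0, 0], vec_ne_zero_of 0 (by simp), ![0, 1, 0], a 1, fun v hv => ?_⟩
    have h0 : v 0 = 0 := by simpa [dotProduct, Fin.sum_univ_three] using hv
    simp [dotProduct, Fin.sum_univ_three, cubicEval, h0, h2, h8, h6]
  · obtain ⟨ρ, hρ⟩ : ∃ ρ, a 7 = 3 * a 6 ^ 2 * ρ := ⟨a 7 / (3 * a 6 ^ 2), by field_simp⟩
    have hρ0 : ρ ≠ 0 := by rintro rfl; simp at hρ; exact h7 hρ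
    obtain ⟨σ, hσ⟩ : ∃ σ, a 9 = a 6 * (σ + a 1 * ρ) := ⟨a 9 / a 6 - a 1 * ρ, by field_simp; ring⟩
    obtain ⟨τ, hτ⟩ : ∃ τ, a 4 = 2 * a 6 * ρ * τ + a 6 * σ ^ 2 :=
      ⟨(a 4 - a 6 * σ ^ 2) / (2 * a 6 * ρ), by field_simp; ring⟩
    obtain ⟨b₁, hb₁⟩ : ∃ b₁, 3 * a 5 = a 1 ^ 2 * ρ + τ + 2 * a 1 * σ + b₁ * ρ :=
      ⟨(3 * a 5 - (a 1 ^ 2 * ρ + τ + 2 * a 1 * σ)) / ρ, by field_simp; ring⟩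
    obtain ⟨b₂, hb₂⟩ : ∃ b₂, 3 * a 3 = 2 * a 1 * τ * ρ + (2 * σ * τ + a 1 * σ ^ 2) +
        2 * b₁ * σ * ρ + b₂ * ρ ^ 2 :=
      ⟨(3 * a 3 - (2 * a 1 * τ * ρ + (2 * σ * τ + a 1 * σ ^ 2) + 2 * b₁ * σ * ρ)) / ρ ^ 2, by
        field_simp; ring⟩
    obtain ⟨b₃, hb₃⟩ : ∃ b₃, a 0 = τ ^ 2 * ρ + τ * σ ^ 2 + b₁ * σ ^ 2 * ρ + b₂ * σ * ρ ^ 2 +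
        b₃ * ρ ^ 3 :=
      ⟨(a 0 - (τ ^ 2 * ρ + τ * σ ^ 2 + b₁ * σ ^ 2 * ρ + b₂ * σ * ρ ^ 2)) / ρ ^ 3, by
        field_simp; ring⟩
    refine flexLine_or_singular_congr (b := tangentVec b₁ b₂ b₃)
      ⟨!![ρ, 0, 0; σ, 1, 0; τ, a 1, 3 * a 6],
        det_ne_zero_of_eq (d := ρ * (3 * a 6)) (by simp [hρ0, h6]) (by simp), 1, one_ne_zero,
        fun v => ?_⟩ (flexLine_or_singular_tangentVec _ _ _)
    simp [cubicEval, tangentVec, Matrix.mulVec, dotProduct, Fin.sum_univ_three, h2, h8, hρ, hσ, hτ]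
    linear_combination v 0 * v 1 ^ 2 * hb₁ + v 0 ^ 2 * v 1 * hb₂ + v 0 ^ 3 * hb₃

lemma flexLine_or_singular_of_point {a : Fin 10 → ℝ} (h2 : a 2 = 0) :
    HasFlexLine a ∨ HasSingularPoint a := by
  by_cases h7 : a 7 = 0
  · by_cases h8 : a 8 = 0
    · exact Or.inr ⟨![0, 0, 1], by simp [mem_singularPoints_iff, cubicPolar, h2, h7, h8],
        vec_ne_zero_of 2 (by simp)⟩
    · refine flexLine_or_singular_congr (linEquivalent_cubicSubst (B := !![0, 1, 0; 1, 0, 0; 0, 0, 1])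
        (det_ne_zero_of_eq (d := -1) (by norm_num) (by simp)))
        (flexLine_or_singular_of_tangent ?_ ?_ ?_) <;>
        simp [cubicSubst, cubicPolar, h2, h7, h8]
  · refine flexLine_or_singular_congr
      (linEquivalent_cubicSubst (B := !![1, -a 8 / a 7, 0; 0, 1, 0; 0, 0, 1])
        (det_ne_zero_of_eq one_ne_zero (by simp)))
      (flexLine_or_singular_of_tangent ?_ ?_ ?_)
    · simp [cubicSubst, cubicPolar, h2]
    · simp [cubicSubst, cubicPolar, h2]
      field_simp
      ring
    · simpa [cubicSubst, cubicPolar, h2] using h7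

/-- A real cubic without real singular points has a real inflectional tangent line, unless it
contains a real line. -/
lemma flexLine_or_singular (a : Fin 10 → ℝ) : HasFlexLine a ∨ HasSingularPoint a := by
  obtain ⟨v, hv0, hv⟩ : ∃ v : Fin 3 → ℝ, v ≠ 0 ∧ cubicEval a v = 0 := by
    rcases exists_root_binaryEval (restrictBinary a) with h | ⟨m, hm⟩
    · refine ⟨![0, 1, 0], vec_ne_zero_of 1 (by simp), ?_⟩
      rw [← binaryEval_restrictBinary]
      simp [binaryEval, h]
    · exact ⟨![1, m, 0], vec_ne_zero_of 0 (by simp), by rw [← binaryEval_restrictBinary, hm]⟩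
  obtain ⟨B, hB, rfl⟩ := exists_matrix_mulVec_eq hv0
  refine flexLine_or_singular_congr (linEquivalent_cubicSubst hB) (flexLine_or_singular_of_point ?_)
  rw [← cubicEval_cubicSubst] at hv
  simpa [cubicEval] using hv

/-! ### Classification of cubics without real singular points -/

lemma isClassified_hesse {lam : ℝ} (h : lam ≠ -1 / 2) :
    IsClassified (cubicEval ![1, 1, 1, 0, 0, 0, 0, 0, 0, lam]) := by
  by_cases h0 : lam = 0
  · subst h0; exact .of_type .realFermat (.refl _)
  by_cases h1 : lam = 1
  · subst h1; exact .of_type .imaginaryFermat (.refl _)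
  exact ⟨.hessePencil, lam, h, h0, h1, .refl _⟩

/-! ### From Weierstrass cubics to the Hesse pencil -/

/-- A combination of the product of three independent linear forms and the cube of their sum. -/
lemma isClassified_triangle_add_cube {α β : ℝ} (hα : α ≠ 0) (hβ : β ≠ 0) (h : β + 27 * α ≠ 0) :
    IsClassified (fun v => α * (v 0 + v 1 + v 2) ^ 3 + β * (v 0 * v 1 * v 2)) := by
  obtain ⟨w, hw⟩ := exists_cube_root (-27 * α / β - 1)
  have hw' : β * w ^ 3 = -27 * α - β := by rw [hw]; field_simp
  obtain ⟨t, hwt⟩ : ∃ t, w = 3 * t - 1 := ⟨(w + 1) / 3, by ring⟩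
  have ht : t ≠ 0 := by
    rintro rfl
    rw [hwt] at hw'
    apply hα
    linarith
  have hw0 : w ≠ 0 := by
    rintro rfl
    apply h
    linarith
  rw [hwt] at hw'
  have hrel : 3 * α = -β * (t - 3 * t ^ 2 + 3 * t ^ 3) := by linear_combination hw' / 9
  have hα' : α = -β * (t - 3 * t ^ 2 + 3 * t ^ 3) / 3 := by linarith
  -- Both cubics are symmetric, so the substitution is taken to commute with permutations: the
  -- coordinates become t(ts - xᵢ) with s the coordinate sum. The Hesse parameter is the one that
  -- kills s(xy + yz + zx), and `hrel` matches the ratio of s³ to xyz.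
  refine .of_equiv (G := cubicEval ![1, 1, 1, 0, 0, 0, 0, 0, 0, (w / t - 1) / 2])
    ⟨!![(t - 1) * t, t * t, t * t; t * t, (t - 1) * t, t * t; t * t, t * t, (t - 1) * t],
      det_ne_zero_of_eq (d := w * t ^ 3) (mul_ne_zero hw0 (pow_ne_zero 3 ht))
        (by rw [hwt]; simp; ring), -β / (3 * t ^ 2 * w),
      div_ne_zero (neg_ne_zero.2 hβ) (mul_ne_zero (by positivity) hw0), fun v => ?_⟩
      (isClassified_hesse fun h0 => hw0 ?_)
  · simp [cubicEval, Matrix.mulVec, dotProduct, Fin.sum_univ_three, hα']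
    field_simp
    rw [hwt]
    ring
  · have : w / t = 0 := by linarith
    simpa [ht] using this

/-- The coefficient vector of `y² z - x³ - a x z² - b z³`. -/
noncomputable def weierstrassVec (a b : ℝ) : Fin 10 → ℝ :=
  ![-1, 0, -b, 0, 0, 0, 1 / 3, -a / 3, 0, 0]

lemma hasSingularPoint_weierstrassVec {a b x : ℝ} (h : x ^ 3 + a * x + b = 0)
    (h' : 3 * x ^ 2 + a = 0) : HasSingularPoint (weierstrassVec a b) := by
  refine ⟨![x, 0, 1], mem_singularPoints_iff.2 ⟨?_, ?_, ?_⟩, vec_ne_zero_of 2 (by simp)⟩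
  · simp [cubicPolar, weierstrassVec]
    linear_combination -h' / 3
  · simp [cubicPolar, weierstrassVec]
  · simp [cubicPolar, weierstrassVec]
    linear_combination -h + x * h' / 3

/-- A real flex of a Weierstrass cubic other than the point at infinity. -/
lemma exists_weierstrass_flex {a b : ℝ} (h : ¬ HasSingularPoint (weierstrassVec a b)) :
    ∃ x y m : ℝ, 0 < y ∧ m ^ 2 = 3 * x ∧ 2 * y * m = 3 * x ^ 2 + a ∧
      y ^ 2 = x ^ 3 + a * x + b := by
  -- The quartic is the third division polynomial, whose roots are the abscissas of the finite
  -- flexes. At a positive root, 12x(x³ + ax + b) is a square, so `y` is real, and nonzero because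
  -- the cubic is nonsingular.
  have key : ∀ x : ℝ, 0 < x → 3 * x ^ 4 + 6 * a * x ^ 2 + 12 * b * x - a ^ 2 = 0 →
      ∃ x y m : ℝ, 0 < y ∧ m ^ 2 = 3 * x ∧ 2 * y * m = 3 * x ^ 2 + a ∧
        y ^ 2 = x ^ 3 + a * x + b := by
    intro x hx hψ
    have hg : 12 * x * (x ^ 3 + a * x + b) = (3 * x ^ 2 + a) ^ 2 := by linear_combination hψ
    have hg0 : 0 < x ^ 3 + a * x + b := by
      rcases lt_trichotomy 0 (x ^ 3 + a * x + b) with h1 | h1 | h1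
      · exact h1
      · rw [← h1, mul_zero] at hg
        exact absurd (hasSingularPoint_weierstrassVec h1.symm (pow_eq_zero_iff two_ne_zero |>.1
          hg.symm)) h
      · nlinarith [sq_nonneg (3 * x ^ 2 + a)]
    have hy : √(x ^ 3 + a * x + b) ^ 2 = x ^ 3 + a * x + b := Real.sq_sqrt hg0.le
    have hy0 : 0 < √(x ^ 3 + a * x + b) := Real.sqrt_pos.2 hg0
    generalize √(x ^ 3 + a * x + b) = y at hy hy0
    refine ⟨x, y, (3 * x ^ 2 + a) / (2 * y), hy0, ?_, by field_simp, hy⟩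
    rw [div_pow, ← hg, ← hy]
    field_simp
    ring
  by_cases ha : a = 0
  · subst ha
    rcases lt_trichotomy b 0 with hb | hb | hb
    · obtain ⟨x, hx⟩ := exists_cube_root (-4 * b)
      have hx0 : 0 < x := by
        by_contra! hneg
        have := Odd.pow_nonpos (n := 3) (by decide) hneg
        linarith
      exact key x hx0 (by linear_combination 3 * x * hx)
    · subst hb
      exact absurd (hasSingularPoint_weierstrassVec (x := 0) (by simp) (by simp)) h
    · exact ⟨0, √b, 0, Real.sqrt_pos.2 hb, by simp, by simp, by simp [Real.sq_sqrt hb.le]⟩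
  · let ψ : ℝ → ℝ := fun x => 3 * x ^ 4 + 6 * a * x ^ 2 + 12 * b * x - a ^ 2
    have h0 : ψ 0 < 0 := by
      simp only [ψ]
      have : 0 < a ^ 2 := by positivity
      linarith
    obtain ⟨K, hK1, hKa, hKb⟩ : ∃ K : ℝ, 1 ≤ K ∧ |a| ≤ K ∧ |b| ≤ K :=
      ⟨1 + |a| + |b|, by linarith [abs_nonneg a, abs_nonneg b], by linarith [abs_nonneg b],
        by linarith [abs_nonneg a]⟩
    have hM : 0 ≤ ψ (5 * K) := by
      simp only [ψ]
      obtain ⟨a1, a2⟩ := abs_le.1 hKa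
      obtain ⟨b1, b2⟩ := abs_le.1 hKb
      have e1 : -K * K ^ 2 ≤ a * K ^ 2 := mul_le_mul_of_nonneg_right a1 (by positivity)
      have e2 : -K * K ≤ b * K := mul_le_mul_of_nonneg_right b1 (by positivity)
      have e3 : a ^ 2 ≤ K ^ 2 := sq_le_sq' a1 a2
      have e4 : K ^ 2 ≤ K ^ 4 := pow_le_pow_right₀ hK1 (by norm_num)
      have e5 : K ^ 3 ≤ K ^ 4 := pow_le_pow_right₀ hK1 (by norm_num)
      nlinarith
    obtain ⟨x, hx, hx0⟩ := intermediate_value_Icc (f := ψ) (by linarith : (0 : ℝ) ≤ 5 * K)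
      (by simp only [ψ]; fun_prop) ⟨h0.le, hM⟩
    refine key x (lt_of_le_of_ne hx.1 ?_) hx0
    rintro rfl
    exact h0.ne hx0

/-- The flexes (x, y), (x, -y) and infinity lie on a vertical line, and the cubic is a combination
of the product of their tangents and the cube of that line. For m = 0 the tangents are concurrent,
which is treated separately. -/
lemma isClassified_weierstrassVec {a b : ℝ} (h : ¬ HasSingularPoint (weierstrassVec a b)) :
    IsClassified (cubicEval (weierstrassVec a b)) := by
  obtain ⟨x, y, m, hy, hm, hym, hy2⟩ := exists_weierstrass_flex h
  have hy0 := hy.ne'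
  obtain rfl : x = m ^ 2 / 3 := by linarith
  obtain rfl : a = 2 * y * m - 3 * (m ^ 2 / 3) ^ 2 := by linarith
  obtain rfl : b = y ^ 2 - (m ^ 2 / 3) ^ 3 - (2 * y * m - 3 * (m ^ 2 / 3) ^ 2) * (m ^ 2 / 3) := by
    linarith
  by_cases hm0 : m = 0
  · subst hm0
    obtain ⟨κ, hκ⟩ := exists_cube_root (2 * y)
    have hκ0 : κ ≠ 0 := by rintro rfl; simp at hκ; exact hy0 hκ
    refine .of_type .imaginaryFermat
      ⟨!![κ / 3, 0, 2 * y / 3; κ / 3, -1 / 3, -y / 3; κ / 3, 1 / 3, -y / 3],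
        det_ne_zero_of_eq (d := κ * y * 2 / 9) (by simp [hκ0, hy0]) (by simp; ring),
        -3 / (2 * y), by simp [hy0], fun v => ?_⟩
    simp [cubicEval, normalVec, weierstrassVec, Matrix.mulVec, dotProduct, Fin.sum_univ_three]
    field_simp
    linear_combination (9 * v 0 ^ 3) * hκ
  -- The rows of the matrix are the three flex tangents, scaled so that their sum is 2m times the
  -- line through the flexes.
  · refine .of_equiv (G := fun v => -1 / (8 * m ^ 3) * (v 0 + v 1 + v 2) ^ 3 +
        1 / (2 * y) * (v 0 * v 1 * v 2))
      ⟨!![0, 0, -2 * y; m, 1, y - m * (m ^ 2 / 3); m, -1, y - m * (m ^ 2 / 3)],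
        det_ne_zero_of_eq (d := 4 * m * y) (by simp [hm0, hy0]) (by simp; ring), 1, one_ne_zero,
        fun v => ?_⟩ (isClassified_triangle_add_cube (by simp [hm0]) (by simp [hy0]) ?_)
    · simp [cubicEval, weierstrassVec, Matrix.mulVec, dotProduct, Fin.sum_univ_three]
      field_simp
      ring
    · intro h0
      have h1 : 4 * m ^ 3 = 27 * y := by
        field_simp at h0
        linarith
      have hy' : y = 4 * m ^ 3 / 27 := by linarith
      refine h (hasSingularPoint_weierstrassVec (x := m ^ 2 / 3 - 3 * y / m) ?_ ?_) <;> rw [hy'] <;>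
        field_simp <;> ring

/-- The coefficient vector of `z (y² + α x² + β x z + γ z²) + k x³`. -/
noncomputable def flexVec (k α β γ : ℝ) : Fin 10 → ℝ :=
  ![k, 0, γ, 0, α / 3, 0, 1 / 3, β / 3, 0, 0]

/-- For k = 0 the line z = 0 splits off. It must miss the real points of the residual conic, since
an intersection point would be singular, so the conic is real and external or imaginary. For k ≠ 0 a
shift of x gives a Weierstrass equation. -/
lemma isClassified_flexVec {k α β γ : ℝ} (h : ¬ HasSingularPoint (flexVec k α β γ)) :
    IsClassified (cubicEval (flexVec k α β γ)) := by
  by_cases hk : k = 0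
  · subst hk
    have hα : 0 < α := by
      by_contra! hα
      refine h ⟨![1, √(-α), 0], mem_singularPoints_iff.2 ⟨?_, ?_, ?_⟩, vec_ne_zero_of 0 (by simp)⟩
      · simp [cubicPolar, flexVec]
      · simp [cubicPolar, flexVec]
      · simp [cubicPolar, flexVec]
        rw [Real.mul_self_sqrt (by linarith)]
        ring
    obtain ⟨s, hs0, rfl⟩ : ∃ s, s ≠ 0 ∧ α = s ^ 2 :=
      ⟨√α, (Real.sqrt_pos.2 hα).ne', (Real.sq_sqrt hα.le).symm⟩
    obtain ⟨e, rfl⟩ : ∃ e, β = 2 * s * e := ⟨β / (2 * s), by field_simp⟩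
    obtain ⟨δ, rfl⟩ : ∃ δ, γ = δ + e ^ 2 := ⟨γ - e ^ 2, by ring⟩
    rcases lt_trichotomy δ 0 with hδ | hδ | hδ
    · obtain ⟨t, ht0, ht⟩ : ∃ t, t ≠ 0 ∧ δ = -t ^ 2 := ⟨√(-δ), (Real.sqrt_pos.2 (by linarith)).ne',
        by rw [Real.sq_sqrt (by linarith)]; ring⟩
      subst ht
      refine .of_type .realConicPlusExternalLine ⟨!![s, 0, e; 0, 1, 0; 0, 0, t],
        det_ne_zero_of_eq (d := s * t) (by simp [hs0, ht0]) (by simp), 1 / t, by simp [ht0],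
        fun v => ?_⟩
      simp [cubicEval, flexVec, normalVec, lineConicVec, Matrix.mulVec, dotProduct,
        Fin.sum_univ_three]
      field_simp
      ring
    · subst hδ
      refine absurd ⟨![-e / s, 0, 1], mem_singularPoints_iff.2 ⟨?_, ?_, ?_⟩,
        vec_ne_zero_of 2 (by simp)⟩ h
      · simp [cubicPolar, flexVec]
        field_simp
        ring
      · simp [cubicPolar, flexVec]
      · simp [cubicPolar, flexVec]
        field_simp
        ring
    · obtain ⟨t, ht0, ht⟩ : ∃ t, t ≠ 0 ∧ δ = t ^ 2 :=
        ⟨√δ, (Real.sqrt_pos.2 hδ).ne', (Real.sq_sqrt hδ.le).symm⟩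
      subst ht
      refine .of_type .imaginaryConicPlusLine ⟨!![0, 0, t; s, 0, e; 0, 1, 0],
        det_ne_zero_of_eq (d := s * t) (by simp [hs0, ht0]) (by simp; ring), 1 / t, by simp [ht0],
        fun v => ?_⟩
      simp [cubicEval, flexVec, normalVec, Matrix.mulVec, dotProduct, Fin.sum_univ_three]
      field_simp
      ring
  · obtain ⟨κ, hκ⟩ := exists_cube_root k
    have hκ0 : κ ≠ 0 := by rintro rfl; simp at hκ; exact hk hκ.symm
    subst hκ
    obtain ⟨e, rfl⟩ : ∃ e, α = 3 * e * κ ^ 3 := ⟨α / (3 * κ ^ 3), by field_simp⟩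
    have hequiv : LinEquivalent (cubicEval (flexVec (κ ^ 3) (3 * e * κ ^ 3) β γ))
        (cubicEval (weierstrassVec ((β - 3 * κ ^ 3 * e ^ 2) / κ)
          (-(γ - κ ^ 3 * e ^ 3 - (β - 3 * κ ^ 3 * e ^ 2) * e)))) := by
      refine ⟨!![-κ, 0, -κ * e; 0, 1, 0; 0, 0, 1], det_ne_zero_of_eq (d := -κ) (by simp [hκ0])
        (by simp), 1, one_ne_zero, fun v => ?_⟩
      simp [cubicEval, flexVec, weierstrassVec, Matrix.mulVec, dotProduct, Fin.sum_univ_three]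
      field_simp
      ring
    exact .of_equiv hequiv (isClassified_weierstrassVec fun h0 => h (h0.congr hequiv.symm))

/-- A flex line can be moved to `z = 0`. -/
lemma exists_linEquivalent_of_hasFlexLine {a : Fin 10 → ℝ} (h : HasFlexLine a) :
    ∃ b, LinEquivalent (cubicEval a) (cubicEval b) ∧ b 1 = 0 ∧ b 3 = 0 ∧ b 5 = 0 := by
  obtain ⟨l, hl, n, c, h⟩ := h
  have key : ∀ (n : Fin 3 → ℝ) (c : ℝ), (∀ v, l ⬝ᵥ v = 0 → cubicEval a v = c * (n ⬝ᵥ v) ^ 3) →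
      crossProduct n l ≠ 0 → ∃ b, LinEquivalent (cubicEval a) (cubicEval b) ∧ b 1 = 0 ∧ b 3 = 0 ∧ b 5 = 0 := by
    intro n c h hnl
    -- The new first and third coordinates are `n` and `l`; the cross product completes them, with
    -- determinant minus its squared length.
    let A : Matrix (Fin 3) (Fin 3) ℝ := Matrix.of ![n, crossProduct n l, l]
    have hA : A.det ≠ 0 := by
      have : A.det = -((crossProduct n l) ⬝ᵥ (crossProduct n l)) := by
        simp [A, Matrix.det_fin_three, cross_apply, dotProduct, Fin.sum_univ_three]
        ring
      rw [this]
      exact neg_ne_zero.2 fun h0 => hnl (dotProduct_self_eq_zero.1 h0)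
    have hu : IsUnit A.det := isUnit_iff_ne_zero.2 hA
    have hB : A⁻¹.det ≠ 0 := (A.isUnit_nonsing_inv_det hu).ne_zero
    have hrow : ∀ v : Fin 3 → ℝ, n ⬝ᵥ A⁻¹.mulVec v = v 0 ∧ l ⬝ᵥ A⁻¹.mulVec v = v 2 := by
      intro v
      have hv : A.mulVec (A⁻¹.mulVec v) = v := by
        rw [Matrix.mulVec_mulVec, Matrix.mul_nonsing_inv _ hu, Matrix.one_mulVec]
      exact ⟨congrFun hv 0, congrFun hv 2⟩
    refine ⟨cubicSubst A⁻¹ a, linEquivalent_cubicSubst hB, ?_⟩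
    have hres : restrictBinary (cubicSubst A⁻¹ a) = ![c, 0, 0, 0] := binaryEval_injective fun x y => by
      rw [binaryEval_restrictBinary, cubicEval_cubicSubst, h _ (by rw [(hrow _).2]; simp),
        (hrow _).1]
      simp [binaryEval]
    have h1 := congrFun hres 1
    have h2 := congrFun hres 2
    have h3 := congrFun hres 3
    simp [restrictBinary] at h1 h2 h3
    exact ⟨h3, h1, h2⟩
  -- If `n` is parallel to `l`, the cubic vanishes on the whole line, so `n` may be replaced by any
  -- independent vector with coefficient 0.
  by_cases hnl : crossProduct n l = 0
  · have h0 := congrFun hnl 0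
    have h1 := congrFun hnl 1
    have h2 := congrFun hnl 2
    simp [cross_apply] at h0 h1 h2
    have hn : ∀ v, l ⬝ᵥ v = 0 → n ⬝ᵥ v = 0 := by
      intro v hv
      obtain ⟨i, hi⟩ := Function.ne_iff.1 hl
      refine mul_left_cancel₀ hi (Eq.trans ?_ (mul_zero _).symm)
      simp only [dotProduct, Fin.sum_univ_three] at hv ⊢
      fin_cases i
      · change l 0 * _ = 0
        linear_combination n 0 * hv - v 1 * h2 + v 2 * h1
      · change l 1 * _ = 0
        linear_combination n 1 * hv + v 0 * h2 - v 2 * h0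
      · change l 2 * _ = 0
        linear_combination n 2 * hv - v 0 * h1 + v 1 * h0
    have hz : ∀ m : Fin 3 → ℝ, ∀ v, l ⬝ᵥ v = 0 → cubicEval a v = 0 * (m ⬝ᵥ v) ^ 3 := by
      intro m v hv
      rw [h v hv, hn v hv]
      simp
    by_cases hl0 : l 0 = 0
    · by_cases hl1 : l 1 = 0
      · refine key ![1, 0, 0] 0 (hz _) fun hc => hl (eq_zero_of_forall_eq hl0 hl1 ?_)
        simpa [cross_apply] using congrFun hc 1
      · refine key ![1, 0, 0] 0 (hz _) fun hc => hl1 ?_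
        simpa [cross_apply] using congrFun hc 2
    · refine key ![0, 1, 0] 0 (hz _) fun hc => hl0 ?_
      simpa [cross_apply] using congrFun hc 2
  · exact key n c h hnl

/-- The coefficient of y²z is nonzero, since otherwise (0,1,0) is singular; completing the square in
y gives the shape of `flexVec`. -/
lemma isClassified_of_flex {a : Fin 10 → ℝ} (h1 : a 1 = 0) (h3 : a 3 = 0) (h5 : a 5 = 0)
    (h : ¬ HasSingularPoint a) : IsClassified (cubicEval a) := by
  have h6 : a 6 ≠ 0 := by
    intro h6
    refine h ⟨![0, 1, 0], mem_singularPoints_iff.2 ?_, vec_ne_zero_of 1 (by simp)⟩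
    simp [cubicPolar, h1, h5, h6]
  obtain ⟨e, he⟩ : ∃ e, a 9 = a 6 * e := ⟨a 9 / a 6, by field_simp⟩
  obtain ⟨d, hd⟩ : ∃ d, a 8 = 2 * a 6 * d := ⟨a 8 / (2 * a 6), by field_simp⟩
  have hequiv : LinEquivalent (cubicEval a) (cubicEval (flexVec (a 0 / (3 * a 6))
      (a 4 / a 6 - e ^ 2) (a 7 / a 6 - 2 * e * d) (a 2 / (3 * a 6) - d ^ 2))) := by
    refine ⟨!![1, 0, 0; e, 1, d; 0, 0, 1], det_ne_zero_of_eq one_ne_zero (by simp), 3 * a 6,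
      by simpa using h6, fun v => ?_⟩
    simp [cubicEval, flexVec, Matrix.mulVec, dotProduct, Fin.sum_univ_three, h1, h3, h5, he, hd]
    field_simp
    ring
  exact .of_equiv hequiv (isClassified_flexVec fun h0 => h (h0.congr hequiv.symm))

/-- Every nonzero real ternary cubic is equivalent to one of the normal forms. -/
lemma exists_hasNormalForm {a : Fin 10 → ℝ} (ha : a ≠ 0) : ∃ t, HasNormalForm a t := by
  by_cases h : HasSingularPoint a
  · exact isClassified_of_hasSingularPoint ha h
  · obtain ⟨b, hb, h1, h3, h5⟩ :=
      exists_linEquivalent_of_hasFlexLine ((flexLine_or_singular a).resolve_right h)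
    exact IsClassified.of_equiv hb (isClassified_of_flex h1 h3 h5 fun h0 => h (h0.congr hb.symm))

/-! ### The main theorem -/

lemma cubicForm_normalVec_mem {lam : ℝ} (h1 : lam ≠ -1 / 2) (h2 : lam ≠ 0) (h3 : lam ≠ 1)
    (t : CubicType) :
    (cubicForm (normalVec lam t) : MvPolynomial (Fin 3) ℝ) ∈ t.normalForms := by
  cases t
  case hessePencil =>
    refine ⟨lam, h1, h2, h3, MvPolynomial.funext fun v => ?_⟩
    rw [eval_cubicForm]
    simp [cubicEval, normalVec, CubicType.hesse]
    ring
  all_goals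
    refine Set.mem_singleton_iff.2 (MvPolynomial.funext fun v => ?_)
    rw [eval_cubicForm]
    simp [cubicEval, normalVec, lineConicVec]
    try ring

lemma exists_lam_of_mem_normalForms {t : CubicType} {p : MvPolynomial (Fin 3) ℝ}
    (hp : p ∈ t.normalForms) : ∃ lam : ℝ, lam ≠ -1 / 2 ∧ lam ≠ 0 ∧ lam ≠ 1 ∧
      p = (cubicForm (normalVec lam t) : MvPolynomial (Fin 3) ℝ) := by
  have h1 : (2 : ℝ) ≠ -1 / 2 := by norm_num
  have h3 : (2 : ℝ) ≠ 1 := by norm_num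
  have hmem := cubicForm_normalVec_mem h1 two_ne_zero h3 t
  cases t
  case hessePencil =>
    obtain ⟨lam, h1, h2, h3, rfl⟩ := hp
    refine ⟨lam, h1, h2, h3, MvPolynomial.funext fun v => ?_⟩
    rw [eval_cubicForm]
    simp [cubicEval, normalVec, CubicType.hesse]
    ring
  all_goals
    exact ⟨2, h1, two_ne_zero, h3, (Set.mem_singleton_iff.1 hp).trans
      (Set.mem_singleton_iff.1 hmem).symm⟩

lemma slEquivalent_cubicForm_iff (f : RealForm 3 3) (b : Fin 10 → ℝ) :
    SLEquivalent (f : MvPolynomial (Fin 3) ℝ) (cubicForm b : MvPolynomial (Fin 3) ℝ) ↔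
      LinEquivalent (cubicEval (cubicVec f)) (cubicEval b) := by
  rw [slEquivalent_iff f _ ((mem_homogeneousSubmodule 3 _).1 (cubicForm b).2)]
  simp only [eval_cubicForm]

lemma hasType_iff (f : RealForm 3 3) (t : CubicType) :
    CubicType.HasType f t ↔ HasNormalForm (cubicVec f) t := by
  constructor
  · rintro ⟨p, hp, h⟩
    obtain ⟨lam, h1, h2, h3, rfl⟩ := exists_lam_of_mem_normalForms hp
    exact ⟨lam, h1, h2, h3, (slEquivalent_cubicForm_iff f _).1 h⟩
  · rintro ⟨lam, h1, h2, h3, h⟩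
    exact ⟨_, cubicForm_normalVec_mem h1 h2 h3 t, (slEquivalent_cubicForm_iff f _).2 h⟩

lemma isLimitOfHasRank_four_all (a : Fin 10 → ℝ) : IsLimitOfHasRank a 4 :=
  isLimitOfHasRank_four (fun _ => exists_hasNormalForm) a

lemma HasNormalForm.unique {a : Fin 10 → ℝ} {t t' : CubicType} (h : HasNormalForm a t)
    (h' : HasNormalForm a t') : t = t' := by
  obtain ⟨lam, h1, h2, h3, h⟩ := h
  obtain ⟨lam', h1', h2', h3', h'⟩ := h'
  exact type_unique isLimitOfHasRank_four_all h1 h2 h3 h1' h2' h3' (h.symm.trans h')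

lemma HasNormalForm.hasBorderRank {a : Fin 10 → ℝ} {t : CubicType} (h : HasNormalForm a t) :
    HasBorderRank a t.tableBorderRank := by
  obtain ⟨lam, h1, h2, h3, h⟩ := h
  have hb := (normalVec_ranks h1 h2 h3 t).2 (isLimitOfHasRank_four_all _)
  exact ⟨⟨hb.1.1, h.isLimitOfHasRank hb.1.2⟩, fun s hs =>
    hb.2 ⟨hs.1, h.symm.isLimitOfHasRank hs.2⟩⟩

lemma isRealBorderRank_iff (f : RealForm 3 3) (r : ℕ) :
    IsRealBorderRank f r ↔ HasBorderRank (cubicVec f) r := by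
  simp only [IsRealBorderRank, HasBorderRank, isLimitOfRank_iff]

lemma hasRank_zero : HasRank 0 0 :=
  ⟨⟨0, 0, fun v => by simp [cubicEval]⟩, fun s _ => s.zero_le⟩

lemma isTypicalRealRank_four : IsTypicalRealRank 3 3 4 := by
  let _ := formTopology 3 3
  have hc : Continuous (cubicVec : RealForm 3 3 → Fin 10 → ℝ) :=
    continuous_normalizedCoeffs.comp continuous_induced_dom
  refine ⟨{f | aronholdS (cubicVec f) * hessResultant (cubicVec f) ≠ 0},
    isOpen_ne_fun ((continuous_aronholdS.comp hc).mul (continuous_hessResultant.comp hc))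
      continuous_const, ⟨cubicForm genericVec, ?_⟩, fun f hf => ?_⟩
  · rw [Set.mem_ofPred_eq, cubicVec_cubicForm]
    exact generic_genericVec
  · exact (isRealRank_iff f 4).2 (hasRank_four_of_generic (fun _ => exists_hasNormalForm) hf)

/-- Cubics of rank four are dense, so every nonempty open set contains one. -/
lemma eq_four_of_isTypicalRealRank {r : ℕ} (h : IsTypicalRealRank 3 3 r) : r = 4 := by
  obtain ⟨U, hU, ⟨f, hf⟩, hr⟩ := h
  let _ := formTopology 3 3
  obtain ⟨P, hP, hlim⟩ := isLimitOfHasRank_four_all (cubicVec f)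
  have hc : Continuous (cubicForm : (Fin 10 → ℝ) → RealForm 3 3) :=
    continuous_induced_rng.2 continuous_formCoeffs_cubicForm
  have hlim' : Tendsto (fun ε => cubicForm (P ε)) (𝓝[>] 0) (𝓝 f) := by
    have := (hc.tendsto _).comp hlim
    rwa [cubicForm_cubicVec] at this
  obtain ⟨ε, hε, hε0⟩ := ((hlim'.eventually (hU.mem_nhds hf)).and self_mem_nhdsWithin).exists
  have h1 := (isRealRank_iff _ _).1 (hr _ hε)
  rw [cubicVec_cubicForm] at h1
  exact h1.unique (hP ε hε0)

theorem theorem2p1 :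
    -- every nonzero real ternary cubic has exactly one of the sixteen types
    (∀ f : RealForm 3 3, f ≠ 0 → ∃! t : CubicType, CubicType.HasType f t) ∧
    -- its real rank and real border rank are those of the table
    (∀ (f : RealForm 3 3) (t : CubicType), CubicType.HasType f t →
      IsRealRank f t.tableRank ∧ IsRealBorderRank f t.tableBorderRank) ∧
    -- each of the normal forms is itself a cubic form, of the type under which it is listed
    (∀ t : CubicType, t.normalForms.Nonempty ∧
      ∀ p ∈ t.normalForms, ∃ f : RealForm 3 3,
        (f : MvPolynomial (Fin 3) ℝ) = p ∧ CubicType.HasType f t) ∧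
    -- the maximal real rank is five, and it occurs exactly for three types
    (∀ f : RealForm 3 3, ∃ r : ℕ, r ≤ 5 ∧ IsRealRank f r) ∧
    (∀ f : RealForm 3 3, IsRealRank f 5 ↔
      (CubicType.HasType f .realConicPlusTangentLine ∨
        CubicType.HasType f .realConicPlusExternalLine ∨
        CubicType.HasType f .imaginaryTriangle)) ∧
    -- four is the only typical real rank
    (∀ r : ℕ, IsTypicalRealRank 3 3 r ↔ r = 4) := by
  simp only [hasType_iff, isRealRank_iff, isRealBorderRank_iff]
  refine ⟨fun f hf => ?_, fun f t h => ⟨h.hasRank, h.hasBorderRank⟩, fun t => ⟨?_, fun p hp => ?_⟩,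
    fun f => ?_, fun f => ⟨fun h => ?_, ?_⟩, fun r =>
      ⟨eq_four_of_isTypicalRealRank, fun h => h ▸ isTypicalRealRank_four⟩⟩
  · obtain ⟨t, ht⟩ := exists_hasNormalForm (mt cubicVec_eq_zero.1 hf)
    exact ⟨t, ht, fun t' ht' => ht'.unique ht⟩
  · exact ⟨_, cubicForm_normalVec_mem (lam := 2) (by norm_num) two_ne_zero (by norm_num) t⟩
  · obtain ⟨lam, h1, h2, h3, rfl⟩ := exists_lam_of_mem_normalForms hp
    exact ⟨cubicForm (normalVec lam t), rfl, lam, h1, h2, h3, by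
      rw [cubicVec_cubicForm]; exact .refl _⟩
  · by_cases hf : cubicVec f = 0
    · exact ⟨0, by norm_num, hf ▸ hasRank_zero⟩
    · obtain ⟨t, ht⟩ := exists_hasNormalForm hf
      exact ⟨_, by cases t <;> decide, ht.hasRank⟩
  · have hf : cubicVec f ≠ 0 := fun hf => absurd (h.unique (hf ▸ hasRank_zero)) (by norm_num)
    obtain ⟨t, ht⟩ := exists_hasNormalForm hf
    have ht5 := ht.hasRank.unique h
    cases t <;> first
      | exact absurd ht5 (by decide)
      | exact .inl ht
      | exact .inr (.inl ht)
      | exact .inr (.inr ht)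
  · rintro (h | h | h) <;> exact h.hasRank
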